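/- **Setting.** Let $(X,Y)$ take values in $\mathbb R^{d_1}\times\mathbb R^{d_2}$, $d=d_1+d_2$, where $X$ has density $f_X$ and $Y$ has conditional density $f(x,\cdot)$ given $X=x$. Fix $w=(x,y)\in\mathbb R^d$. Let $p\ge 1$ be an integer and let $K:\mathbb R\to\mathbb R$ be a compactly supported $\mathcal C^1$ function with $\int K=1$, $\int t^\ell K(t)\,dt=0$ for $1\le\ell\le p-1$ and $\int t^pK(t)\,dt\ne0$, whose support is an interval with $0$ in its interior. Put $J(t)=K(t)+tK'(t)$, and let $\|\cdot\|_2$ be the norm of $L^2(\mathbb R)$. Let $\beta\in(0,1)$ and $a>1$. Set $\mathcal U_n(u)=\{u': u'_j=u_j-z_j/\log n,\ z_j\in\mathrm{supp}\,K \text{ for all } j\}$, and write $\|g\|_{\infty,\mathcal U}=\sup_{\mathcal U}|g|$. **Procedure.** For a function $\tilde f_X$ (the estimator of $f_X$), data $W_i=(X_i,Y_i)$, $i=1,\dots,n$, and a bandwidth $h\in(0,\infty)^d$, let $$\hat f_h(w)=\frac1n\sum_{i=1}^n\frac1{\tilde f_X(X_i)}\prod_{j=1}^d h_j^{-1}K\Big(\frac{w_j-W_{ij}}{h_j}\Big),\qquad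 Z_{hj}=\frac{\partial}{\partial h_j}\hat f_h(w),\qquad \lambda_{hj}=C_\lambda\sqrt{\frac{(\log n)^a}{n h_j^2\prod_k h_k}},$$ with $C_\lambda=4\|J\|_2\|K\|_2^{d-1}$. CDRodeo starts from $h=(1/\log n,\dots,1/\log n)$ with all $d$ variables active. While some variable is active and $\prod_kh_k\ge\frac{\log n}n$, it computes $Z_{hj}$ and $\lambda_{hj}$ at the current $h$ for all active $j$; then each active $j$ with $|Z_{hj}|\ge\lambda_{hj}$ has $h_j$ replaced by $\beta h_j$, and every other active $j$ is deactivated. The final $h$ is $\hat h$. **Assumptions.** For some $n_0\ge2$ and some set $\mathcal R$ of $r$ coordinates: - (A1) $\inf_{\mathcal U_{n_0}(x)}f_X>0$. - (A2) On $\mathcal U_{n_0}(w)$ the value of $f$ depends only on the coordinates in $\mathcal R$. - (A3) $f$ is $\mathcal C^p$ on $\mathcal U_{n_0}(w)$, and $\partial_j^pf(w)\neq0$ for all $j\in\mathcal R$. **Constants.** Write $\delta_n=\inf_{\mathcal U_n(x)}f_X$ and $$C_\tau=\Big(\frac{4(p-1)!\,C_\lambda}{\min_{j\in\mathcal R}|\partial_j^pf(w)|\int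 t^pK(t)\,dt}\Big)^2,\qquad C_T=\Big(\frac{\min_{j\in\mathcal R}|\partial^p_jf(w)|}{24\max_{j\in\mathcal R}|\partial_j^pf(w)|}\Big)^2,$$ $$\tau_n=\frac{1}{(2p+r)\log\frac1\beta}\log\Big(\frac{n}{C_\tau(\log n)^{2p+d+a}}\Big),\qquad T_n=\tau_n+\frac{\log(C_T^{-1})}{(2p+1)\log\frac1\beta}.$$ For an integer $m$ let $\mathcal H_n(m)$ be the set of $h$ with $h_j=\beta^{\theta_j}/\log n$, where $\theta_j$ is an integer with $\lfloor\tau_n\rfloor+1\le\theta_j\le m$ if $j\in\mathcal R$, and $\theta_j=0$ if $j\notin\mathcal R$. Let $\mathcal H_{\rm hp}=\mathcal H_n(\lceil T_n\rceil)$. **Theorem.** Let $M_X>0$ and $q>0$. There is an $N$ such that the following holds for every $n\ge N$, every i.i.d. sample $W_1,\dots,W_n$ of $(X,Y)$, and every random function $\tilde f_X$ such that - (i) almost surely $\inf_{\mathcal U_n(x)}\tilde f_X>0$; - (ii) $\displaystyle\mathbb P\Big(\sup_{u\in\mathcal U_n(x)}\Big|\frac{f_X(u)-\tilde f_X(u)}{\tilde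 f_X(u)}\Big|>M_X\frac{(\log n)^{d/2}}{n^{1/2}}\Big)\le \exp(-(\log n)^{5/4})$. 1. $\mathbb P(\hat h\in\mathcal H_{\rm hp})\ge1-n^{-q}$. If moreover $36\,\beta^{2p+1}>1$, then $\mathbb P(\hat h\in\mathcal H_n(\lfloor T_n\rfloor))\ge1-n^{-q}$. 2. If $\mathcal R\ne\emptyset$, then with probability at least $1-2n^{-q}$ $$|\hat f_{\hat h}(w)-f(w)|\le C(\log n)^{\frac{p}{2p+r}(d-r+a)}\,n^{-\frac p{2p+r}},$$ where $$C=2rC_\tau^{\frac p{2p+r}}\int\Big|\frac{t^p}{p!}K(t)\Big|dt\ \max_{k\in\mathcal R}\|\partial_k^pf\|_{\infty,\mathcal U_n(w)}+4\|K\|_2^d\,\|f\|_{\infty,\mathcal U_n(w)}^{1/2}\,\delta_n^{-1/2}\,C_T^{\frac{-r}{2(2p+1)}}C_\tau^{\frac{-r}{2(2p+r)}}.$$ -/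

import Mathlib

open MeasureTheory ProbabilityTheory

noncomputable section

namespace CDRodeo

/-! ### Neighbourhoods, extrema over a set, partial derivatives -/

/-- The neighbourhood `U_h(u) = {u' : u'_j = u_j - h_j z_j for all j, with every z_j in supp K}`;
the support is the closed support. -/
def nbhd {ι : Type*} (K : ℝ → ℝ) (h u : ι → ℝ) : Set (ι → ℝ) :=
  {u' | ∃ z : ι → ℝ, (∀ j, z j ∈ tsupport K) ∧ ∀ j, u' j = u j - h j * z j}

/-- The initial bandwidth `(1 / log n, …, 1 / log n)`. -/
def initBandwidth (ι : Type*) (n : ℕ) : ι → ℝ := fun _ => 1 / Real.log n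

/-- `U_n(u)`, the neighbourhood attached to the initial bandwidth. -/
def nbhdN {ι : Type*} (K : ℝ → ℝ) (n : ℕ) (u : ι → ℝ) : Set (ι → ℝ) :=
  nbhd K (initBandwidth ι n) u

/-- The supremum norm of `g` over `U`. -/
def supOn {E : Type*} (g : E → ℝ) (U : Set E) : ℝ := sSup ((fun u => |g u|) '' U)

/-- The infimum of `g` over `U`. -/
def infOn {E : Type*} (g : E → ℝ) (U : Set E) : ℝ := sInf (g '' U)

/-- The pure partial derivative `∂_j^p g (u)` of order `p` in direction `j`. -/
def partialD {ι : Type*} [DecidableEq ι] (p : ℕ) (g : (ι → ℝ) → ℝ) (j : ι) (u : ι → ℝ) : ℝ :=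
  iteratedDeriv p (fun t => g (Function.update u j t)) (u j)

/-- The `x`-part of a point `(x, y)` of `ℝ^{d₁} × ℝ^{d₂}`; the coordinates of the product are
indexed by `Fin d₁ ⊕ Fin d₂`. -/
def xPart {d₁ d₂ : ℕ} (u : Fin d₁ ⊕ Fin d₂ → ℝ) : Fin d₁ → ℝ := fun j => u (Sum.inl j)

/-! ### Kernels -/

/-- A compactly supported `C^1` kernel of order `p`, whose support is an interval with `0` in its
interior, so that `U_h(u)` is a neighbourhood of `u` that grows with `h`. -/
structure IsKernel (p : ℕ) (K : ℝ → ℝ) : Prop where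
  contDiff : ContDiff ℝ 1 K
  compactSupport : HasCompactSupport K
  convexSupport : Convex ℝ (tsupport K)
  zero_mem : (0 : ℝ) ∈ interior (tsupport K)
  integral_eq_one : ∫ t, K t = 1
  moment_zero : ∀ l : ℕ, 1 ≤ l → l ≤ p - 1 → ∫ t, t ^ l * K t = 0
  moment_ne_zero : ∫ t, t ^ p * K t ≠ 0

/-- The function `J(t) = K(t) + t K'(t)`. -/
def kernelJ (K : ℝ → ℝ) (t : ℝ) : ℝ := K t + t * deriv K t

/-- The `L²` norm of a function on the real line. -/
def l2norm (g : ℝ → ℝ) : ℝ := Real.sqrt (∫ t, g t ^ 2)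

/-! ### The statistical model -/

/-- The function `fX` is a probability density on `ℝ^{d₁}`, and `f(x, ·)` is a probability density on `ℝ^{d₂}`
for almost every `x` under the law with density `fX`. -/
structure IsCondDensity {d₁ d₂ : ℕ} (fX : (Fin d₁ → ℝ) → ℝ)
    (f : (Fin d₁ ⊕ Fin d₂ → ℝ) → ℝ) : Prop where
  measurable_fX : Measurable fX
  nonneg_fX : ∀ x, 0 ≤ fX x
  lintegral_fX : ∫⁻ x, ENNReal.ofReal (fX x) = 1
  measurable_f : Measurable f
  nonneg_f : ∀ u, 0 ≤ f u
  lintegral_f : ∀ᵐ x ∂(volume.withDensity fun x => ENNReal.ofReal (fX x)),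
    ∫⁻ y : Fin d₂ → ℝ, ENNReal.ofReal (f (Sum.elim x y)) = 1

/-- `W_1, …, W_n` are i.i.d. copies of `(X, Y)`, where `X` has density `fX` and `Y` has conditional
density `f(x, ·)` given `X = x`; that is, the common law has density `fX(x) f(x, y)`. -/
structure IsSample {d₁ d₂ n : ℕ} {Ω : Type*} [MeasurableSpace Ω] (P : Measure Ω)
    (W : Fin n → Ω → Fin d₁ ⊕ Fin d₂ → ℝ) (fX : (Fin d₁ → ℝ) → ℝ)
    (f : (Fin d₁ ⊕ Fin d₂ → ℝ) → ℝ) : Prop where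
  measurable : ∀ i, Measurable (W i)
  indep : iIndepFun W P
  law : ∀ i, P.map (W i) = volume.withDensity fun u => ENNReal.ofReal (fX (xPart u) * f u)

/-- Sparsity: on `U_n(w)` the function `f` depends only on the coordinates in `R`. -/
def IsSparse {d₁ d₂ : ℕ} (K : ℝ → ℝ) (n : ℕ) (f : (Fin d₁ ⊕ Fin d₂ → ℝ) → ℝ)
    (w : Fin d₁ ⊕ Fin d₂ → ℝ) (R : Finset (Fin d₁ ⊕ Fin d₂)) : Prop :=
  ∀ u ∈ nbhdN K n w, ∀ u' ∈ nbhdN K n w, (∀ j ∈ R, u j = u' j) → f u = f u'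

/-- Regularity: `f` is `C^p` on `U_n(w)`, and `∂_j^p f(w) ≠ 0` for every `j` in `R`. -/
def IsRegular {d₁ d₂ : ℕ} (p : ℕ) (K : ℝ → ℝ) (n : ℕ) (f : (Fin d₁ ⊕ Fin d₂ → ℝ) → ℝ)
    (w : Fin d₁ ⊕ Fin d₂ → ℝ) (R : Finset (Fin d₁ ⊕ Fin d₂)) : Prop :=
  ContDiffOn ℝ p f (nbhdN K n w) ∧ ∀ j ∈ R, partialD p f j w ≠ 0

/-- The two conditions on the (random) estimator `g` of `fX`, at sample size `n`: almost surely its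
infimum over `U_n(x)` is positive, and the supremum over `U_n(x)` of its relative error exceeds
`M (log n)^{d/2} n^{-1/2}` with probability at most `exp (-(log n)^{5/4})`. The supremum exceeds
a bound exactly when some value does. -/
structure EstimatorConditions {d₁ : ℕ} {Ω : Type*} [MeasurableSpace Ω] (P : Measure Ω)
    (K : ℝ → ℝ) (d n : ℕ) (fX : (Fin d₁ → ℝ) → ℝ) (x : Fin d₁ → ℝ) (M : ℝ)
    (g : Ω → (Fin d₁ → ℝ) → ℝ) : Prop where
  lower : ∀ᵐ ω ∂P, 0 < infOn (g ω) (nbhdN K n x)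
  accuracy : P.real {ω | ∃ u ∈ nbhdN K n x,
      M * (Real.log n ^ ((d : ℝ) / 2) / (n : ℝ) ^ ((1 : ℝ) / 2)) < |(fX u - g ω u) / g ω u|}
    ≤ Real.exp (-(Real.log n ^ ((5 : ℝ) / 4)))

/-! ### The estimator and the bandwidth selection -/

/-- The kernel estimator of `f(w)` with bandwidth `h`, computed from the data `W` with the
function `g` in place of the marginal density. -/
def fhat {d₁ d₂ n : ℕ} (K : ℝ → ℝ) (g : (Fin d₁ → ℝ) → ℝ) (W : Fin n → Fin d₁ ⊕ Fin d₂ → ℝ)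
    (w h : Fin d₁ ⊕ Fin d₂ → ℝ) : ℝ :=
  1 / (n : ℝ) * ∑ i, 1 / g (xPart (W i)) * ∏ j, (h j)⁻¹ * K ((w j - W i j) / h j)

/-- The statistic `Z_{hj}`, the partial derivative of the estimator in `h_j`. -/
def statZ {d₁ d₂ n : ℕ} (K : ℝ → ℝ) (g : (Fin d₁ → ℝ) → ℝ) (W : Fin n → Fin d₁ ⊕ Fin d₂ → ℝ)
    (w h : Fin d₁ ⊕ Fin d₂ → ℝ) (j : Fin d₁ ⊕ Fin d₂) : ℝ :=
  deriv (fun s => fhat K g W w (Function.update h j s)) (h j)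

/-- The constant `C_λ = 4 ‖J‖₂ ‖K‖₂^{d-1}`. -/
def cLam (K : ℝ → ℝ) (d : ℕ) : ℝ := 4 * l2norm (kernelJ K) * l2norm K ^ (d - 1)

/-- The threshold `λ_{hj} = C_λ √((log n)^a / (n h_j² ∏_k h_k))`. -/
def threshold {d₁ d₂ : ℕ} (K : ℝ → ℝ) (a : ℝ) (n : ℕ) (h : Fin d₁ ⊕ Fin d₂ → ℝ)
    (j : Fin d₁ ⊕ Fin d₂) : ℝ :=
  cLam K (d₁ + d₂) * Real.sqrt (Real.log n ^ a / (n * h j ^ 2 * ∏ k, h k))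

/-- The state of the algorithm: the current bandwidth and the set of active variables. -/
structure State (ι : Type*) where
  h : ι → ℝ
  active : Finset ι

/-- The condition of the while loop: some variable is active, and `∏_k h_k ≥ log n / n`. -/
def State.Continues {ι : Type*} [Fintype ι] (n : ℕ) (s : State ι) : Prop :=
  s.active.Nonempty ∧ Real.log n / n ≤ ∏ k, s.h k

open Classical in
/-- One iteration of the loop, with the tests `|Z_{hj}| ≥ λ_{hj}` of all active `j` made at
the bandwidth `h` that is current when the iteration begins: an active `h_j` that passes
is multiplied by `β`, an active `j` that fails is deactivated. -/
def State.next {ι : Type*} (Z lam : (ι → ℝ) → ι → ℝ) (β : ℝ) (s : State ι) : State ι where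
  h := fun j => if j ∈ s.active ∧ lam s.h j ≤ |Z s.h j| then β * s.h j else s.h j
  active := s.active.filter fun j => lam s.h j ≤ |Z s.h j|

/-- The state after `t` iterations from the initial bandwidth with all variables active. -/
def stateAt {ι : Type*} [Fintype ι] (Z lam : (ι → ℝ) → ι → ℝ) (β : ℝ) (n t : ℕ) : State ι :=
  (State.next Z lam β)^[t] ⟨initBandwidth ι n, Finset.univ⟩

open Classical in
/-- The bandwidth at the first time at which the condition of the loop fails. There is such a
time whenever `2 ≤ n` and `0 < β < 1`, see `exists_not_continues`. -/
def output {ι : Type*} [Fintype ι] (Z lam : (ι → ℝ) → ι → ℝ) (β : ℝ) (n : ℕ) : ι → ℝ :=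
  if H : ∃ t, ¬ (stateAt Z lam β n t).Continues n then (stateAt Z lam β n (Nat.find H)).h
  else initBandwidth ι n

theorem exists_not_continues {ι : Type*} [Fintype ι] (Z lam : (ι → ℝ) → ι → ℝ) {β : ℝ}
    (hβ : β ∈ Set.Ioo (0 : ℝ) 1) {n : ℕ} (hn : 2 ≤ n) :
    ∃ t, ¬ (stateAt Z lam β n t).Continues n := by
  classical
  by_contra! hc
  have hlog : 0 < Real.log n := Real.log_pos (by exact_mod_cast hn)
  have hsucc : ∀ t, stateAt Z lam β n (t + 1) = (stateAt Z lam β n t).next Z lam β := by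
    intro t
    simp only [stateAt, Function.iterate_succ_apply']
  have hpos : ∀ t k, 0 < (stateAt Z lam β n t).h k := by
    intro t
    induction t with
    | zero => intro k; simp [stateAt, initBandwidth, hlog]
    | succ t ih =>
      intro k
      rw [hsucc]
      simp only [State.next]
      split_ifs
      · exact mul_pos hβ.1 (ih k)
      · exact ih k
  have hanti : Antitone fun t => (stateAt Z lam β n t).active := by
    apply antitone_nat_of_succ_le
    intro t
    rw [hsucc]
    exact Finset.filter_subset _ _
  obtain ⟨T, hT⟩ := WellFoundedGT.monotone_chain_condition
    (α := (Finset ι)ᵒᵈ) ⟨fun t => OrderDual.toDual (stateAt Z lam β n t).active, hanti⟩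
  have hact : ∀ t, T ≤ t → (stateAt Z lam β n t).active = (stateAt Z lam β n T).active :=
    fun t ht => (hT t ht).symm
  have hdec : ∀ t, T ≤ t →
      ∏ k, (stateAt Z lam β n (t + 1)).h k ≤ β * ∏ k, (stateAt Z lam β n t).h k := by
    intro t ht
    obtain ⟨j, hj⟩ := (hc t).1
    have hj' : j ∈ (stateAt Z lam β n (t + 1)).active := by
      rw [hact (t + 1) (by omega), ← hact t ht]; exact hj
    rw [hsucc] at hj' ⊢
    simp only [State.next, Finset.mem_filter] at hj'
    rw [← Finset.mul_prod_erase _ _ (Finset.mem_univ j),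
      ← Finset.mul_prod_erase _ (fun k => (stateAt Z lam β n t).h k) (Finset.mem_univ j),
      ← mul_assoc]
    have hnonneg : ∀ k, 0 ≤ ((stateAt Z lam β n t).next Z lam β).h k := by
      intro k; rw [← hsucc]; exact (hpos _ k).le
    apply mul_le_mul
    · simp [State.next, hj'.1, hj'.2]
    · apply Finset.prod_le_prod
      · intro k _; exact hnonneg k
      · intro k _
        simp only [State.next]
        split_ifs
        · nlinarith [hpos t k, hβ.2]
        · exact le_rfl
    · exact Finset.prod_nonneg fun k _ => hnonneg k
    · exact mul_nonneg hβ.1.le (hpos t j).le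
  have hgeom : ∀ m, ∏ k, (stateAt Z lam β n (T + m)).h k ≤
      β ^ m * ∏ k, (stateAt Z lam β n T).h k := by
    intro m
    induction m with
    | zero => simp
    | succ m ih =>
      calc _ ≤ β * ∏ k, (stateAt Z lam β n (T + m)).h k := hdec (T + m) (by omega)
        _ ≤ β * (β ^ m * ∏ k, (stateAt Z lam β n T).h k) :=
          mul_le_mul_of_nonneg_left ih hβ.1.le
        _ = _ := by ring
  have hlim : Filter.Tendsto (fun m : ℕ => β ^ m * ∏ k, (stateAt Z lam β n T).h k)
      Filter.atTop (nhds 0) := by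
    simpa using (tendsto_pow_atTop_nhds_zero_of_lt_one hβ.1.le hβ.2).mul_const
      (∏ k, (stateAt Z lam β n T).h k)
  have hq : 0 < Real.log n / n := div_pos hlog (by positivity)
  obtain ⟨m, hm⟩ := (hlim.eventually (gt_mem_nhds hq)).exists
  have h1 := (hc (T + m)).2
  have h2 := hgeom m
  linarith

/-- The bandwidth selected by CDRodeo. -/
def bandwidth {d₁ d₂ n : ℕ} (K : ℝ → ℝ) (β a : ℝ) (g : (Fin d₁ → ℝ) → ℝ)
    (W : Fin n → Fin d₁ ⊕ Fin d₂ → ℝ) (w : Fin d₁ ⊕ Fin d₂ → ℝ) : Fin d₁ ⊕ Fin d₂ → ℝ :=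
  output (statZ K g W w) (threshold K a n) β n

/-! ### The constants and the set of bandwidths -/

section Constants

variable {d₁ d₂ : ℕ} (p : ℕ) (K : ℝ → ℝ) (β a : ℝ) (f : (Fin d₁ ⊕ Fin d₂ → ℝ) → ℝ)
  (w : Fin d₁ ⊕ Fin d₂ → ℝ) (R : Finset (Fin d₁ ⊕ Fin d₂))

/-- The constant `C_τ`. -/
def cTau : ℝ :=
  (4 * ((p - 1).factorial : ℝ) * cLam K (d₁ + d₂) /
    ((⨅ j : R, |partialD p f j w|) * ∫ t, t ^ p * K t)) ^ 2

/-- The constant `C_T`. -/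
def cT : ℝ :=
  ((⨅ j : R, |partialD p f j w|) / (24 * ⨆ j : R, |partialD p f j w|)) ^ 2

/-- The number `τ_n`. -/
def tau (n : ℕ) : ℝ :=
  1 / ((2 * p + R.card) * Real.log (1 / β)) *
    Real.log (n / (cTau p K f w R * Real.log n ^ (2 * p + ((d₁ + d₂ : ℕ) : ℝ) + a)))

/-- The number `T_n`. -/
def bigT (n : ℕ) : ℝ :=
  tau p K β a f w R n + Real.log ((cT p f w R)⁻¹) / ((2 * p + 1) * Real.log (1 / β))

/-- The set of bandwidths `h` with `h_j = β^{θ_j} / log n`, where `θ_j` runs over the integers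
from `⌊τ_n⌋ + 1` to `m` if `j` is in `R`, and `θ_j = 0` otherwise. -/
def bandwidthSet (n : ℕ) (m : ℤ) : Set (Fin d₁ ⊕ Fin d₂ → ℝ) :=
  {h | ∃ θ : Fin d₁ ⊕ Fin d₂ → ℤ, ∀ j, h j = β ^ θ j / Real.log n ∧
    (j ∈ R → ⌊tau p K β a f w R n⌋ + 1 ≤ θ j ∧ θ j ≤ m) ∧ (j ∉ R → θ j = 0)}

/-- The constant `C` of the error bound. -/
def errorConst (fX : (Fin d₁ → ℝ) → ℝ) (n : ℕ) : ℝ :=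
  2 * R.card * cTau p K f w R ^ ((p : ℝ) / (2 * p + R.card)) *
      (∫ t, |t ^ p / (p.factorial : ℝ) * K t|) *
      (⨆ k : R, supOn (partialD p f k) (nbhdN K n w)) +
    4 * l2norm K ^ (d₁ + d₂) * supOn f (nbhdN K n w) ^ ((1 : ℝ) / 2) *
      infOn fX (nbhdN K n (xPart w)) ^ (-(1 : ℝ) / 2) *
      cT p f w R ^ (-(R.card : ℝ) / (2 * (2 * p + 1))) *
      cTau p K f w R ^ (-(R.card : ℝ) / (2 * (2 * p + R.card)))

/-- The rate `(log n)^{p (d - r + a) / (2p + r)} n^{-p / (2p + r)}`. -/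
def rate (n : ℕ) : ℝ :=
  Real.log n ^ ((p : ℝ) / (2 * p + R.card) * (((d₁ + d₂ : ℕ) : ℝ) - R.card + a)) *
    (n : ℝ) ^ (-((p : ℝ) / (2 * p + R.card)))

end Constants

end CDRodeo

end

open MeasureTheory CDRodeo

/-!
All the statistics of the algorithm are product kernel statistics: the estimator is the one with
kernel `K` in every coordinate, and `Z_{hj}` is `-1 / h_j` times the one with `J = (t K)'` in
coordinate `j` (`statZ_eq_kernelStat`). With the true marginal density, the expectation of such a
statistic is `∫ ∏ φ_k(z_k) f(w - h z) dz`, called `smooth` below.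

*Bias.* Taylor expansion in one coordinate against a kernel with vanishing moments
(`abs_smooth_sub_le`) gives the expectations (`exists_bias_bounds`): zero for `h_j Z_{hj}` when `j`
is irrelevant, since `∫ J = 0`, and of exact order `h_j ^ p |∂_j^p f(w)|` when `j` is relevant; the
bias of the estimator is at most `∑_{j ∈ R} h_j ^ p (|∂_j^p f(w)| |∫ t ^ p K| / p! + o(1))`.

*Deviations.* Let `s = √((log n) ^ a / (n ∏ h_k))`, so that `λ_{hj} = C_λ s / h_j`. As `a > 1`
and the loop runs only while `n ∏ h_k ≥ log n`, a Bernstein inequality bounds the probability of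
a deviation `ε s`, for each fixed `ε > 0`, by `2 exp(-c (log n) ^ ((a + 1) / 2))`. This beats every
power of `n`, hence also the number of bandwidths on the grid. The estimation of the marginal
density changes the statistics by `o(s)`: the relative error times the statistic of the absolute
kernel, which is controlled in the same way. Hence `eventually_exists_good_event`: outside an event
of probability `n ^ (-q)`, at all bandwidths of the grid, the statistics are within `ε s` of their
expectations. The estimator of the marginal density need not be measurable, as only
the subadditivity of outer measure is used.

*Selection.* On this event the irrelevant coordinates fail the first test. A relevant one passes as
long as `h_j ^ (2 p) ≥ C_τ s ^ 2`, which holds up to time `τ_n`, and fails once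
`h_j ^ (2 p) ≤ ϱ ^ 2 C_τ s ^ 2` for some `ϱ < min |∂_j^p f(w)| / (4 max |∂_j^p f(w)|)`, which
holds from time `T_n` on, and already from time `T_n - 1` on if `36 β ^ (2 p + 1) > 1`
(`exists_eventually_bandwidth_mem`, on the path analysis `output_eq_gridBandwidth`).

*Error.* For the selected bandwidths `s` is at most a constant times `(β ^ τ_n / log n) ^ p`, a
constant times the rate. The stochastic error `ε s` and the remainder of the bias are
therefore absorbed by the factor `2` in front of the bias term of the constant
(`exists_eventually_abs_fhat_sub_le`).
-/

namespace CDRodeo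

/-! ### One-dimensional kernels -/

theorem continuous_kernelJ {K : ℝ → ℝ} (hK : ContDiff ℝ 1 K) : Continuous (kernelJ K) :=
  hK.continuous.add (continuous_id.mul (hK.continuous_deriv le_rfl))

theorem kernelJ_eq_zero {K : ℝ → ℝ} {t : ℝ} (ht : t ∉ tsupport K) : kernelJ K t = 0 := by
  have h1 : deriv K t = 0 := by
    by_contra h
    exact ht (support_deriv_subset h)
  simp [kernelJ, image_eq_zero_of_notMem_tsupport ht, h1]

theorem hasDerivAt_pow_mul_kernel {K : ℝ → ℝ} (hK : ContDiff ℝ 1 K) (l : ℕ) (t : ℝ) :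
    HasDerivAt (fun t => t ^ (l + 1) * K t) (t ^ l * kernelJ K t + l * (t ^ l * K t)) t := by
  have h1 : HasDerivAt K (deriv K t) t := (hK.differentiable one_ne_zero t).hasDerivAt
  have h2 := (hasDerivAt_pow (l + 1) t).mul h1
  convert! h2 using 1
  simp only [kernelJ, Nat.add_sub_cancel]
  push_cast
  ring

theorem integrable_of_eq_zero_off {ψ : ℝ → ℝ} (hψ : Continuous ψ) {S : Set ℝ} (hS : IsCompact S)
    (h0 : ∀ t ∉ S, ψ t = 0) : Integrable ψ :=
  hψ.integrable_of_hasCompactSupport (HasCompactSupport.intro hS h0)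

/-- Integration by parts: the moments of `J = (t K)'`. -/
theorem integral_pow_mul_kernelJ {K : ℝ → ℝ} (hK : ContDiff ℝ 1 K) (hc : HasCompactSupport K)
    (l : ℕ) : ∫ t, t ^ l * kernelJ K t = -(l * ∫ t, t ^ l * K t) := by
  have hJ := continuous_kernelJ hK
  have hKc := hK.continuous
  have i1 : Integrable fun t => t ^ l * kernelJ K t :=
    integrable_of_eq_zero_off (by fun_prop) hc.isCompact
      fun t ht => by rw [kernelJ_eq_zero ht, mul_zero]
  have i2 : ∀ l : ℕ, Integrable fun t => t ^ l * K t := fun l =>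
    integrable_of_eq_zero_off (by fun_prop) hc.isCompact
      fun t ht => by rw [image_eq_zero_of_notMem_tsupport ht, mul_zero]
  have := integral_eq_zero_of_hasDerivAt_of_integrable (hasDerivAt_pow_mul_kernel hK l)
    (i1.add ((i2 l).const_mul l)) (i2 (l + 1))
  rw [integral_add i1 ((i2 l).const_mul l), integral_const_mul] at this
  linarith

theorem integral_kernelJ {K : ℝ → ℝ} (hK : ContDiff ℝ 1 K) (hc : HasCompactSupport K) :
    ∫ t, kernelJ K t = 0 := by
  simpa using integral_pow_mul_kernelJ hK hc 0

theorem l2norm_pos {g : ℝ → ℝ} (hg : Continuous g) (hc : HasCompactSupport g) {t : ℝ}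
    (ht : g t ≠ 0) : 0 < l2norm g := by
  refine Real.sqrt_pos.2 ?_
  have hcont : Continuous fun t => g t ^ 2 := by fun_prop
  refine hcont.integral_pos_of_hasCompactSupport_nonneg_nonzero ?_ (fun t => sq_nonneg _)
    (x := t) (pow_ne_zero 2 ht)
  exact HasCompactSupport.intro hc.isCompact fun t ht => by
    rw [image_eq_zero_of_notMem_tsupport ht]; simp

theorem cLam_pos {p : ℕ} {K : ℝ → ℝ} (hK : IsKernel p K) (d : ℕ) : 0 < cLam K d := by
  have hK0 : ∃ t, K t ≠ 0 := by
    by_contra! h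
    have := hK.integral_eq_one
    simp [h] at this
  have hJ0 : ∃ t, kernelJ K t ≠ 0 := by
    by_contra! h
    -- otherwise `t K(t)` is constant, so `K` vanishes off `0`
    have hd : ∀ t, HasDerivAt (fun t => t ^ (0 + 1) * K t) 0 t := fun t => by
      simpa [h] using hasDerivAt_pow_mul_kernel hK.contDiff 0 t
    have hconst := is_const_of_deriv_eq_zero (fun t => (hd t).differentiableAt)
      (fun t => (hd t).deriv)
    have hz : ∀ t, t * K t = 0 := fun t => by simpa using hconst t 0
    have hae : K =ᵐ[volume] 0 := by
      have : ∀ᵐ t : ℝ, t ≠ 0 := by simp [ae_iff]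
      filter_upwards [this] with t ht
      exact (mul_eq_zero.1 (hz t)).resolve_left ht
    have := hK.integral_eq_one
    rw [integral_congr_ae hae] at this
    simp at this
  obtain ⟨s, hs⟩ := hK0
  obtain ⟨t, ht⟩ := hJ0
  have h1 := l2norm_pos hK.contDiff.continuous hK.compactSupport hs
  have h2 := l2norm_pos (continuous_kernelJ hK.contDiff)
    (HasCompactSupport.intro hK.compactSupport.isCompact fun t => kernelJ_eq_zero) ht
  unfold cLam
  positivity

/-! ### Taylor expansion against a kernel -/

theorem abs_sub_taylor_le {p : ℕ} (hp : 1 ≤ p) {g : ℝ → ℝ} {U : Set ℝ} (hU : IsOpen U)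
    (hg : ContDiffOn ℝ p g U) {x₀ x D ε : ℝ} (hx : Set.uIcc x₀ x ⊆ U)
    (hD : ∀ ξ ∈ Set.uIcc x₀ x, |iteratedDeriv p g ξ - D| ≤ ε) :
    |g x - (∑ l ∈ Finset.range p, (l.factorial : ℝ)⁻¹ * (x - x₀) ^ l * iteratedDeriv l g x₀) -
      D * (x - x₀) ^ p / p.factorial| ≤ ε * |x - x₀| ^ p := by
  obtain ⟨m, rfl⟩ := Nat.exists_eq_add_of_le' hp
  rcases eq_or_ne x₀ x with rfl | hne
  · simp [Finset.sum_range_succ']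
  have hg' : ContDiffOn ℝ (m + 1) g (Set.uIcc x₀ x) := by
    simpa using hg.mono hx
  obtain ⟨ξ, hξ, h⟩ := taylor_mean_remainder_lagrange_iteratedDeriv hne hg'
  have hat : ContDiffAt ℝ (m + 1) g x₀ := by
    simpa using hg.contDiffAt (hU.mem_nhds (hx Set.left_mem_uIcc))
  have hT : taylorWithinEval g m (Set.uIcc x₀ x) x₀ x =
      ∑ l ∈ Finset.range (m + 1), (l.factorial : ℝ)⁻¹ * (x - x₀) ^ l * iteratedDeriv l g x₀ := by
    rw [taylor_within_apply]
    refine Finset.sum_congr rfl fun l hl => ?_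
    rw [smul_eq_mul, iteratedDerivWithin_eq_iteratedDeriv (uniqueDiffOn_uIcc hne) _
      Set.left_mem_uIcc]
    refine hat.of_le ?_
    have : l ≤ m + 1 := (Finset.mem_range.1 hl).le
    exact_mod_cast this
  rw [hT] at h
  rw [h]
  have hξ' := hD ξ (Set.uIoo_subset_uIcc_self hξ)
  have e : iteratedDeriv (m + 1) g ξ * (x - x₀) ^ (m + 1) / (m + 1).factorial -
      D * (x - x₀) ^ (m + 1) / (m + 1).factorial =
      (iteratedDeriv (m + 1) g ξ - D) * ((x - x₀) ^ (m + 1) / (m + 1).factorial) := by ring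
  rw [e, abs_mul, abs_div, abs_pow, Nat.abs_cast]
  have hε : 0 ≤ ε := (abs_nonneg _).trans hξ'
  gcongr
  refine div_le_self (by positivity) ?_
  exact_mod_cast Nat.factorial_pos _

/-- A kernel whose moments of orders `1, …, p - 1` vanish sees only the term of order `p` of
the Taylor expansion of `g`, after the constant term is removed. -/
theorem abs_integral_kernel_sub_le {p : ℕ} (hp : 1 ≤ p) {g ψ : ℝ → ℝ} {U S : Set ℝ}
    (hU : IsOpen U) (hg : ContDiffOn ℝ p g U) (hS : IsCompact S) (hψ : Continuous ψ)
    (hψ0 : ∀ t ∉ S, ψ t = 0) (hmom : ∀ l : ℕ, 1 ≤ l → l < p → ∫ t, t ^ l * ψ t = 0)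
    {x₀ h D ε : ℝ} (hh : 0 ≤ h) (hx : ∀ t ∈ S, Set.uIcc x₀ (x₀ - h * t) ⊆ U)
    (hD : ∀ t ∈ S, ∀ ξ ∈ Set.uIcc x₀ (x₀ - h * t), |iteratedDeriv p g ξ - D| ≤ ε) :
    |(∫ t, ψ t * (g (x₀ - h * t) - g x₀)) - D * (-h) ^ p / p.factorial * ∫ t, t ^ p * ψ t| ≤
      ε * h ^ p * ∫ t, |t| ^ p * |ψ t| := by
  have ipow : ∀ l : ℕ, Integrable fun t => t ^ l * ψ t := fun l =>
    integrable_of_eq_zero_off (by fun_prop) hS fun t ht => by rw [hψ0 t ht, mul_zero]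
  have iabs : Integrable fun t => |t| ^ p * |ψ t| :=
    integrable_of_eq_zero_off (by fun_prop) hS fun t ht => by simp [hψ0 t ht]
  have ig : Integrable fun t => ψ t * (g (x₀ - h * t) - g x₀) := by
    have hcont : ContinuousOn (fun t => ψ t * (g (x₀ - h * t) - g x₀)) S := by
      refine hψ.continuousOn.mul (ContinuousOn.sub ?_ continuousOn_const)
      refine hg.continuousOn.comp (by fun_prop) fun t ht => hx t ht Set.right_mem_uIcc
    refine (integrableOn_iff_integrable_of_support_subset ?_).1
      (hcont.integrableOn_compact hS)
    intro t ht
    by_contra h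
    exact ht (by simp [hψ0 t h])
  let a : ℕ → ℝ := fun l => (l.factorial : ℝ)⁻¹ * (-h) ^ l * iteratedDeriv l g x₀
  have isum : Integrable fun t => ∑ l ∈ Finset.Ico 1 p, a l * (t ^ l * ψ t) :=
    integrable_finsetSum _ fun l _ => (ipow l).const_mul _
  have hsum : ∫ t, ∑ l ∈ Finset.Ico 1 p, a l * (t ^ l * ψ t) = 0 := by
    rw [integral_finsetSum _ fun l _ => (ipow l).const_mul _]
    refine Finset.sum_eq_zero fun l hl => ?_
    rw [Finset.mem_Ico] at hl
    rw [integral_const_mul, hmom l hl.1 hl.2, mul_zero]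
  have e : (∫ t, ψ t * (g (x₀ - h * t) - g x₀)) -
      D * (-h) ^ p / p.factorial * ∫ t, t ^ p * ψ t =
      ∫ t, (ψ t * (g (x₀ - h * t) - g x₀) - (∑ l ∈ Finset.Ico 1 p, a l * (t ^ l * ψ t)) -
        D * (-h) ^ p / p.factorial * (t ^ p * ψ t)) := by
    have := integral_sub (ig.sub isum) ((ipow p).const_mul (D * (-h) ^ p / p.factorial))
    simp only [Pi.sub_apply] at this
    rw [this, integral_sub ig isum, hsum, integral_const_mul, sub_zero]
  rw [e, ← integral_const_mul]
  rw [← Real.norm_eq_abs]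
  refine norm_integral_le_of_norm_le (iabs.const_mul _) (Filter.Eventually.of_forall fun t => ?_)
  by_cases ht : t ∈ S
  · have key := abs_sub_taylor_le hp hU hg (hx t ht) (hD t ht)
    rw [Finset.range_eq_Ico, Finset.sum_eq_sum_Ico_succ_bot hp] at key
    have e1 : x₀ - h * t - x₀ = -h * t := by ring
    simp only [e1, mul_pow] at key
    have e2 : ψ t * (g (x₀ - h * t) - g x₀) - (∑ l ∈ Finset.Ico 1 p, a l * (t ^ l * ψ t)) -
        D * (-h) ^ p / p.factorial * (t ^ p * ψ t) =
        ψ t * (g (x₀ - h * t) - ((Nat.factorial 0 : ℝ)⁻¹ * ((-h) ^ 0 * t ^ 0) *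
          iteratedDeriv 0 g x₀ + ∑ l ∈ Finset.Ico (0 + 1) p, (l.factorial : ℝ)⁻¹ *
            ((-h) ^ l * t ^ l) * iteratedDeriv l g x₀) -
          D * ((-h) ^ p * t ^ p) / p.factorial) := by
      have : ∑ l ∈ Finset.Ico 1 p, a l * (t ^ l * ψ t) =
          ψ t * ∑ l ∈ Finset.Ico (0 + 1) p, (l.factorial : ℝ)⁻¹ *
            ((-h) ^ l * t ^ l) * iteratedDeriv l g x₀ := by
        rw [Finset.mul_sum, zero_add]
        exact Finset.sum_congr rfl fun l _ => by simp only [a]; ring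
      rw [this]
      simp only [Nat.factorial_zero, Nat.cast_one, inv_one, pow_zero, iteratedDeriv_zero]
      ring
    rw [e2, Real.norm_eq_abs, abs_mul]
    calc |ψ t| * _ ≤ |ψ t| * (ε * |-h * t| ^ p) := by gcongr
      _ = ε * h ^ p * (|t| ^ p * |ψ t|) := by
        rw [abs_mul, abs_neg, abs_of_nonneg hh]; ring
  · simp [hψ0 t ht]

/-! ### Integration along one coordinate -/

/-- The point with coordinate `j` equal to `t` and the other coordinates given by `b`. -/
def insertCoord {ι : Type*} [DecidableEq ι] (j : ι) (t : ℝ) (b : {k // ¬ k = j} → ℝ) : ι → ℝ :=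
  fun k => if hk : k = j then t else b ⟨k, hk⟩

theorem prod_eq_zero_off {ι : Type*} [Fintype ι] {φ : ι → ℝ → ℝ} {S : Set ℝ} (hφ : ∀ k, ∀ t ∉ S, φ k t = 0)
    {z : ι → ℝ} (hz : ¬ ∀ k, z k ∈ S) : ∏ k, φ k (z k) = 0 := by
  push Not at hz
  obtain ⟨k, hk⟩ := hz
  exact Finset.prod_eq_zero (Finset.mem_univ k) (hφ k _ hk)

theorem sub_mul_mem_ball {ι : Type*} [Fintype ι] {w h : ι → ℝ} {ρ : ℝ} {z : ι → ℝ} (hρ : 0 < ρ) :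
    (fun k => w k - h k * z k) ∈ Metric.ball w ρ ↔ ∀ k, |h k * z k| < ρ := by
  rw [Metric.mem_ball, dist_pi_lt_iff hρ]
  simp

theorem integrable_prod_mul {ι : Type*} [Fintype ι] {φ : ι → ℝ → ℝ} {S : Set ℝ} (hS : IsCompact S)
    (hc : ∀ k, Continuous (φ k)) (hφ : ∀ k, ∀ t ∉ S, φ k t = 0) {f : (ι → ℝ) → ℝ}
    {O : Set (ι → ℝ)} (hf : ContinuousOn f O) {w h : ι → ℝ}
    (hO : ∀ z : ι → ℝ, (∀ k, z k ∈ S) → (fun k => w k - h k * z k) ∈ O) :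
    Integrable fun z : ι → ℝ => (∏ k, φ k (z k)) * f (fun k => w k - h k * z k) := by
  have hcont : ContinuousOn (fun z : ι → ℝ => (∏ k, φ k (z k)) * f (fun k => w k - h k * z k))
      (Set.univ.pi fun _ => S) := by
    refine ContinuousOn.mul ?_ ?_
    · exact (continuous_finsetProd _ fun k _ => (hc k).comp (continuous_apply k)).continuousOn
    · exact hf.comp (by fun_prop) fun z hz => hO z fun k => hz k (Set.mem_univ k)
  refine (integrableOn_iff_integrable_of_support_subset ?_).1
    (hcont.integrableOn_compact (isCompact_univ_pi fun _ => hS))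
  intro z hz
  by_contra h
  exact hz (by simp [prod_eq_zero_off hφ fun h' => h fun k _ => h' k])

section Coordinates

variable {ι : Type*} [DecidableEq ι]

theorem insertCoord_self (j : ι) (t : ℝ) (b : {k // ¬ k = j} → ℝ) : insertCoord j t b j = t := by
  simp [insertCoord]

theorem insertCoord_coe (j : ι) (t : ℝ) (b : {k // ¬ k = j} → ℝ) (k : {k // ¬ k = j}) :
    insertCoord j t b k = b k := by
  simp [insertCoord, k.2]

theorem measurableEmbedding_insertCoord (j : ι) :
    MeasurableEmbedding (fun q : ℝ × ({k // ¬ k = j} → ℝ) => insertCoord j q.1 q.2) := by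
  have h1 := (MeasurableEquiv.piEquivPiSubtypeProd (fun _ : ι => ℝ) (· = j)).symm.measurableEmbedding
  have h2 := (((MeasurableEquiv.funUnique {k // k = j} ℝ).symm).prodCongr
    (MeasurableEquiv.refl ({k // ¬ k = j} → ℝ))).measurableEmbedding
  convert! h1.comp h2 using 1

theorem update_mul_insertCoord (j : ι) (w h : ι → ℝ) (s t : ℝ) (b : {k // ¬ k = j} → ℝ) :
    (fun k => w k - Function.update h j s k * insertCoord j t b k) =
      Function.update (fun k => w k - h k * insertCoord j 0 b k) j (w j - s * t) := by
  ext k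
  by_cases hk : k = j
  · subst hk; simp [insertCoord]
  · simp [insertCoord, hk]

variable [Fintype ι]

theorem measurePreserving_insertCoord (j : ι) :
    MeasurePreserving (fun q : ℝ × ({k // ¬ k = j} → ℝ) => insertCoord j q.1 q.2)
      (volume.prod volume) volume := by
  have h1 := (volume_preserving_piEquivPiSubtypeProd (fun _ : ι => ℝ) (· = j)).symm
  have h2 := (volume_preserving_funUnique {k // k = j} ℝ).symm
  have h3 : MeasurePreserving (Prod.map (MeasurableEquiv.funUnique {k // k = j} ℝ).symm id)
      ((volume : Measure ℝ).prod (volume : Measure ({k // ¬ k = j} → ℝ)))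
      ((@volume _ (@MeasureSpace.pi _ (Subtype.fintype fun x => x = j) _ _)).prod volume) := by
    convert h2.prod (MeasurePreserving.id (volume : Measure ({k // ¬ k = j} → ℝ)))
  convert! h1.comp h3 using 1

theorem integrable_insertCoord (j : ι) {F : (ι → ℝ) → ℝ} (hF : Integrable F) :
    Integrable (fun q : ℝ × ({k // ¬ k = j} → ℝ) => F (insertCoord j q.1 q.2))
      (volume.prod volume) :=
  (measurePreserving_insertCoord j).integrable_comp_of_integrable hF

theorem integral_eq_integral_insertCoord (j : ι) {F : (ι → ℝ) → ℝ} (hF : Integrable F) :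
    ∫ z, F z = ∫ b : {k // ¬ k = j} → ℝ, ∫ t, F (insertCoord j t b) := by
  rw [← integral_prod_symm _ (integrable_insertCoord j hF)]
  exact ((measurePreserving_insertCoord j).integral_comp (measurableEmbedding_insertCoord j) F).symm

theorem prod_insertCoord (j : ι) (φ : ι → ℝ → ℝ) (t : ℝ) (b : {k // ¬ k = j} → ℝ) :
    ∏ k, φ k (insertCoord j t b k) = φ j t * ∏ k : {k // ¬ k = j}, φ k (b k) := by
  rw [Fintype.prod_eq_mul_prod_subtype_ne _ j, insertCoord_self]
  congr 1
  exact Finset.prod_congr rfl fun k _ => by rw [insertCoord_coe]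

/-! ### Product kernels applied to a function -/

/-- The expectation `∫ ∏ φ_k(z_k) f(w - h z) dz` of a product kernel statistic. -/
noncomputable def smooth (φ : ι → ℝ → ℝ) (f : (ι → ℝ) → ℝ) (w h : ι → ℝ) : ℝ :=
  ∫ z : ι → ℝ, (∏ k, φ k (z k)) * f (fun k => w k - h k * z k)

/-- A factor of mean zero annihilates a function that does not depend on its coordinate. -/
theorem smooth_update_zero {φ : ι → ℝ → ℝ} {S : Set ℝ} (hS : IsCompact S)
    (hc : ∀ k, Continuous (φ k)) (hφ : ∀ k, ∀ t ∉ S, φ k t = 0) {f : (ι → ℝ) → ℝ}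
    {O : Set (ι → ℝ)} (hf : ContinuousOn f O) {w h : ι → ℝ} {j : ι}
    (hO : ∀ z : ι → ℝ, (∀ k, z k ∈ S) → (fun k => w k - Function.update h j 0 k * z k) ∈ O)
    (hj : ∫ t, φ j t = 0) : smooth φ f w (Function.update h j 0) = 0 := by
  rw [smooth, integral_eq_integral_insertCoord j (integrable_prod_mul hS hc hφ hf hO)]
  refine (integral_congr_ae (Filter.Eventually.of_forall fun b => ?_)).trans (integral_zero _ _)
  simp only [update_mul_insertCoord, prod_insertCoord, zero_mul, sub_zero, mul_assoc]
  rw [integral_mul_const, hj, zero_mul]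

theorem contDiff_update (u : ι → ℝ) (j : ι) (p : ℕ) :
    ContDiff ℝ p (fun t : ℝ => Function.update u j t) := by
  refine contDiff_pi.2 fun k => ?_
  by_cases hk : k = j
  · subst hk; simpa using contDiff_fun_id
  · simpa [hk] using contDiff_const

/-- Setting one bandwidth to zero removes the bias term of order `p` of that coordinate. -/
theorem abs_smooth_sub_le {p : ℕ} (hp : 1 ≤ p) {φ : ι → ℝ → ℝ} {S : Set ℝ} (hS : IsCompact S)
    (hc : ∀ k, Continuous (φ k)) (hφ : ∀ k, ∀ t ∉ S, φ k t = 0) {f : (ι → ℝ) → ℝ}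
    {w h : ι → ℝ} {ρ : ℝ} (hρ : 0 < ρ) (hf : ContDiffOn ℝ p f (Metric.ball w ρ))
    (hO : ∀ z : ι → ℝ, (∀ k, z k ∈ S) → (fun k => w k - h k * z k) ∈ Metric.ball w ρ)
    {j : ι} (hh : 0 ≤ h j) (hmom : ∀ l : ℕ, 1 ≤ l → l < p → ∫ t, t ^ l * φ j t = 0)
    {D ε : ℝ} (hD : ∀ u ∈ Metric.ball w ρ, |partialD p f j u - D| ≤ ε) :
    |smooth φ f w h - smooth φ f w (Function.update h j 0) -
        D * (-h j) ^ p / p.factorial * (∫ t, t ^ p * φ j t) *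
          ∏ k : {k // ¬ k = j}, ∫ t, φ k t| ≤
      ε * h j ^ p * (∫ t, |t| ^ p * |φ j t|) * ∏ k : {k // ¬ k = j}, ∫ t, |φ k t| := by
  have hO' : ∀ z : ι → ℝ, (∀ k, z k ∈ S) →
      (fun k => w k - Function.update h j 0 k * z k) ∈ Metric.ball w ρ := by
    intro z hz
    have := (sub_mul_mem_ball hρ).1 (hO z hz)
    refine (sub_mul_mem_ball hρ).2 fun k => ?_
    by_cases hk : k = j
    · subst hk; simpa using hρ
    · simpa [hk] using this k
  have i1 := integrable_prod_mul hS hc hφ hf.continuousOn hO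
  have i2 := integrable_prod_mul hS hc hφ hf.continuousOn hO'
  set c : ℝ := D * (-h j) ^ p / p.factorial * (∫ t, t ^ p * φ j t) with hcdef
  set Φ : ({k // ¬ k = j} → ℝ) → ℝ := fun b => ∏ k : {k // ¬ k = j}, φ k (b k) with hΦ
  have iΦ : Integrable Φ := by
    have : Integrable (fun b : {k // ¬ k = j} → ℝ => ∏ k : {k // ¬ k = j}, φ k (b k)) :=
      Integrable.fintype_prod fun k => integrable_of_eq_zero_off (hc k) hS (hφ k)
    exact this
  have iΦa : Integrable fun b => |Φ b| := iΦ.abs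
  have eq1 : smooth φ f w h - smooth φ f w (Function.update h j 0) =
      ∫ b, Φ b * ∫ t, φ j t * (f (Function.update (fun k => w k - h k * insertCoord j 0 b k) j
          (w j - h j * t)) - f (Function.update (fun k => w k - h k * insertCoord j 0 b k) j
          (w j))) := by
    rw [smooth, smooth, ← integral_sub i1 i2]
    refine (integral_eq_integral_insertCoord j (i1.sub i2)).trans ?_
    refine integral_congr_ae (Filter.Eventually.of_forall fun b => ?_)
    simp only [Pi.sub_apply]
    rw [← integral_const_mul]
    refine integral_congr_ae (Filter.Eventually.of_forall fun t => ?_)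
    simp only [update_mul_insertCoord, prod_insertCoord, zero_mul, sub_zero, hΦ]
    have := update_mul_insertCoord j w h (h j) t b
    rw [Function.update_eq_self] at this
    rw [this]
    ring
  have eq2 : c * ∏ k : {k // ¬ k = j}, ∫ t, φ k t = ∫ b, Φ b * c := by
    rw [integral_mul_const, hΦ, integral_fintype_prod_volume_eq_prod, mul_comm]
  have eq3 : ∏ k : {k // ¬ k = j}, ∫ t, |φ k t| = ∫ b, |Φ b| := by
    simp only [hΦ, Finset.abs_prod]
    rw [integral_fintype_prod_volume_eq_prod (fun (k : {k // ¬ k = j}) t => |φ k t|)]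
  have iF : Integrable fun b => Φ b * ∫ t, φ j t *
      (f (Function.update (fun k => w k - h k * insertCoord j 0 b k) j
          (w j - h j * t)) - f (Function.update (fun k => w k - h k * insertCoord j 0 b k) j
          (w j))) := by
    refine (integrable_insertCoord j (i1.sub i2)).integral_prod_right.congr
      (Filter.Eventually.of_forall fun b => ?_)
    simp only [Pi.sub_apply]
    rw [← integral_const_mul]
    refine integral_congr_ae (Filter.Eventually.of_forall fun t => ?_)
    simp only [update_mul_insertCoord, prod_insertCoord, zero_mul, sub_zero, hΦ]
    have := update_mul_insertCoord j w h (h j) t b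
    rw [Function.update_eq_self] at this
    rw [this]
    ring
  rw [eq1, eq2, eq3, ← integral_sub iF (iΦ.mul_const c), ← integral_const_mul,
    ← Real.norm_eq_abs]
  refine norm_integral_le_of_norm_le (iΦa.const_mul _) (Filter.Eventually.of_forall fun b => ?_)
  rw [← mul_sub, Real.norm_eq_abs, abs_mul, mul_comm]
  by_cases hb : ∀ k, b k ∈ S
  · refine mul_le_mul_of_nonneg_right ?_ (abs_nonneg _)
    set u : ι → ℝ := fun k => w k - h k * insertCoord j 0 b k with hu
    have hball : ∀ t ∈ S, ∀ x ∈ Set.uIcc (w j) (w j - h j * t),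
        Function.update u j x ∈ Metric.ball w ρ := by
      intro t ht x hx
      have hz := (sub_mul_mem_ball hρ).1 (hO (insertCoord j t b) fun k => by
        by_cases hk : k = j
        · subst hk; rwa [insertCoord_self]
        · simpa [insertCoord, hk] using hb ⟨k, hk⟩)
      rw [Metric.mem_ball, dist_pi_lt_iff hρ]
      intro k
      by_cases hk : k = j
      · subst hk
        have h1 := hz k
        rw [insertCoord_self] at h1
        have h2 := Set.abs_sub_left_of_mem_uIcc hx
        rw [Function.update_self, Real.dist_eq]
        calc |x - w k| ≤ |w k - h k * t - w k| := h2
          _ = |h k * t| := by rw [sub_right_comm, sub_self, zero_sub, abs_neg]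
          _ < ρ := h1
      · have h1 := hz k
        simp only [insertCoord, hk, dif_neg, not_false_eq_true] at h1
        simpa [hk, hu, insertCoord, Real.dist_eq] using h1
    have hopen : IsOpen ((fun x : ℝ => Function.update u j x) ⁻¹' Metric.ball w ρ) :=
      Metric.isOpen_ball.preimage (contDiff_update u j p).continuous
    refine abs_integral_kernel_sub_le (g := fun x => f (Function.update u j x)) hp hopen
      (hf.comp (contDiff_update u j p).contDiffOn fun x hx => hx) hS (hc j) (hφ j) hmom hh
      (fun t ht x hx => hball t ht x hx) fun t ht x hx => ?_
    have := hD _ (hball t ht x hx)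
    simpa [partialD] using this
  · have : Φ b = 0 := prod_eq_zero_off (φ := fun k : {k // ¬ k = j} => φ k) (fun k => hφ k) hb
    simp [this]

/-- If `f` does not depend on coordinate `j`, neither does `smooth` on the bandwidth `h_j`. -/
theorem smooth_update_of_sparse {φ : ι → ℝ → ℝ} {S : Set ℝ} (hφ : ∀ k, ∀ t ∉ S, φ k t = 0)
    {f : (ι → ℝ) → ℝ} {O : Set (ι → ℝ)} {R : Finset ι}
    (hsp : ∀ u ∈ O, ∀ u' ∈ O, (∀ j ∈ R, u j = u' j) → f u = f u') {w h : ι → ℝ} {j : ι}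
    (hj : j ∉ R) (hO : ∀ z : ι → ℝ, (∀ k, z k ∈ S) → (fun k => w k - h k * z k) ∈ O)
    (hO' : ∀ z : ι → ℝ, (∀ k, z k ∈ S) → (fun k => w k - Function.update h j 0 k * z k) ∈ O) :
    smooth φ f w h = smooth φ f w (Function.update h j 0) := by
  unfold smooth
  congr 1 with z
  by_cases hz : ∀ k, z k ∈ S
  · rw [hsp _ (hO z hz) _ (hO' z hz) fun k hk => ?_]
    have : k ≠ j := fun e => hj (e ▸ hk)
    simp [this]
  · simp [prod_eq_zero_off hφ hz]

end Coordinates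

/-! ### The bias -/

/-- The kernels of `Z_{hj}`: `J` in coordinate `j`, and `K` in the others. -/
noncomputable def zKernel {ι : Type*} [DecidableEq ι] (K : ℝ → ℝ) (j : ι) : ι → ℝ → ℝ :=
  Function.update (fun _ => K) j (kernelJ K)

theorem continuous_zKernel {ι : Type*} [DecidableEq ι] {K : ℝ → ℝ} (hK : ContDiff ℝ 1 K) (j k : ι) :
    Continuous (zKernel K j k) := by
  by_cases hk : k = j
  · subst hk; simpa [zKernel] using continuous_kernelJ hK
  · simpa [zKernel, hk] using hK.continuous

theorem zKernel_eq_zero {ι : Type*} [DecidableEq ι] {K : ℝ → ℝ} (j k : ι) {t : ℝ} (ht : t ∉ tsupport K) :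
    zKernel K j k t = 0 := by
  by_cases hk : k = j
  · subst hk; simpa [zKernel] using kernelJ_eq_zero ht
  · simpa [zKernel, hk] using image_eq_zero_of_notMem_tsupport ht

theorem smooth_zero {ι : Type*} [Fintype ι] {K : ℝ → ℝ} (hK : ∫ t, K t = 1) (f : (ι → ℝ) → ℝ) (w : ι → ℝ) :
    smooth (fun _ => K) f w (fun _ => 0) = f w := by
  simp only [smooth, zero_mul, sub_zero]
  rw [integral_mul_const, integral_fintype_prod_volume_eq_prod (fun _ => K)]
  simp [hK]

section Bias

variable {ι : Type*} [DecidableEq ι] [Fintype ι]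

theorem partialD_succ {p : ℕ} {f : (ι → ℝ) → ℝ} {O : Set (ι → ℝ)} (hO : IsOpen O)
    (hf : DifferentiableOn ℝ f O) (j : ι) {u : ι → ℝ} (hu : u ∈ O) :
    partialD (p + 1) f j u = partialD p (fun v => fderiv ℝ f v (Pi.single j 1)) j u := by
  rw [partialD, partialD, iteratedDeriv_succ']
  refine Filter.EventuallyEq.iteratedDeriv_eq p ?_
  have hc : Continuous fun t : ℝ => Function.update u j t := (contDiff_update u j 0).continuous
  have hmem : ∀ᶠ t in nhds (u j), Function.update u j t ∈ O :=
    hc.continuousAt.eventually_mem (hO.mem_nhds (by simpa using hu))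
  filter_upwards [hmem] with t ht
  have h1 : HasFDerivAt f (fderiv ℝ f (Function.update u j t)) (Function.update u j t) :=
    ((hf _ ht).differentiableAt (hO.mem_nhds ht)).hasFDerivAt
  exact (h1.comp_hasDerivAt t (hasDerivAt_update u j t)).deriv

theorem continuousOn_partialD {O : Set (ι → ℝ)} (hO : IsOpen O) (j : ι) (p : ℕ) :
    ∀ {f : (ι → ℝ) → ℝ}, ContDiffOn ℝ p f O → ContinuousOn (partialD p f j) O := by
  induction p with
  | zero =>
    intro f hf
    refine hf.continuousOn.congr fun u _ => ?_
    simp [partialD]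
  | succ p ih =>
    intro f hf
    have hf' : ContDiffOn ℝ (p + 1) f O := by simpa using hf
    have hd : DifferentiableOn ℝ f O := hf'.differentiableOn (by simp)
    refine (ih (f := fun v => fderiv ℝ f v (Pi.single j 1)) ?_).congr fun u hu =>
      partialD_succ hO hd j hu
    exact (hf'.fderiv_of_isOpen hO le_rfl).clm_apply contDiffOn_const

/-- The bias of the statistics, to first order: `Z_{hj}` has mean zero for irrelevant `j` and mean
of exact order `h_j ^ p / h_j` for relevant `j`, and the bias of the estimator is a sum over the
relevant coordinates only. -/
theorem exists_bias_bounds {p : ℕ} (hp : 1 ≤ p) {K : ℝ → ℝ} (hK : IsKernel p K)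
    {f : (ι → ℝ) → ℝ} {w : ι → ℝ} {ρ₀ : ℝ} (hρ₀ : 0 < ρ₀)
    (hf : ContDiffOn ℝ p f (Metric.ball w ρ₀)) {R : Finset ι}
    (hsp : ∀ u ∈ Metric.ball w ρ₀, ∀ u' ∈ Metric.ball w ρ₀, (∀ j ∈ R, u j = u' j) → f u = f u')
    {ε : ℝ} (hε : 0 < ε) :
    ∃ η > 0, ∀ h : ι → ℝ, (∀ k, 0 ≤ h k ∧ h k ≤ η) →
      (∀ j ∉ R, smooth (zKernel K j) f w h = 0) ∧
      (∀ j, |smooth (zKernel K j) f w h +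
        partialD p f j w * (-h j) ^ p / p.factorial * (p * ∫ t, t ^ p * K t)| ≤ ε * h j ^ p) ∧
      |smooth (fun _ => K) f w h - f w| ≤ ∑ j ∈ R,
        h j ^ p * (|partialD p f j w| * |∫ t, t ^ p * K t| / p.factorial + ε) := by
  set m := ∫ t, t ^ p * K t with hm
  set M : ℝ := max ((∫ t, |t| ^ p * |kernelJ K t|) * (∫ t, |K t|) ^ (Fintype.card ι - 1))
    ((∫ t, |t| ^ p * |K t|) * (∫ t, |K t|) ^ (Fintype.card ι - 1)) with hM
  have hM0 : 0 ≤ M := le_max_of_le_left (by positivity)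
  set e : ℝ := ε / (M + 1) with he
  have he0 : 0 < e := by positivity
  have heM : e * M ≤ ε := by
    rw [he, div_mul_eq_mul_div, div_le_iff₀ (by positivity)]
    nlinarith
  have hev : ∀ᶠ u in nhds w, ∀ j, |partialD p f j u - partialD p f j w| ≤ e := by
    refine Filter.eventually_all.2 fun j => ?_
    have hc := (continuousOn_partialD Metric.isOpen_ball j p hf).continuousAt
      (Metric.isOpen_ball.mem_nhds (Metric.mem_ball_self hρ₀))
    filter_upwards [Metric.continuousAt_iff'.1 hc e he0] with u hu
    exact (Real.dist_eq _ _ ▸ hu).le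
  obtain ⟨ρ₁, hρ₁, hρ₁D⟩ := Metric.eventually_nhds_iff_ball.1 hev
  set ρ := min ρ₀ ρ₁ with hρdef
  have hρ : 0 < ρ := lt_min hρ₀ hρ₁
  have hsub : Metric.ball w ρ ⊆ Metric.ball w ρ₀ := Metric.ball_subset_ball (min_le_left _ _)
  have hfρ := hf.mono hsub
  have hD : ∀ j, ∀ u ∈ Metric.ball w ρ, |partialD p f j u - partialD p f j w| ≤ e :=
    fun j u hu => hρ₁D u (Metric.ball_subset_ball (min_le_right _ _) hu) j
  set S := tsupport K with hSdef
  have hS : IsCompact S := hK.compactSupport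
  obtain ⟨B, hB⟩ := hS.isBounded.exists_norm_le
  have hB0 : 0 ≤ B := (norm_nonneg _).trans (hB 0 (interior_subset hK.zero_mem))
  refine ⟨ρ / (B + 1), by positivity, fun h hh => ?_⟩
  have hball : ∀ h : ι → ℝ, (∀ k, 0 ≤ h k ∧ h k ≤ ρ / (B + 1)) → ∀ z : ι → ℝ, (∀ k, z k ∈ S) →
      (fun k => w k - h k * z k) ∈ Metric.ball w ρ := by
    intro h hh z hz
    refine (sub_mul_mem_ball hρ).2 fun k => ?_
    rw [abs_mul, abs_of_nonneg (hh k).1]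
    calc h k * |z k| ≤ ρ / (B + 1) * B :=
          mul_le_mul (hh k).2 (hB _ (hz k)) (abs_nonneg _) (by positivity)
      _ < ρ := by
        rw [div_mul_eq_mul_div, div_lt_iff₀ (by positivity)]
        nlinarith
  have hupd : ∀ (h : ι → ℝ) (j : ι), (∀ k, 0 ≤ h k ∧ h k ≤ ρ / (B + 1)) →
      ∀ k, 0 ≤ Function.update h j 0 k ∧ Function.update h j 0 k ≤ ρ / (B + 1) := by
    intro h j hh k
    by_cases hk : k = j
    · subst hk; simpa using by positivity
    · simpa [hk] using hh k
  have hspρ : ∀ u ∈ Metric.ball w ρ, ∀ u' ∈ Metric.ball w ρ, (∀ j ∈ R, u j = u' j) →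
      f u = f u' := fun u hu u' hu' => hsp u (hsub hu) u' (hsub hu')
  have hKc := hK.contDiff.continuous
  have hJc := continuous_kernelJ hK.contDiff
  have hKS : ∀ k : ι, ∀ t ∉ S, (fun _ : ι => K) k t = 0 :=
    fun _ t ht => image_eq_zero_of_notMem_tsupport ht
  have hzero : ∀ j, smooth (zKernel K j) f w (Function.update h j 0) = 0 := fun j =>
    smooth_update_zero hS (continuous_zKernel hK.contDiff j) (fun k t => zKernel_eq_zero j k)
      hfρ.continuousOn (hball _ (hupd h j hh))
      (by simpa [zKernel] using integral_kernelJ hK.contDiff hK.compactSupport)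
  refine ⟨fun j hj => ?_, fun j => ?_, ?_⟩
  · rw [smooth_update_of_sparse (fun k t => zKernel_eq_zero j k) hspρ hj (hball h hh)
      (hball _ (hupd h j hh)), hzero]
  · have hmom : ∀ l : ℕ, 1 ≤ l → l < p → ∫ t, t ^ l * zKernel K j j t = 0 := by
      intro l h1 h2
      simp only [zKernel, Function.update_self]
      rw [integral_pow_mul_kernelJ hK.contDiff hK.compactSupport, hK.moment_zero l h1 (by omega)]
      simp
    have key := abs_smooth_sub_le hp hS (continuous_zKernel hK.contDiff j)
      (fun k t => zKernel_eq_zero j k) hρ hfρ (hball h hh) (hh j).1 hmom (hD j)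
    have hother : ∀ k : {k // ¬ k = j}, zKernel K j k = K := fun k => by simp [zKernel, k.2]
    rw [hzero] at key
    simp only [hother, hK.integral_eq_one, Finset.prod_const_one, mul_one, sub_zero,
      Finset.prod_const, Finset.card_univ] at key
    simp only [zKernel, Function.update_self] at key
    rw [integral_pow_mul_kernelJ hK.contDiff hK.compactSupport, mul_neg, sub_neg_eq_add] at key
    refine key.trans ?_
    rw [Fintype.card_subtype_compl, Fintype.card_subtype_eq]
    calc _ = h j ^ p * (e * ((∫ t, |t| ^ p * |kernelJ K t|) *
          (∫ t, |K t|) ^ (Fintype.card ι - 1))) := by ring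
      _ ≤ h j ^ p * ε := mul_le_mul_of_nonneg_left
          ((mul_le_mul_of_nonneg_left (le_max_left _ _) he0.le).trans heM) (pow_nonneg (hh j).1 p)
      _ = _ := mul_comm _ _
  · have main : ∀ s : Finset ι, ∀ h : ι → ℝ, (∀ k, 0 ≤ h k ∧ h k ≤ ρ / (B + 1)) →
        (∀ k ∉ s, h k = 0) → |smooth (fun _ => K) f w h - f w| ≤ ∑ j ∈ s, if j ∈ R then
          h j ^ p * (|partialD p f j w| * |m| / p.factorial + ε) else 0 := by
      intro s
      induction s using Finset.induction_on with
      | empty =>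
        intro h _ h0
        obtain rfl : h = fun _ => 0 := funext fun k => h0 k (by simp)
        simp [smooth_zero hK.integral_eq_one]
      | insert j s hj ih =>
        intro h hh h0
        have ih' := ih (Function.update h j 0) (hupd h j hh) fun k hk => by
          by_cases hkj : k = j
          · subst hkj; simp
          · simpa [hkj] using h0 k (by simp [hk, hkj])
        have hsum : ∑ i ∈ s, (if i ∈ R then Function.update h j 0 i ^ p *
            (|partialD p f i w| * |m| / p.factorial + ε) else 0) =
            ∑ i ∈ s, if i ∈ R then h i ^ p *
              (|partialD p f i w| * |m| / p.factorial + ε) else 0 :=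
          Finset.sum_congr rfl fun i hi => by
            rw [Function.update_of_ne (fun e : i = j => hj (e ▸ hi))]
        rw [hsum] at ih'
        rw [Finset.sum_insert hj]
        by_cases hjR : j ∈ R
        · rw [if_pos hjR]
          have key := abs_smooth_sub_le hp hS (fun _ => hKc) hKS hρ hfρ (hball h hh) (hh j).1
            (fun l h1 h2 => hK.moment_zero l h1 (by omega)) (hD j)
          simp only [hK.integral_eq_one, Finset.prod_const_one, mul_one, Finset.prod_const,
            Finset.card_univ] at key
          rw [Fintype.card_subtype_compl, Fintype.card_subtype_eq] at key
          have h1 : e * h j ^ p * (∫ t, |t| ^ p * |K t|) * (∫ t, |K t|) ^ (Fintype.card ι - 1) ≤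
              h j ^ p * ε := by
            calc _ = h j ^ p * (e * ((∫ t, |t| ^ p * |K t|) *
                (∫ t, |K t|) ^ (Fintype.card ι - 1))) := by ring
              _ ≤ h j ^ p * ε := mul_le_mul_of_nonneg_left
                ((mul_le_mul_of_nonneg_left (le_max_right _ _) he0.le).trans heM)
                (pow_nonneg (hh j).1 p)
          have h2 : |partialD p f j w * (-h j) ^ p / p.factorial * m| =
              h j ^ p * (|partialD p f j w| * |m| / p.factorial) := by
            rw [abs_mul, abs_div, abs_mul, abs_pow, abs_neg, abs_of_nonneg (hh j).1,
              Nat.abs_cast]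
            ring
          have h3 := abs_le.1 (key.trans h1)
          have h4 := abs_le.1 h2.le
          have h5 := abs_le.1 ih'
          rw [mul_add]
          exact abs_le.2 ⟨by linarith [h3.1, h4.1, h5.1], by linarith [h3.2, h4.2, h5.2]⟩
        · rw [if_neg hjR, zero_add,
            smooth_update_of_sparse hKS hspρ hjR (hball h hh) (hball _ (hupd h j hh))]
          exact ih'
    have := main Finset.univ h hh fun k hk => absurd (Finset.mem_univ k) hk
    simpa [Finset.sum_ite_mem] using this

end Bias

/-! ### Kernel statistics -/

/-- The contribution of the observation `u` to a product kernel statistic, with the function `g`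
in place of the marginal density. -/
noncomputable def kernelTerm {d₁ d₂ : ℕ} (φ : Fin d₁ ⊕ Fin d₂ → ℝ → ℝ)
    (g : (Fin d₁ → ℝ) → ℝ) (w h u : Fin d₁ ⊕ Fin d₂ → ℝ) : ℝ :=
  1 / g (xPart u) * ∏ j, (h j)⁻¹ * φ j ((w j - u j) / h j)

/-- The product kernel statistic of the data `W`. Both the estimator and, up to a factor, its
derivatives in the bandwidth are of this form. -/
noncomputable def kernelStat {d₁ d₂ n : ℕ} (φ : Fin d₁ ⊕ Fin d₂ → ℝ → ℝ)
    (g : (Fin d₁ → ℝ) → ℝ) (W : Fin n → Fin d₁ ⊕ Fin d₂ → ℝ)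
    (w h : Fin d₁ ⊕ Fin d₂ → ℝ) : ℝ :=
  1 / (n : ℝ) * ∑ i, kernelTerm φ g w h (W i)

theorem hasDerivAt_inv_mul_kernel {K : ℝ → ℝ} (hK : ContDiff ℝ 1 K) (c : ℝ) {s : ℝ}
    (hs : s ≠ 0) :
    HasDerivAt (fun s => s⁻¹ * K (c / s)) (-(1 / s) * (s⁻¹ * kernelJ K (c / s))) s := by
  have h1 : HasDerivAt K (deriv K (c / s)) (c / s) :=
    (hK.differentiable one_ne_zero _).hasDerivAt
  have h2 : HasDerivAt (fun s => c / s) (-c / s ^ 2) s := by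
    simpa [div_eq_mul_inv, neg_mul, mul_neg] using (hasDerivAt_inv hs).const_mul c
  have h3 := (hasDerivAt_inv hs).mul (HasDerivAt.comp s h1 h2)
  convert! h3 using 1
  simp only [kernelJ, Function.comp]
  field_simp
  ring

theorem statZ_eq_kernelStat {d₁ d₂ n : ℕ} {K : ℝ → ℝ} (hK : ContDiff ℝ 1 K)
    (g : (Fin d₁ → ℝ) → ℝ) (W : Fin n → Fin d₁ ⊕ Fin d₂ → ℝ) (w h : Fin d₁ ⊕ Fin d₂ → ℝ)
    (j : Fin d₁ ⊕ Fin d₂) (hj : h j ≠ 0) :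
    statZ K g W w h j = -(1 / h j) * kernelStat (zKernel K j) g W w h := by
  have hterm : ∀ i, HasDerivAt (fun s => 1 / g (xPart (W i)) *
      ∏ k, (Function.update h j s k)⁻¹ * K ((w k - W i k) / Function.update h j s k))
      (-(1 / h j) * kernelTerm (zKernel K j) g w h (W i)) (h j) := by
    intro i
    have e : ∀ s, ∏ k, (Function.update h j s k)⁻¹ *
        K ((w k - W i k) / Function.update h j s k) =
        (s⁻¹ * K ((w j - W i j) / s)) *
          ∏ k : {k // k ≠ j}, (h k)⁻¹ * K ((w k - W i k) / h k) := by
      intro s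
      rw [Fintype.prod_eq_mul_prod_subtype_ne _ j, Function.update_self]
      congr 1
      exact Finset.prod_congr rfl fun k _ => by rw [Function.update_of_ne k.2]
    simp_rw [e]
    have h1 := ((hasDerivAt_inv_mul_kernel hK (w j - W i j) hj).mul_const
      (∏ k : {k // k ≠ j}, (h k)⁻¹ * K ((w k - W i k) / h k))).const_mul
        (1 / g (xPart (W i)))
    convert! h1 using 1
    rw [kernelTerm, Fintype.prod_eq_mul_prod_subtype_ne _ j]
    have e2 : ∏ k : {k // k ≠ j}, (h k)⁻¹ * zKernel K j k ((w k - W i k) / h k) =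
        ∏ k : {k // k ≠ j}, (h k)⁻¹ * K ((w k - W i k) / h k) :=
      Finset.prod_congr rfl fun k _ => by simp [zKernel, k.2]
    rw [e2]
    simp only [zKernel, Function.update_self]
    ring
  have hsum := (HasDerivAt.fun_sum (u := Finset.univ) fun i _ => hterm i).const_mul (1 / (n : ℝ))
  rw [statZ]
  refine hsum.deriv.trans ?_
  rw [kernelStat, ← Finset.mul_sum]
  ring

/-! ### Expectation of a kernel statistic -/

theorem integral_eq_prod_mul_integral_sub_mul {ι : Type*} [Fintype ι] [DecidableEq ι]
    (F : (ι → ℝ) → ℝ) (w : ι → ℝ) {h : ι → ℝ} (hh : ∀ k, 0 < h k) :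
    ∫ u, F u = (∏ k, h k) * ∫ z : ι → ℝ, F (fun k => w k - h k * z k) := by
  have hdet : (Matrix.diagonal h).det ≠ 0 := by
    rw [Matrix.det_diagonal]
    exact (Finset.prod_pos fun k _ => hh k).ne'
  have hpos : 0 < ∏ k, h k := Finset.prod_pos fun k _ => hh k
  have h1 := Real.smul_map_diagonal_volume_pi hdet
  rw [Matrix.det_diagonal, abs_of_pos hpos] at h1
  have hmeas : MeasurableEmbedding (Matrix.toLin' (Matrix.diagonal h)) := by
    have hinj : Function.Injective (Matrix.toLin' (Matrix.diagonal h)) := by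
      intro x y hxy
      ext k
      have := congrFun hxy k
      simp only [Matrix.toLin'_apply, Matrix.mulVec_diagonal] at this
      exact mul_left_cancel₀ (hh k).ne' this
    exact (LinearMap.continuous_on_pi _).measurableEmbedding hinj
  rw [← integral_sub_left_eq_self F volume w]
  conv_lhs => rw [← h1]
  rw [integral_smul_measure, hmeas.integral_map, ENNReal.toReal_ofReal hpos.le, smul_eq_mul]
  congr 2 with z
  congr 1
  ext k
  simp [Matrix.mulVec_diagonal]

section Expectation

variable {d₁ d₂ : ℕ} {φ : Fin d₁ ⊕ Fin d₂ → ℝ → ℝ} {S : Set ℝ}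
  {fX : (Fin d₁ → ℝ) → ℝ} {f : (Fin d₁ ⊕ Fin d₂ → ℝ) → ℝ} {w h : Fin d₁ ⊕ Fin d₂ → ℝ}

/-- The law of an observation `(X, Y)`. -/
noncomputable def jointLaw (fX : (Fin d₁ → ℝ) → ℝ) (f : (Fin d₁ ⊕ Fin d₂ → ℝ) → ℝ) :
    Measure (Fin d₁ ⊕ Fin d₂ → ℝ) :=
  volume.withDensity fun u => ENNReal.ofReal (fX (xPart u) * f u)

theorem measurable_xPart : Measurable (xPart : (Fin d₁ ⊕ Fin d₂ → ℝ) → Fin d₁ → ℝ) :=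
  measurable_pi_lambda _ fun j => measurable_pi_apply (Sum.inl j)

theorem measurable_kernelTerm (hc : ∀ k, Continuous (φ k)) (hfX : Measurable fX) :
    Measurable (kernelTerm φ fX w h) := by
  refine ((hfX.comp measurable_xPart).const_div 1).mul
    (Finset.measurable_prod _ fun k _ => ?_)
  have hk : Measurable fun u : Fin d₁ ⊕ Fin d₂ → ℝ => (w k - u k) / h k := by fun_prop
  exact ((hc k).measurable.comp hk).const_mul _

/-- A point at which the product kernel does not vanish is `w - h z` with `z` in the support. -/
theorem exists_eq_of_prod_ne_zero (hφ : ∀ k, ∀ t ∉ S, φ k t = 0) (hh : ∀ k, 0 < h k)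
    {u : Fin d₁ ⊕ Fin d₂ → ℝ} (hu : ∏ j, (h j)⁻¹ * φ j ((w j - u j) / h j) ≠ 0) :
    ∃ z : Fin d₁ ⊕ Fin d₂ → ℝ, (∀ k, z k ∈ S) ∧ u = fun k => w k - h k * z k := by
  refine ⟨fun k => (w k - u k) / h k, fun k => ?_, ?_⟩
  · by_contra hk
    exact hu (Finset.prod_eq_zero (Finset.mem_univ k) (by rw [hφ k _ hk, mul_zero]))
  · ext k
    rw [mul_div_cancel₀ _ (hh k).ne', sub_sub_cancel]

theorem integral_kernelTerm (hf : IsCondDensity fX f) (hφ : ∀ k, ∀ t ∉ S, φ k t = 0)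
    (hh : ∀ k, 0 < h k)
    (hpos : ∀ z : Fin d₁ ⊕ Fin d₂ → ℝ, (∀ k, z k ∈ S) →
      0 < fX (xPart fun k => w k - h k * z k)) :
    ∫ u, kernelTerm φ fX w h u ∂(jointLaw fX f) = smooth φ f w h := by
  have hm : Measurable fun u => ENNReal.ofReal (fX (xPart u) * f u) :=
    (((hf.measurable_fX.comp measurable_xPart).mul hf.measurable_f)).ennreal_ofReal
  rw [jointLaw, integral_withDensity_eq_integral_toReal_smul hm
    (Filter.Eventually.of_forall fun _ => ENNReal.ofReal_lt_top),
    integral_eq_prod_mul_integral_sub_mul _ w hh, smooth, ← integral_const_mul]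
  congr 1 with z
  have hp : ∏ k, h k ≠ 0 := (Finset.prod_pos fun k _ => hh k).ne'
  rw [ENNReal.toReal_ofReal (mul_nonneg (hf.nonneg_fX _) (hf.nonneg_f _)), smul_eq_mul,
    kernelTerm, Finset.prod_mul_distrib, Finset.prod_inv_distrib]
  have e : ∏ k, φ k ((w k - (w k - h k * z k)) / h k) = ∏ k, φ k (z k) :=
    Finset.prod_congr rfl fun k _ => by
      rw [sub_sub_cancel, mul_div_cancel_left₀ _ (hh k).ne']
  rw [e]
  by_cases hz : ∀ k, z k ∈ S
  · have := (hpos z hz).ne'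
    field_simp
  · simp [prod_eq_zero_off hφ hz]

theorem abs_kernelTerm_eq (hf : IsCondDensity fX f) (hh : ∀ k, 0 < h k)
    (u : Fin d₁ ⊕ Fin d₂ → ℝ) :
    |kernelTerm φ fX w h u| = kernelTerm (fun k t => |φ k t|) fX w h u := by
  simp only [kernelTerm, abs_mul, Finset.abs_prod, abs_inv, abs_of_pos (hh _), abs_div, abs_one,
    abs_of_nonneg (hf.nonneg_fX _)]

theorem abs_kernelTerm_le (hφ : ∀ k, ∀ t ∉ S, φ k t = 0) (hh : ∀ k, 0 < h k) {B δ : ℝ}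
    (hδ : 0 < δ) (hB : ∀ k t, |φ k t| ≤ B) (hpos : ∀ z : Fin d₁ ⊕ Fin d₂ → ℝ,
      (∀ k, z k ∈ S) → δ ≤ fX (xPart fun k => w k - h k * z k))
    (u : Fin d₁ ⊕ Fin d₂ → ℝ) :
    |kernelTerm φ fX w h u| ≤ B ^ (d₁ + d₂) / δ / ∏ k, h k := by
  have hp : 0 < ∏ k, h k := Finset.prod_pos fun k _ => hh k
  have hprod : ∏ k : Fin d₁ ⊕ Fin d₂, |φ k ((w k - u k) / h k)| ≤ B ^ (d₁ + d₂) := by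
    calc _ ≤ ∏ _k : Fin d₁ ⊕ Fin d₂, B :=
          Finset.prod_le_prod (fun _ _ => abs_nonneg _) fun k _ => hB k _
      _ = _ := by simp
  have hB0 : 0 ≤ B ^ (d₁ + d₂) := (Finset.prod_nonneg fun _ _ => abs_nonneg _).trans hprod
  by_cases hu : ∏ j, (h j)⁻¹ * φ j ((w j - u j) / h j) = 0
  · rw [kernelTerm, hu, mul_zero, abs_zero]
    positivity
  · obtain ⟨z, hz, rfl⟩ := exists_eq_of_prod_ne_zero hφ hh hu
    have h1 := hpos z hz
    rw [kernelTerm, Finset.prod_mul_distrib, Finset.prod_inv_distrib, abs_mul, abs_mul,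
      Finset.abs_prod, abs_of_pos (inv_pos.2 hp), abs_of_pos (one_div_pos.2 (hδ.trans_le h1))]
    calc _ ≤ 1 / δ * ((∏ k, h k)⁻¹ * B ^ (d₁ + d₂)) := by gcongr
      _ = _ := by field_simp

theorem abs_smooth_le (hS : IsCompact S) (hc : ∀ k, Continuous (φ k))
    (hφ : ∀ k, ∀ t ∉ S, φ k t = 0) {F : ℝ}
    (hF : ∀ z : Fin d₁ ⊕ Fin d₂ → ℝ, (∀ k, z k ∈ S) → |f fun k => w k - h k * z k| ≤ F) :
    |smooth φ f w h| ≤ (∏ k, ∫ t, |φ k t|) * F := by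
  have hi : Integrable fun z : Fin d₁ ⊕ Fin d₂ → ℝ => ∏ k, |φ k (z k)| := by
    exact Integrable.fintype_prod (f := fun k t => |φ k t|)
      fun k => (integrable_of_eq_zero_off (hc k) hS (hφ k)).abs
  rw [← integral_fintype_prod_volume_eq_prod (fun k t => |φ k t|), ← integral_mul_const,
    smooth, ← Real.norm_eq_abs]
  refine norm_integral_le_of_norm_le (hi.mul_const F) (Filter.Eventually.of_forall fun z => ?_)
  rw [Real.norm_eq_abs, abs_mul, Finset.abs_prod]
  by_cases hz : ∀ k, z k ∈ S
  · exact mul_le_mul_of_nonneg_left (hF z hz) (Finset.prod_nonneg fun _ _ => abs_nonneg _)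
  · rw [prod_eq_zero_off (φ := fun k t => |φ k t|) (fun k t ht => by rw [hφ k t ht, abs_zero]) hz]
    simp

end Expectation

/-! ### A Bernstein inequality -/

section Bernstein

variable {Ω : Type*} [MeasurableSpace Ω] {P : Measure Ω} [IsProbabilityMeasure P]

theorem mgf_le_exp {Y : Ω → ℝ} (hY : Measurable Y) {b M s : ℝ} (hb : ∀ ω, |Y ω| ≤ b)
    (hM : ∫ ω, |Y ω| ∂P ≤ M) (hs : 0 ≤ s) (hsb : s * b ≤ 1) :
    mgf Y P s ≤ Real.exp (s * ∫ ω, Y ω ∂P + s ^ 2 * (b * M)) := by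
  have iY : Integrable Y P := Integrable.of_bound hY.aestronglyMeasurable b
    (Filter.Eventually.of_forall hb)
  have hpt : ∀ ω, Real.exp (s * Y ω) ≤ 1 + s * Y ω + s ^ 2 * b * |Y ω| := by
    intro ω
    have h1 : |s * Y ω| ≤ 1 := by
      rw [abs_mul, abs_of_nonneg hs]
      exact (mul_le_mul_of_nonneg_left (hb ω) hs).trans hsb
    have h2 := (abs_le.1 (Real.abs_exp_sub_one_sub_id_le h1)).2
    have h3 : (s * Y ω) ^ 2 ≤ s ^ 2 * b * |Y ω| := by
      rw [mul_pow, ← sq_abs (Y ω), sq |Y ω|, mul_assoc]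
      exact mul_le_mul_of_nonneg_left
        (mul_le_mul_of_nonneg_right (hb ω) (abs_nonneg _)) (sq_nonneg s)
    linarith
  have i1 : Integrable (fun ω => 1 + s * Y ω) P := (integrable_const 1).add (iY.const_mul s)
  have i2 : Integrable (fun ω => s ^ 2 * b * |Y ω|) P := iY.abs.const_mul _
  have iexp : Integrable (fun ω => Real.exp (s * Y ω)) P := by
    refine Integrable.of_bound (C := Real.exp 1) (by fun_prop) (Filter.Eventually.of_forall fun ω => ?_)
    rw [Real.norm_eq_abs, Real.abs_exp]
    refine Real.exp_le_exp.2 ((mul_le_mul_of_nonneg_left ((le_abs_self _).trans (hb ω)) hs).trans hsb)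
  have hb0 : 0 ≤ b := by
    obtain ⟨ω⟩ : Nonempty Ω := nonempty_of_isProbabilityMeasure P
    exact (abs_nonneg _).trans (hb ω)
  calc mgf Y P s ≤ ∫ ω, (1 + s * Y ω + s ^ 2 * b * |Y ω|) ∂P :=
        integral_mono iexp (i1.add i2) hpt
    _ = 1 + s * (∫ ω, Y ω ∂P) + s ^ 2 * b * ∫ ω, |Y ω| ∂P := by
      rw [integral_add i1 i2, integral_add (integrable_const 1) (iY.const_mul s),
        integral_const_mul, integral_const_mul]
      simp
    _ ≤ (s * (∫ ω, Y ω ∂P) + s ^ 2 * (b * M)) + 1 := by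
      have : s ^ 2 * b * ∫ ω, |Y ω| ∂P ≤ s ^ 2 * b * M :=
        mul_le_mul_of_nonneg_left hM (by positivity)
      linarith
    _ ≤ _ := Real.add_one_le_exp _

theorem measureReal_avg_sub_ge_le {n : ℕ} (hn : 0 < n) {Y : Fin n → Ω → ℝ}
    (hY : ∀ i, Measurable (Y i)) (hind : iIndepFun Y P) {b M m s t : ℝ}
    (hb : ∀ i ω, |Y i ω| ≤ b) (hM : ∀ i, ∫ ω, |Y i ω| ∂P ≤ M) (hm : ∀ i, ∫ ω, Y i ω ∂P = m)
    (hs : 0 ≤ s) (hsb : s * b ≤ 1) :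
    P.real {ω | t ≤ 1 / (n : ℝ) * ∑ i, Y i ω - m} ≤
      Real.exp (-(n * s * t) + n * s ^ 2 * (b * M)) := by
  have hn' : (0 : ℝ) < n := by exact_mod_cast hn
  have hset : {ω | t ≤ 1 / (n : ℝ) * ∑ i, Y i ω - m} =
      {ω | n * (t + m) ≤ (∑ i, Y i) ω} := by
    ext ω
    simp only [Set.mem_ofPred_eq, Finset.sum_apply]
    rw [le_sub_iff_add_le, one_div, inv_mul_eq_div, le_div_iff₀ hn', mul_comm]
  have hbound : ∀ ω, |(∑ i, Y i) ω| ≤ n * b := by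
    intro ω
    rw [Finset.sum_apply]
    calc _ ≤ ∑ i, |Y i ω| := Finset.abs_sum_le_sum_abs _ _
      _ ≤ ∑ _i : Fin n, b := Finset.sum_le_sum fun i _ => hb i ω
      _ = _ := by simp
  have hmeas : Measurable (∑ i, Y i) := by
    rw [Finset.sum_fn]
    exact Finset.measurable_sum _ fun i _ => hY i
  have iexp : Integrable (fun ω => Real.exp (s * (∑ i, Y i) ω)) P := by
    refine Integrable.of_bound (C := Real.exp (s * (n * b))) (by fun_prop)
      (Filter.Eventually.of_forall fun ω => ?_)
    rw [Real.norm_eq_abs, Real.abs_exp]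
    exact Real.exp_le_exp.2 (mul_le_mul_of_nonneg_left ((le_abs_self _).trans (hbound ω)) hs)
  rw [hset]
  refine (measure_ge_le_exp_mul_mgf _ hs iexp).trans ?_
  rw [hind.mgf_sum hY]
  have hprod : ∏ i, mgf (Y i) P s ≤ ∏ _i : Fin n, Real.exp (s * m + s ^ 2 * (b * M)) :=
    Finset.prod_le_prod (fun i _ => mgf_nonneg) fun i _ => by
      rw [← hm i]; exact mgf_le_exp (hY i) (hb i) (hM i) hs hsb
  calc _ ≤ Real.exp (-s * (n * (t + m))) * ∏ _i : Fin n, Real.exp (s * m + s ^ 2 * (b * M)) :=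
        mul_le_mul_of_nonneg_left hprod (Real.exp_pos _).le
    _ = _ := by
      rw [Finset.prod_const, ← Real.exp_nat_mul, ← Real.exp_add]
      simp only [Finset.card_univ, Fintype.card_fin]
      ring_nf

/-- A Bernstein inequality in which the variance is bounded by the product of the uniform bound
and the first absolute moment. -/
theorem measureReal_abs_avg_sub_ge_le {n : ℕ} (hn : 0 < n) {Y : Fin n → Ω → ℝ}
    (hY : ∀ i, Measurable (Y i)) (hind : iIndepFun Y P) {b M m s t : ℝ}
    (hb : ∀ i ω, |Y i ω| ≤ b) (hM : ∀ i, ∫ ω, |Y i ω| ∂P ≤ M) (hm : ∀ i, ∫ ω, Y i ω ∂P = m)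
    (hs : 0 ≤ s) (hsb : s * b ≤ 1) :
    P.real {ω | t ≤ |1 / (n : ℝ) * ∑ i, Y i ω - m|} ≤
      2 * Real.exp (-(n * s * t) + n * s ^ 2 * (b * M)) := by
  have h1 := measureReal_avg_sub_ge_le (t := t) hn hY hind hb hM hm hs hsb
  have h2 := measureReal_avg_sub_ge_le (P := P) (Y := fun i ω => -Y i ω) (t := t) (m := -m) hn
    (fun i => (hY i).neg) (hind.comp (fun _ x => -x) fun _ => measurable_neg)
    (fun i ω => by rw [abs_neg]; exact hb i ω) (fun i => by simpa using hM i)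
    (fun i => by rw [integral_neg, hm]) hs hsb
  have hsub : {ω | t ≤ |1 / (n : ℝ) * ∑ i, Y i ω - m|} ⊆
      {ω | t ≤ 1 / (n : ℝ) * ∑ i, Y i ω - m} ∪
        {ω | t ≤ 1 / (n : ℝ) * ∑ i, -Y i ω - -m} := by
    intro ω hω
    rcases le_abs.1 (show t ≤ |1 / (n : ℝ) * ∑ i, Y i ω - m| from hω) with h | h
    · exact Or.inl h
    · refine Or.inr ?_
      simp only [Set.mem_ofPred_eq, Finset.sum_neg_distrib]
      linarith
  calc _ ≤ _ := measureReal_mono hsub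
    _ ≤ _ := measureReal_union_le _ _
    _ ≤ _ := by linarith

end Bernstein

/-! ### Concentration of the statistics over all bandwidths -/

section Concentration

variable {d₁ d₂ : ℕ} {φ : Fin d₁ ⊕ Fin d₂ → ℝ → ℝ} {S : Set ℝ}
  {fX : (Fin d₁ → ℝ) → ℝ} {f : (Fin d₁ ⊕ Fin d₂ → ℝ) → ℝ} {w h : Fin d₁ ⊕ Fin d₂ → ℝ}

/-- Concentration at a fixed bandwidth. The deviation `ε √(L ^ a / (n ∏ h_k))` may be any small
multiple of the threshold scale, since `a > 1` and `n ∏ h_k ≥ L` make the exponent at least a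
multiple of `L ^ ((a + 1) / 2)`, which exceeds every multiple of `L = log n`. -/
theorem measureReal_kernelStat_sub_smooth_ge_le {Ω : Type*} [MeasurableSpace Ω] {P : Measure Ω}
    [IsProbabilityMeasure P] {n : ℕ} (hn : 0 < n) {W : Fin n → Ω → Fin d₁ ⊕ Fin d₂ → ℝ}
    (hf : IsCondDensity fX f) (hW : IsSample P W fX f) (hS : IsCompact S)
    (hc : ∀ k, Continuous (φ k)) (hφ : ∀ k, ∀ t ∉ S, φ k t = 0) (hh : ∀ k, 0 < h k)
    {A B F L a δ ε : ℝ} (hδ : 0 < δ) (hB : ∀ k t, |φ k t| ≤ B)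
    (hpos : ∀ z : Fin d₁ ⊕ Fin d₂ → ℝ, (∀ k, z k ∈ S) →
      δ ≤ fX (xPart fun k => w k - h k * z k))
    (hF : ∀ z : Fin d₁ ⊕ Fin d₂ → ℝ, (∀ k, z k ∈ S) → |f fun k => w k - h k * z k| ≤ F)
    (hA : 0 < A) (hA1 : B ^ (d₁ + d₂) / δ ≤ A) (hA2 : (∏ k, ∫ t, |φ k t|) * F ≤ A)
    (hε : 0 < ε) (ha : 1 < a) (hL : 1 ≤ L) (hx : L ≤ n * ∏ k, h k) :
    P.real {ω | ε * Real.sqrt (L ^ a / (n * ∏ k, h k)) ≤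
        |kernelStat φ fX (fun i => W i ω) w h - smooth φ f w h|} ≤
      2 * Real.exp (-(min (ε ^ 2 / (4 * A ^ 2)) (ε / (2 * A)) * L ^ ((a + 1) / 2))) := by
  have hp : 0 < ∏ k, h k := Finset.prod_pos fun k _ => hh k
  set π := ∏ k, h k with hπ
  set x : ℝ := n * π with hxdef
  have hx0 : 0 < x := by linarith
  have hL0 : 0 < L := by linarith
  have hLa : 0 < L ^ a := Real.rpow_pos_of_pos hL0 a
  set t := ε * Real.sqrt (L ^ a / x) with ht
  have ht0 : 0 < t := mul_pos hε (Real.sqrt_pos.2 (div_pos hLa hx0))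
  have hpos' : ∀ z : Fin d₁ ⊕ Fin d₂ → ℝ, (∀ k, z k ∈ S) →
      0 < fX (xPart fun k => w k - h k * z k) := fun z hz => hδ.trans_le (hpos z hz)
  have hmeas : ∀ φ : Fin d₁ ⊕ Fin d₂ → ℝ → ℝ, (∀ k, Continuous (φ k)) →
      Measurable (kernelTerm φ fX w h) := fun φ hc => measurable_kernelTerm hc hf.measurable_fX
  have hmean : ∀ (φ : Fin d₁ ⊕ Fin d₂ → ℝ → ℝ), (∀ k, Continuous (φ k)) →
      (∀ k, ∀ t ∉ S, φ k t = 0) → ∀ i,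
      ∫ ω, kernelTerm φ fX w h (W i ω) ∂P = smooth φ f w h := by
    intro φ hc hφ i
    rw [← integral_kernelTerm hf hφ hh hpos', jointLaw, ← hW.law i,
      integral_map (hW.measurable i).aemeasurable (hmeas φ hc).aestronglyMeasurable]
  have habs : ∀ i, ∫ ω, |kernelTerm φ fX w h (W i ω)| ∂P ≤ A := by
    intro i
    simp only [abs_kernelTerm_eq hf hh]
    have hc' : ∀ k, Continuous fun t => |φ k t| := fun k => (hc k).abs
    have hφ' : ∀ k, ∀ t ∉ S, |φ k t| = 0 := fun k t ht => by rw [hφ k t ht, abs_zero]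
    rw [hmean _ hc' hφ' i]
    refine (le_abs_self _).trans ((abs_smooth_le hS hc' hφ' hF).trans ?_)
    simpa using hA2
  have hbd : ∀ i ω, |kernelTerm φ fX w h (W i ω)| ≤ A / π := fun i ω =>
    (abs_kernelTerm_le hφ hh hδ hB hpos _).trans (by gcongr)
  have bern : ∀ κ : ℝ, 0 ≤ κ → κ * A ≤ 1 →
      P.real {ω | t ≤ |kernelStat φ fX (fun i => W i ω) w h - smooth φ f w h|} ≤
        2 * Real.exp (-(x * κ * t) + x * κ ^ 2 * A ^ 2) := by
    intro κ hκ hκA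
    have := measureReal_abs_avg_sub_ge_le (t := t) (s := κ * π) hn
      (fun i => (hmeas φ hc).comp (hW.measurable i))
      (hW.indep.comp (fun _ => kernelTerm φ fX w h) fun _ => hmeas φ hc)
      hbd habs (hmean φ hc hφ) (by positivity) (by field_simp; exact hκA)
    refine this.trans (le_of_eq ?_)
    rw [hxdef]
    congr 2
    field_simp
  have hsqrt : t ^ 2 * x = ε ^ 2 * L ^ a := by
    rw [ht, mul_pow, Real.sq_sqrt (by positivity)]
    field_simp
  have hexp : 0 < L ^ ((a + 1) / 2) := Real.rpow_pos_of_pos hL0 _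
  rcases le_or_gt t (2 * A) with hcase | hcase
  · -- the optimal exponent is available
    refine (bern (t / (2 * A ^ 2)) (by positivity) ?_).trans ?_
    · rw [div_mul_eq_mul_div, div_le_one (by positivity)]
      nlinarith
    · have e : -(x * (t / (2 * A ^ 2)) * t) + x * (t / (2 * A ^ 2)) ^ 2 * A ^ 2 =
          -(ε ^ 2 / (4 * A ^ 2) * L ^ a) := by
        have : -(x * (t / (2 * A ^ 2)) * t) + x * (t / (2 * A ^ 2)) ^ 2 * A ^ 2 =
          -(t ^ 2 * x / (4 * A ^ 2)) := by field_simp; ring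
        rw [this, hsqrt]; ring
      rw [e]
      refine mul_le_mul_of_nonneg_left (Real.exp_le_exp.2 (neg_le_neg ?_)) (by norm_num)
      exact mul_le_mul (min_le_left _ _)
        (Real.rpow_le_rpow_of_exponent_le hL (by linarith)) hexp.le (by positivity)
  · -- the exponent is limited by the uniform bound
    refine (bern (1 / A) (by positivity) (by field_simp; exact le_rfl)).trans ?_
    refine mul_le_mul_of_nonneg_left (Real.exp_le_exp.2 ?_) (by norm_num)
    have h1 : L ^ ((a + 1) / 2) ≤ Real.sqrt (L ^ a / x) * x := by
      have h2 : Real.sqrt (L ^ a / x) * x = Real.sqrt (L ^ a * x) := by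
        rw [Real.sqrt_div' _ hx0.le, Real.sqrt_mul hLa.le, div_mul_eq_mul_div,
          div_eq_iff (Real.sqrt_pos.2 hx0).ne', mul_assoc, Real.mul_self_sqrt hx0.le]
      rw [h2]
      refine Real.le_sqrt_of_sq_le ?_
      rw [← Real.rpow_natCast, ← Real.rpow_mul hL0.le]
      have : (a + 1) / 2 * ((2 : ℕ) : ℝ) = a + 1 := by push_cast; ring
      rw [this, Real.rpow_add_one hL0.ne']
      exact mul_le_mul_of_nonneg_left hx hLa.le
    have h3 : ε / (2 * A) * L ^ ((a + 1) / 2) ≤ t * x / (2 * A) := by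
      rw [ht, div_mul_eq_mul_div, mul_assoc]
      gcongr
    have h4 : min (ε ^ 2 / (4 * A ^ 2)) (ε / (2 * A)) * L ^ ((a + 1) / 2) ≤
        ε / (2 * A) * L ^ ((a + 1) / 2) :=
      mul_le_mul_of_nonneg_right (min_le_right _ _) hexp.le
    have h5 : -(x * (1 / A) * t) + x * (1 / A) ^ 2 * A ^ 2 = x - t * x / A := by field_simp; ring
    rw [h5]
    have h6 : x ≤ t * x / (2 * A) := by
      rw [le_div_iff₀ (by positivity)]
      nlinarith
    have h7 : t * x / A = t * x / (2 * A) + t * x / (2 * A) := by field_simp; ring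
    linarith

/-- Replacing the marginal density by an estimator with relative error at most `r` changes a
kernel statistic by at most `r` times the statistic of the absolute kernel. -/
theorem abs_kernelStat_sub_le {n : ℕ} {g : (Fin d₁ → ℝ) → ℝ} {W : Fin n → Fin d₁ ⊕ Fin d₂ → ℝ}
    (hφ : ∀ k, ∀ t ∉ S, φ k t = 0) (hh : ∀ k, 0 < h k) {r : ℝ}
    (hpos : ∀ z : Fin d₁ ⊕ Fin d₂ → ℝ, (∀ k, z k ∈ S) →
      0 < fX (xPart fun k => w k - h k * z k))
    (hg : ∀ z : Fin d₁ ⊕ Fin d₂ → ℝ, (∀ k, z k ∈ S) →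
      0 < g (xPart fun k => w k - h k * z k))
    (hr : ∀ z : Fin d₁ ⊕ Fin d₂ → ℝ, (∀ k, z k ∈ S) →
      |(fX (xPart fun k => w k - h k * z k) - g (xPart fun k => w k - h k * z k)) /
        g (xPart fun k => w k - h k * z k)| ≤ r) :
    |kernelStat φ g W w h - kernelStat φ fX W w h| ≤
      r * kernelStat (fun k t => |φ k t|) fX W w h := by
  have hterm : ∀ u, |kernelTerm φ g w h u - kernelTerm φ fX w h u| ≤
      r * kernelTerm (fun k t => |φ k t|) fX w h u := by
    intro u
    have habs : ∏ j, (h j)⁻¹ * |φ j ((w j - u j) / h j)| =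
        |∏ j, (h j)⁻¹ * φ j ((w j - u j) / h j)| := by
      simp only [Finset.abs_prod, abs_mul, abs_inv, abs_of_pos (hh _)]
    rw [kernelTerm, kernelTerm, kernelTerm, habs, ← sub_mul, abs_mul]
    by_cases hu : ∏ j, (h j)⁻¹ * φ j ((w j - u j) / h j) = 0
    · simp [hu]
    · obtain ⟨z, hz, rfl⟩ := exists_eq_of_prod_ne_zero hφ hh hu
      rw [← mul_assoc]
      refine mul_le_mul_of_nonneg_right ?_ (abs_nonneg _)
      have h1 := hpos z hz
      have h2 := hg z hz
      have h3 := hr z hz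
      set p := fX (xPart fun k => w k - h k * z k)
      set q := g (xPart fun k => w k - h k * z k)
      have e : 1 / q - 1 / p = (p - q) / q * (1 / p) := by field_simp
      rw [e, abs_mul, abs_of_pos (one_div_pos.2 h1)]
      exact mul_le_mul_of_nonneg_right h3 (one_div_pos.2 h1).le
  rw [kernelStat, kernelStat, kernelStat, ← mul_sub, ← Finset.sum_sub_distrib, abs_mul,
    abs_of_nonneg (by positivity : (0 : ℝ) ≤ 1 / (n : ℝ)), mul_left_comm]
  refine mul_le_mul_of_nonneg_left ?_ (by positivity)
  rw [Finset.mul_sum]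
  exact (Finset.abs_sum_le_sum_abs _ _).trans (Finset.sum_le_sum fun i _ => hterm _)

end Concentration

/-! ### Asymptotic comparisons -/

open Filter Asymptotics in
/-- The failure probability: a number of bandwidths polynomial in `n` is negligible. -/
theorem eventually_failure_le {c C b q : ℝ} (hc : 0 < c) (hb : 1 < b) (d : ℕ) :
    ∀ᶠ n : ℕ in atTop, C * ((n : ℝ) + 1) ^ d * Real.exp (-(c * Real.log n ^ b)) ≤
      (n : ℝ) ^ (-q) / 2 := by
  -- with `y = log n`, the left side is at most `|C| 2 ^ d exp (d y - c y ^ b)`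
  have h1 : Tendsto (fun y : ℝ => c * y ^ b - (q + d) * y) atTop atTop := by
    have h2 : Tendsto (fun y : ℝ => y * (c * y ^ (b - 1) - (q + d))) atTop atTop := by
      refine tendsto_id.atTop_mul_atTop₀ ?_
      refine tendsto_atTop_add_const_right _ _ ?_
      exact (tendsto_rpow_atTop (by linarith)).const_mul_atTop hc
    refine h2.congr' ?_
    filter_upwards [eventually_gt_atTop 0] with y hy
    have : y ^ b = y * y ^ (b - 1) := by
      rw [← Real.rpow_one_add' hy.le (by linarith)]; congr 1; ring
    rw [this]; ring
  have hlog : Tendsto (fun n : ℕ => Real.log n) atTop atTop :=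
    Real.tendsto_log_atTop.comp tendsto_natCast_atTop_atTop
  have h3 := (h1.comp hlog).eventually_ge_atTop (Real.log (2 * (|C| + 1) * 2 ^ d))
  filter_upwards [h3, eventually_ge_atTop 1] with n hn hn1
  have hn0 : (0 : ℝ) < n := by exact_mod_cast hn1
  have hn1' : (1 : ℝ) ≤ n := by exact_mod_cast hn1
  simp only [Function.comp] at hn
  have hC : 0 < 2 * (|C| + 1) * 2 ^ d := by positivity
  have h4 := (Real.log_le_iff_le_exp hC).1 hn
  have h5 : (n : ℝ) ^ (-q) = Real.exp (-q * Real.log n) := by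
    rw [Real.rpow_def_of_pos hn0, mul_comm]
  have h6 : (n : ℝ) ^ d = Real.exp (d * Real.log n) := by
    rw [← Real.rpow_natCast, Real.rpow_def_of_pos hn0, mul_comm]
  rw [h5, le_div_iff₀ two_pos]
  calc C * ((n : ℝ) + 1) ^ d * Real.exp (-(c * Real.log n ^ b)) * 2
      ≤ (|C| + 1) * (2 * n) ^ d * Real.exp (-(c * Real.log n ^ b)) * 2 := by
        gcongr
        · linarith [le_abs_self C]
        · linarith
    _ = (2 * (|C| + 1) * 2 ^ d) * Real.exp (d * Real.log n - c * Real.log n ^ b) := by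
        rw [mul_pow, h6, sub_eq_add_neg, Real.exp_add]; ring
    _ ≤ Real.exp (c * Real.log n ^ b - (q + d) * Real.log n) *
          Real.exp (d * Real.log n - c * Real.log n ^ b) := by gcongr
    _ = _ := by rw [← Real.exp_add]; congr 1; ring

/-! ### The good event -/

/-- The bandwidth with coordinates `β ^ θ_j / log n`. -/
noncomputable def gridBandwidth {ι : Type*} (β : ℝ) (n : ℕ) (θ : ι → ℕ) : ι → ℝ :=
  fun j => β ^ θ j / Real.log n

/-- On the ball of radius `ρ` around `w`, for the sup norm, `f` is `C^p`, depends only on the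
coordinates in `R` and is bounded by `F`, and `fX` is at least `δ`. -/
structure IsWindow {d₁ d₂ : ℕ} (p : ℕ) (fX : (Fin d₁ → ℝ) → ℝ)
    (f : (Fin d₁ ⊕ Fin d₂ → ℝ) → ℝ) (w : Fin d₁ ⊕ Fin d₂ → ℝ) (R : Finset (Fin d₁ ⊕ Fin d₂))
    (ρ δ F : ℝ) : Prop where
  radius_pos : 0 < ρ
  lower_pos : 0 < δ
  contDiffOn : ContDiffOn ℝ p f (Metric.ball w ρ)
  sparse : ∀ u ∈ Metric.ball w ρ, ∀ u' ∈ Metric.ball w ρ, (∀ j ∈ R, u j = u' j) → f u = f u'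
  lower : ∀ u ∈ Metric.ball w ρ, δ ≤ fX (xPart u)
  upper : ∀ u ∈ Metric.ball w ρ, |f u| ≤ F

/-- A neighbourhood `U_n(u)` contains a ball around `u`, as `0` is interior to the support. -/
theorem exists_ball_subset_nbhdN {ι : Type*} [Fintype ι] {p : ℕ} {K : ℝ → ℝ} (hK : IsKernel p K)
    {n : ℕ} (hn : 2 ≤ n) (u : ι → ℝ) : ∃ ρ > 0, Metric.ball u ρ ⊆ nbhdN K n u := by
  have hlog : 0 < Real.log n := Real.log_pos (by exact_mod_cast hn)
  obtain ⟨r, hr, hsub⟩ := Metric.isOpen_iff.1 isOpen_interior 0 hK.zero_mem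
  refine ⟨r / Real.log n, by positivity, fun v hv => ?_⟩
  rw [Metric.mem_ball, dist_pi_lt_iff (by positivity)] at hv
  refine ⟨fun j => (u j - v j) * Real.log n, fun j => interior_subset (hsub ?_), fun j => ?_⟩
  · have := hv j
    rw [Real.dist_eq, abs_sub_comm, lt_div_iff₀ hlog] at this
    rwa [mem_ball_zero_iff, Real.norm_eq_abs, abs_mul, abs_of_pos hlog]
  · simp only [initBandwidth]
    field_simp
    ring

theorem infOn_le {E : Type*} {g : E → ℝ} {U : Set E} (hpos : 0 < infOn g U) {u : E}
    (hu : u ∈ U) : infOn g U ≤ g u := by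
  refine csInf_le ?_ (Set.mem_image_of_mem g hu)
  -- an infimum that is not zero is not a junk value
  by_contra h
  rw [infOn, Real.sInf_of_not_bddBelow h] at hpos
  exact lt_irrefl 0 hpos

theorem xPart_mem_nbhdN {d₁ d₂ : ℕ} {K : ℝ → ℝ} {n : ℕ} {w u : Fin d₁ ⊕ Fin d₂ → ℝ}
    (hu : u ∈ nbhdN K n w) : xPart u ∈ nbhdN K n (xPart w) := by
  obtain ⟨z, hz, hzu⟩ := hu
  exact ⟨fun j => z (Sum.inl j), fun j => hz _, fun j => hzu _⟩

theorem exists_isWindow {d₁ d₂ p : ℕ} {K : ℝ → ℝ} (hK : IsKernel p K)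
    {fX : (Fin d₁ → ℝ) → ℝ} {f : (Fin d₁ ⊕ Fin d₂ → ℝ) → ℝ} {w : Fin d₁ ⊕ Fin d₂ → ℝ}
    {R : Finset (Fin d₁ ⊕ Fin d₂)} {n₀ : ℕ} (hn₀ : 2 ≤ n₀)
    (A1 : 0 < infOn fX (nbhdN K n₀ (xPart w))) (A2 : IsSparse K n₀ f w R)
    (A3 : IsRegular p K n₀ f w R) : ∃ ρ δ F, IsWindow p fX f w R ρ δ F := by
  obtain ⟨r, hr, hsub⟩ := exists_ball_subset_nbhdN hK hn₀ w
  have hcont : ContinuousOn f (Metric.closedBall w (r / 2)) :=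
    A3.1.continuousOn.mono ((Metric.closedBall_subset_ball (by linarith)).trans hsub)
  obtain ⟨F, hF⟩ := (isCompact_closedBall w (r / 2)).exists_bound_of_continuousOn hcont
  have hsub' : Metric.ball w (r / 2) ⊆ nbhdN K n₀ w :=
    (Metric.ball_subset_ball (by linarith)).trans hsub
  exact ⟨r / 2, infOn fX (nbhdN K n₀ (xPart w)), F, by linarith, A1, A3.1.mono hsub',
    fun u hu u' hu' => A2 u (hsub' hu) u' (hsub' hu'),
    fun u hu => infOn_le A1 (xPart_mem_nbhdN (hsub' hu)),
    fun u hu => hF u (Metric.ball_subset_closedBall hu)⟩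

theorem tendsto_log_natCast : Filter.Tendsto (fun n : ℕ => Real.log n) Filter.atTop Filter.atTop :=
  Real.tendsto_log_atTop.comp tendsto_natCast_atTop_atTop

theorem eventually_sub_mul_mem_ball {ι : Type*} [Fintype ι] {S : Set ℝ} (hS : IsCompact S)
    (w : ι → ℝ) {ρ : ℝ} (hρ : 0 < ρ) : ∀ᶠ n : ℕ in Filter.atTop,
      ∀ h : ι → ℝ, (∀ k, 0 ≤ h k ∧ h k ≤ 1 / Real.log n) →
      ∀ z : ι → ℝ, (∀ k, z k ∈ S) → (fun k => w k - h k * z k) ∈ Metric.ball w ρ := by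
  obtain ⟨B, hB⟩ := hS.isBounded.exists_norm_le
  filter_upwards [tendsto_log_natCast.eventually_gt_atTop ((|B| + 1) / ρ),
    tendsto_log_natCast.eventually_gt_atTop 0] with n hn hn0 h hh z hz
  refine (sub_mul_mem_ball hρ).2 fun k => ?_
  rw [abs_mul, abs_of_nonneg (hh k).1]
  calc h k * |z k| ≤ 1 / Real.log n * |B| :=
        mul_le_mul (hh k).2 ((hB _ (hz k)).trans (le_abs_self B)) (abs_nonneg _) (by positivity)
    _ < ρ := by
      rw [div_lt_iff₀ hρ] at hn
      rw [div_mul_eq_mul_div, one_mul, div_lt_iff₀ hn0]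
      linarith

theorem sub_mul_mem_nbhdN {ι : Type*} {p : ℕ} {K : ℝ → ℝ} (hK : IsKernel p K) {n : ℕ}
    (hn : 0 < Real.log n) {w h : ι → ℝ} (hh : ∀ k, 0 ≤ h k ∧ h k ≤ 1 / Real.log n)
    {z : ι → ℝ} (hz : ∀ k, z k ∈ tsupport K) : (fun k => w k - h k * z k) ∈ nbhdN K n w := by
  refine ⟨fun k => (h k * Real.log n) * z k, fun k => ?_, fun k => ?_⟩
  · have h1 : h k * Real.log n ≤ 1 := by
      have := (hh k).2
      rwa [le_div_iff₀ hn] at this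
    exact hK.convexSupport.smul_mem_of_zero_mem (interior_subset hK.zero_mem) (hz k)
      ⟨mul_nonneg (hh k).1 hn.le, h1⟩
  · simp only [initBandwidth]
    field_simp

section Grid

variable {ι : Type*} {β : ℝ} {n : ℕ}

theorem gridBandwidth_pos (hβ : β ∈ Set.Ioo (0 : ℝ) 1) (hn : 0 < Real.log n) (θ : ι → ℕ) (k : ι) :
    0 < gridBandwidth β n θ k := div_pos (pow_pos hβ.1 _) hn

theorem gridBandwidth_le (hβ : β ∈ Set.Ioo (0 : ℝ) 1) (hn : 0 < Real.log n) (θ : ι → ℕ) (k : ι) :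
    gridBandwidth β n θ k ≤ 1 / Real.log n :=
  div_le_div_of_nonneg_right (pow_le_one₀ hβ.1.le hβ.2.le) hn.le

variable [Fintype ι]

theorem prod_gridBandwidth (θ : ι → ℕ) :
    ∏ k, gridBandwidth β n θ k = (∏ k, β ^ θ k) / Real.log n ^ Fintype.card ι := by
  simp [gridBandwidth, Finset.prod_div_distrib]

theorem prod_gridBandwidth_le (hβ : β ∈ Set.Ioo (0 : ℝ) 1) (hn : 0 < Real.log n) (θ : ι → ℕ) :
    ∏ k, gridBandwidth β n θ k ≤ 1 / Real.log n ^ Fintype.card ι := by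
  rw [prod_gridBandwidth]
  refine div_le_div_of_nonneg_right ?_ (by positivity)
  exact Finset.prod_le_one (fun k _ => (pow_pos hβ.1 _).le) fun k _ => pow_le_one₀ hβ.1.le hβ.2.le

/-- The exponents of a bandwidth at which the loop continues are at most `n`. -/
theorem exponent_le (hβ : β ∈ Set.Ioo (0 : ℝ) 1) (hn : 1 ≤ Real.log n)
    (hβn : n * β ^ n < 1) {θ : ι → ℕ}
    (hθ : Real.log n / n ≤ ∏ k, gridBandwidth β n θ k) (k : ι) : θ k ≤ n := by
  classical
  by_contra! hk
  have hn0 : 0 < n := by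
    rcases Nat.eq_zero_or_pos n with rfl | h
    · norm_num at hn
    · exact h
  have hn0' : (0 : ℝ) < n := by exact_mod_cast hn0
  have h1 : ∏ k, gridBandwidth β n θ k ≤ β ^ n := by
    rw [prod_gridBandwidth]
    refine (div_le_self (Finset.prod_nonneg fun k _ => (pow_pos hβ.1 _).le)
      (one_le_pow₀ hn)).trans ?_
    rw [← Finset.mul_prod_erase _ _ (Finset.mem_univ k)]
    calc _ ≤ β ^ θ k * 1 := mul_le_mul_of_nonneg_left (Finset.prod_le_one
          (fun k _ => (pow_pos hβ.1 _).le) fun k _ => pow_le_one₀ hβ.1.le hβ.2.le)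
          (pow_pos hβ.1 _).le
      _ = β ^ θ k := mul_one _
      _ ≤ β ^ n := pow_le_pow_of_le_one hβ.1.le hβ.2.le hk.le
  have h2 := hθ.trans h1
  rw [div_le_iff₀ hn0'] at h2
  linarith

end Grid

open Filter in
/-- With high probability a kernel statistic is close to its expectation at all bandwidths of the
grid at which the loop continues, even with the estimated marginal density. -/
theorem eventually_exists_good_event_of_kernel {d₁ d₂ p : ℕ} {K : ℝ → ℝ} (hK : IsKernel p K)
    {β a : ℝ} (hβ : β ∈ Set.Ioo (0 : ℝ) 1) (ha : 1 < a)
    {fX : (Fin d₁ → ℝ) → ℝ} {f : (Fin d₁ ⊕ Fin d₂ → ℝ) → ℝ} (hf : IsCondDensity fX f)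
    {w : Fin d₁ ⊕ Fin d₂ → ℝ} {R : Finset (Fin d₁ ⊕ Fin d₂)} {ρ δ F : ℝ}
    (hwin : IsWindow p fX f w R ρ δ F) {φ : Fin d₁ ⊕ Fin d₂ → ℝ → ℝ}
    (hc : ∀ k, Continuous (φ k)) (hφ : ∀ k, ∀ t ∉ tsupport K, φ k t = 0)
    {MX q ε : ℝ} (hMX : 0 < MX) (hε : 0 < ε) :
    ∀ᶠ n : ℕ in atTop, ∀ (Ω : Type*) [MeasurableSpace Ω] (P : Measure Ω) [IsProbabilityMeasure P]
      (W : Fin n → Ω → Fin d₁ ⊕ Fin d₂ → ℝ) (g : Ω → (Fin d₁ → ℝ) → ℝ),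
      IsSample P W fX f → EstimatorConditions P K (d₁ + d₂) n fX (xPart w) MX g →
      ∃ E : Set Ω, P.real E ≤ (n : ℝ) ^ (-q) ∧ ∀ ω ∉ E, ∀ θ : Fin d₁ ⊕ Fin d₂ → ℕ,
        Real.log n / n ≤ ∏ k, gridBandwidth β n θ k →
        |kernelStat φ (g ω) (fun i => W i ω) w (gridBandwidth β n θ) -
          smooth φ f w (gridBandwidth β n θ)| ≤
        ε * Real.sqrt (Real.log n ^ a / (n * ∏ k, gridBandwidth β n θ k)) := by
  have hS : IsCompact (tsupport K) := hK.compactSupport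
  have hbdd : ∃ B, ∀ k t, |φ k t| ≤ B := by
    choose C hC using fun k => (hc k).bounded_above_of_compact_support
      (HasCompactSupport.intro hS (hφ k))
    exact ⟨∑ k, C k, fun k t => (hC k t).trans (Finset.single_le_sum (f := C)
      (fun k _ => (norm_nonneg _).trans (hC k 0)) (Finset.mem_univ k))⟩
  obtain ⟨B, hB⟩ := hbdd
  obtain ⟨A, hA, hA1, hA2⟩ : ∃ A : ℝ, 0 < A ∧ B ^ (d₁ + d₂) / δ ≤ A ∧
      (∏ k, ∫ t, |φ k t|) * F ≤ A :=
    ⟨max 1 (max (B ^ (d₁ + d₂) / δ) ((∏ k, ∫ t, |φ k t|) * F)),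
      lt_max_of_lt_left one_pos, (le_max_left _ _).trans (le_max_right _ _),
      (le_max_right _ _).trans (le_max_right _ _)⟩
  set c := min ((ε / 4) ^ 2 / (4 * A ^ 2)) (ε / 4 / (2 * A)) with hcdef
  have hc0 : 0 < c := lt_min (by positivity) (by positivity)
  have ev1 := eventually_failure_le (C := 4) (q := q) hc0 (b := (a + 1) / 2) (by linarith) (d₁ + d₂)
  have ev2 := eventually_failure_le (C := 1) (q := q) one_pos (b := 5 / 4) (by norm_num) 0
  have ev3 : ∀ᶠ n : ℕ in atTop, (n : ℝ) * β ^ n < 1 :=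
    (tendsto_self_mul_const_pow_of_lt_one hβ.1.le hβ.2).eventually_lt_const one_pos
  have ev4 : ∀ᶠ n : ℕ in atTop,
      MX * (Real.log n ^ (((d₁ + d₂ : ℕ) : ℝ) / 2) / (n : ℝ) ^ ((1 : ℝ) / 2)) ≤ 1 := by
    have h1 := ((isLittleO_log_rpow_rpow_atTop (((d₁ + d₂ : ℕ) : ℝ) / 2)
      (by norm_num : (0 : ℝ) < 1 / 2)).tendsto_div_nhds_zero.comp
        tendsto_natCast_atTop_atTop).const_mul MX
    rw [mul_zero] at h1
    exact (h1.eventually_lt_const one_pos).mono fun n hn => hn.le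
  have ev5 : ∀ᶠ n : ℕ in atTop, MX * A * (2 / ε) ≤ Real.log n ^ (a / 2) :=
    ((tendsto_rpow_atTop (by linarith)).comp tendsto_log_natCast).eventually_ge_atTop _
  filter_upwards [ev1, ev2, ev3, ev4, ev5, tendsto_log_natCast.eventually_ge_atTop 1,
    eventually_sub_mul_mem_ball hS w hwin.radius_pos, eventually_ge_atTop 1]
    with n h1 h2 h3 h4 h5 hL hball hn1 Ω _ P _ W g hW hg
  set L := Real.log n with hLdef
  have hL0 : 0 < L := by linarith
  have hn0 : (0 : ℝ) < n := by exact_mod_cast hn1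
  set r := MX * (L ^ (((d₁ + d₂ : ℕ) : ℝ) / 2) / (n : ℝ) ^ ((1 : ℝ) / 2)) with hr
  have hr0 : 0 ≤ r := by positivity
  set s : (Fin d₁ ⊕ Fin d₂ → ℕ) → ℝ := fun θ =>
    Real.sqrt (L ^ a / (n * ∏ k, gridBandwidth β n θ k)) with hs
  have hgrid : ∀ θ : Fin d₁ ⊕ Fin d₂ → ℕ, ∀ k, 0 ≤ gridBandwidth β n θ k ∧
      gridBandwidth β n θ k ≤ 1 / Real.log n := fun θ k =>
    ⟨(gridBandwidth_pos hβ hL0 θ k).le, gridBandwidth_le hβ hL0 θ k⟩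
  let ψ : Fin d₁ ⊕ Fin d₂ → ℝ → ℝ := fun k t => |φ k t|
  have hψc : ∀ k, Continuous (ψ k) := fun k => (hc k).abs
  have hψ0 : ∀ k, ∀ t ∉ tsupport K, ψ k t = 0 := fun k t ht => by simp [ψ, hφ k t ht]
  have hψB : ∀ k t, |ψ k t| ≤ B := fun k t => by simpa [ψ] using hB k t
  have hψA : (∏ k, ∫ t, |ψ k t|) * F ≤ A := by simpa [ψ] using hA2
  let dev : (Fin d₁ ⊕ Fin d₂ → ℝ → ℝ) → (Fin d₁ ⊕ Fin d₂ → ℕ) → Set Ω := fun φ θ =>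
    {ω | ε / 4 * s θ ≤ |kernelStat φ fX (fun i => W i ω) w (gridBandwidth β n θ) -
      smooth φ f w (gridBandwidth β n θ)|}
  let bad : (Fin d₁ ⊕ Fin d₂ → ℕ) → Set Ω := fun θ =>
    {ω | L / n ≤ ∏ k, gridBandwidth β n θ k ∧ ω ∈ dev φ θ ∪ dev ψ θ}
  have hbad : ∀ θ, P.real (bad θ) ≤ 4 * Real.exp (-(c * L ^ ((a + 1) / 2))) := by
    intro θ
    by_cases hθ : L / n ≤ ∏ k, gridBandwidth β n θ k
    · have hx : L ≤ n * ∏ k, gridBandwidth β n θ k := by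
        rwa [div_le_iff₀ hn0, mul_comm] at hθ
      have hpos : ∀ z : Fin d₁ ⊕ Fin d₂ → ℝ, (∀ k, z k ∈ tsupport K) →
          δ ≤ fX (xPart fun k => w k - gridBandwidth β n θ k * z k) := fun z hz =>
        hwin.lower _ (hball _ (hgrid θ) z hz)
      have hF : ∀ z : Fin d₁ ⊕ Fin d₂ → ℝ, (∀ k, z k ∈ tsupport K) →
          |f fun k => w k - gridBandwidth β n θ k * z k| ≤ F := fun z hz =>
        hwin.upper _ (hball _ (hgrid θ) z hz)
      have c1 := measureReal_kernelStat_sub_smooth_ge_le (Nat.pos_of_ne_zero (by omega)) hf hW hS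
        hc hφ (gridBandwidth_pos hβ hL0 θ) hwin.lower_pos hB hpos hF hA hA1 hA2
        (by positivity : 0 < ε / 4) ha hL hx
      have c2 := measureReal_kernelStat_sub_smooth_ge_le (Nat.pos_of_ne_zero (by omega)) hf hW hS
        hψc hψ0 (gridBandwidth_pos hβ hL0 θ) hwin.lower_pos hψB hpos hF hA hA1 hψA
        (by positivity : 0 < ε / 4) ha hL hx
      calc P.real (bad θ) ≤ P.real (dev φ θ ∪ dev ψ θ) := measureReal_mono fun ω hω => hω.2
        _ ≤ P.real (dev φ θ) + P.real (dev ψ θ) := measureReal_union_le _ _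
        _ ≤ _ := by linarith
    · have : bad θ = ∅ := Set.eq_empty_of_forall_notMem fun ω hω => hθ hω.1
      rw [this, measureReal_empty]
      positivity
  let acc : Set Ω := {ω | ∃ u ∈ nbhdN K n (xPart w), r < |(fX u - g ω u) / g ω u|}
  let low : Set Ω := {ω | ¬ 0 < infOn (g ω) (nbhdN K n (xPart w))}
  have hlow : P.real low = 0 := by
    rw [measureReal_def, ae_iff.1 hg.lower, ENNReal.toReal_zero]
  have hacc : P.real acc ≤ (n : ℝ) ^ (-q) / 2 := by
    refine hg.accuracy.trans ?_
    simpa using h2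
  let U : Set Ω := ⋃ θ : Fin d₁ ⊕ Fin d₂ → Fin (n + 1), bad fun k => θ k
  have hU : P.real U ≤ (n : ℝ) ^ (-q) / 2 := by
    refine (measureReal_iUnion_fintype_le _).trans ((Finset.sum_le_sum fun θ _ =>
      hbad fun k => θ k).trans (le_trans (le_of_eq ?_) h1))
    simp only [Finset.sum_const, Finset.card_univ, Fintype.card_pi, Fintype.card_fin,
      Finset.prod_const, Fintype.card_sum, nsmul_eq_mul]
    push_cast
    ring
  refine ⟨U ∪ acc ∪ low, ?_, fun ω hω θ hθ => ?_⟩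
  · have i1 := measureReal_union_le (μ := P) (U ∪ acc) low
    have i2 := measureReal_union_le (μ := P) U acc
    linarith
  · have hωU : ω ∉ U := fun h => hω (Or.inl (Or.inl h))
    have hωacc : ω ∉ acc := fun h => hω (Or.inl (Or.inr h))
    have hωlow : 0 < infOn (g ω) (nbhdN K n (xPart w)) := by
      by_contra h
      exact hω (Or.inr h)
    have hθn := exponent_le hβ hL h3 hθ
    have hnot : ω ∉ bad θ := fun h => hωU (Set.mem_iUnion.2
      ⟨fun k => ⟨θ k, Nat.lt_succ_of_le (hθn k)⟩, h⟩)
    have hφdev : |kernelStat φ fX (fun i => W i ω) w (gridBandwidth β n θ) -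
        smooth φ f w (gridBandwidth β n θ)| ≤ ε / 4 * s θ := by
      by_contra! h
      exact hnot ⟨hθ, Or.inl h.le⟩
    have hψdev : |kernelStat ψ fX (fun i => W i ω) w (gridBandwidth β n θ) -
        smooth ψ f w (gridBandwidth β n θ)| ≤ ε / 4 * s θ := by
      by_contra! h
      exact hnot ⟨hθ, Or.inr h.le⟩
    have hmem : ∀ z : Fin d₁ ⊕ Fin d₂ → ℝ, (∀ k, z k ∈ tsupport K) →
        (xPart fun k => w k - gridBandwidth β n θ k * z k) ∈ nbhdN K n (xPart w) := fun z hz =>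
      xPart_mem_nbhdN (sub_mul_mem_nbhdN hK hL0 (hgrid θ) hz)
    have hrepl := abs_kernelStat_sub_le (W := fun i => W i ω) hφ (gridBandwidth_pos hβ hL0 θ)
      (fun z hz => hwin.lower_pos.trans_le (hwin.lower _ (hball _ (hgrid θ) z hz)))
      (fun z hz => hωlow.trans_le (infOn_le hωlow (hmem z hz)))
      (fun z hz => not_lt.1 fun h => hωacc ⟨_, hmem z hz, h⟩)
    have hψsm : smooth ψ f w (gridBandwidth β n θ) ≤ A :=
      (le_abs_self _).trans ((abs_smooth_le hS hψc hψ0 fun z hz =>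
        hwin.upper _ (hball _ (hgrid θ) z hz)).trans hψA)
    have hs0 : 0 ≤ s θ := Real.sqrt_nonneg _
    -- the scale `s` is at least its value at the largest bandwidth
    have hsr : r * A ≤ ε / 2 * s θ := by
      have hp : 0 < ∏ k, gridBandwidth β n θ k :=
        Finset.prod_pos fun k _ => gridBandwidth_pos hβ hL0 θ k
      have hd : ∏ k, gridBandwidth β n θ k ≤ 1 / L ^ (d₁ + d₂) := by
        simpa using prod_gridBandwidth_le hβ hL0 θ
      have hle : L ^ (a / 2) * (L ^ (((d₁ + d₂ : ℕ) : ℝ) / 2) / (n : ℝ) ^ ((1 : ℝ) / 2)) ≤ s θ := by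
        refine Real.le_sqrt_of_sq_le ?_
        have e : (L ^ (a / 2) * (L ^ (((d₁ + d₂ : ℕ) : ℝ) / 2) / (n : ℝ) ^ ((1 : ℝ) / 2))) ^ 2 =
            L ^ a / (n * (1 / L ^ (d₁ + d₂))) := by
          rw [mul_pow, div_pow, ← Real.rpow_natCast (L ^ (a / 2)),
            ← Real.rpow_natCast (L ^ (((d₁ + d₂ : ℕ) : ℝ) / 2)),
            ← Real.rpow_natCast ((n : ℝ) ^ ((1 : ℝ) / 2)), ← Real.rpow_mul hL0.le,
            ← Real.rpow_mul hL0.le, ← Real.rpow_mul hn0.le, ← Real.rpow_natCast L (d₁ + d₂)]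
          have e1 : a / 2 * ((2 : ℕ) : ℝ) = a := by push_cast; ring
          have e2 : ((d₁ + d₂ : ℕ) : ℝ) / 2 * ((2 : ℕ) : ℝ) = ((d₁ + d₂ : ℕ) : ℝ) := by
            push_cast; ring
          have e3 : (1 : ℝ) / 2 * ((2 : ℕ) : ℝ) = 1 := by norm_num
          rw [e1, e2, e3, Real.rpow_one]
          field_simp
        rw [e]
        gcongr
      have h5' : MX * A ≤ ε / 2 * L ^ (a / 2) := by
        have := mul_le_mul_of_nonneg_left h5 (by positivity : 0 ≤ ε / 2)
        calc MX * A = ε / 2 * (MX * A * (2 / ε)) := by field_simp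
          _ ≤ _ := this
      calc r * A = (MX * A) * (L ^ (((d₁ + d₂ : ℕ) : ℝ) / 2) / (n : ℝ) ^ ((1 : ℝ) / 2)) := by
            rw [hr]; ring
        _ ≤ (ε / 2 * L ^ (a / 2)) *
            (L ^ (((d₁ + d₂ : ℕ) : ℝ) / 2) / (n : ℝ) ^ ((1 : ℝ) / 2)) := by gcongr
        _ ≤ ε / 2 * s θ := by
          rw [mul_assoc]
          exact mul_le_mul_of_nonneg_left hle (by positivity)
    have hψ1 : kernelStat ψ fX (fun i => W i ω) w (gridBandwidth β n θ) ≤ A + ε / 4 * s θ := by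
      linarith [(abs_le.1 hψdev).2]
    have h6 : r * kernelStat ψ fX (fun i => W i ω) w (gridBandwidth β n θ) ≤
        r * A + ε / 4 * s θ := by
      calc _ ≤ r * (A + ε / 4 * s θ) := mul_le_mul_of_nonneg_left hψ1 hr0
        _ ≤ r * A + ε / 4 * s θ := by nlinarith [mul_nonneg hε.le hs0]
    calc _ ≤ |kernelStat φ (g ω) (fun i => W i ω) w (gridBandwidth β n θ) -
            kernelStat φ fX (fun i => W i ω) w (gridBandwidth β n θ)| +
          |kernelStat φ fX (fun i => W i ω) w (gridBandwidth β n θ) -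
            smooth φ f w (gridBandwidth β n θ)| := abs_sub_le _ _ _
      _ ≤ (r * A + ε / 4 * s θ) + ε / 4 * s θ := add_le_add (hrepl.trans h6) hφdev
      _ ≤ ε * s θ := by linarith

open Filter in
/-- The good event, simultaneously for finitely many product kernels. -/
theorem eventually_exists_good_event {d₁ d₂ p : ℕ} {K : ℝ → ℝ} (hK : IsKernel p K)
    {β a : ℝ} (hβ : β ∈ Set.Ioo (0 : ℝ) 1) (ha : 1 < a)
    {fX : (Fin d₁ → ℝ) → ℝ} {f : (Fin d₁ ⊕ Fin d₂ → ℝ) → ℝ} (hf : IsCondDensity fX f)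
    {w : Fin d₁ ⊕ Fin d₂ → ℝ} {R : Finset (Fin d₁ ⊕ Fin d₂)} {ρ δ F : ℝ}
    (hwin : IsWindow p fX f w R ρ δ F) {κ : Type*} [Fintype κ]
    {φ : κ → Fin d₁ ⊕ Fin d₂ → ℝ → ℝ}
    (hc : ∀ c k, Continuous (φ c k)) (hφ : ∀ c k, ∀ t ∉ tsupport K, φ c k t = 0)
    {MX ε : ℝ} (q : ℝ) (hMX : 0 < MX) (hε : 0 < ε) :
    ∀ᶠ n : ℕ in atTop, ∀ (Ω : Type*) [MeasurableSpace Ω] (P : Measure Ω) [IsProbabilityMeasure P]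
      (W : Fin n → Ω → Fin d₁ ⊕ Fin d₂ → ℝ) (g : Ω → (Fin d₁ → ℝ) → ℝ),
      IsSample P W fX f → EstimatorConditions P K (d₁ + d₂) n fX (xPart w) MX g →
      ∃ E : Set Ω, P.real E ≤ (n : ℝ) ^ (-q) ∧ ∀ ω ∉ E, ∀ θ : Fin d₁ ⊕ Fin d₂ → ℕ,
        Real.log n / n ≤ ∏ k, gridBandwidth β n θ k → ∀ c,
        |kernelStat (φ c) (g ω) (fun i => W i ω) w (gridBandwidth β n θ) -
          smooth (φ c) f w (gridBandwidth β n θ)| ≤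
        ε * Real.sqrt (Real.log n ^ a / (n * ∏ k, gridBandwidth β n θ k)) := by
  have hall := eventually_all.2 fun c => eventually_exists_good_event_of_kernel hK hβ ha hf hwin
    (hc c) (hφ c) (q := q + 1) hMX hε
  filter_upwards [hall, eventually_ge_atTop (Fintype.card κ), eventually_ge_atTop 1]
    with n h hcard hn1 Ω _ P _ W g hW hg
  choose E hE hdev using fun c => h c Ω P W g hW hg
  have hn0 : (0 : ℝ) < n := by exact_mod_cast hn1
  refine ⟨⋃ c, E c, ?_, fun ω hω θ hθ c => hdev c ω (fun hc => hω (Set.mem_iUnion.2 ⟨c, hc⟩)) θ hθ⟩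
  calc P.real (⋃ c, E c) ≤ ∑ c, P.real (E c) := measureReal_iUnion_fintype_le _
    _ ≤ ∑ _c : κ, (n : ℝ) ^ (-(q + 1)) := Finset.sum_le_sum fun c _ => hE c
    _ = Fintype.card κ * (n : ℝ) ^ (-(q + 1)) := by simp
    _ ≤ n * (n : ℝ) ^ (-(q + 1)) := by gcongr
    _ = (n : ℝ) ^ (-q) := by
      rw [show -q = 1 + -(q + 1) by ring, Real.rpow_add hn0, Real.rpow_one]

/-! ### The path of the algorithm -/

section Path

variable {ι : Type*} [Fintype ι]

open Classical in
/-- The exponents after `t` iterations in which exactly the coordinates in `R` were reduced. -/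
noncomputable def commonExponent (R : Finset ι) (t : ℕ) : ι → ℕ := fun j => if j ∈ R then t else 0

/-- The state `s` after `t` iterations is consistent with all the coordinates in `R` being reduced
in the first `t₁` iterations, and at most `m` times in total, and no others. -/
def OnPath (β : ℝ) (n : ℕ) (R : Finset ι) (t₁ m t : ℕ) (s : State ι) : Prop :=
  ∃ θ : ι → ℕ, s.h = gridBandwidth β n θ ∧ (∀ j ∉ R, θ j = 0) ∧ (∀ j ∈ s.active, θ j = t) ∧
    (t ≤ t₁ → θ = commonExponent R t ∧ R ⊆ s.active) ∧
    (t₁ ≤ t → ∀ j ∈ R, t₁ ≤ θ j ∧ θ j ≤ m)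

/-- If the tests reject the coordinates outside `R` at once, accept those in `R` during the first
`t₁` iterations and reject them after `m` reductions, then the selected bandwidth has exponents
between `t₁` and `m` on `R`, and `0` elsewhere. -/
theorem output_eq_gridBandwidth {Z lam : (ι → ℝ) → ι → ℝ} {β : ℝ} (hβ : β ∈ Set.Ioo (0 : ℝ) 1)
    {n : ℕ} (hn : 2 ≤ n) {R : Finset ι} {t₁ m : ℕ} (hm : t₁ ≤ m) (ht₁ : 0 < t₁)
    (hoff : ∀ θ : ι → ℕ, Real.log n / n ≤ ∏ k, gridBandwidth β n θ k → ∀ j ∉ R,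
      |Z (gridBandwidth β n θ) j| < lam (gridBandwidth β n θ) j)
    (hcont : ∀ t < t₁, Real.log n / n ≤ ∏ k, gridBandwidth β n (commonExponent R t) k)
    (hpass : ∀ t < t₁, ∀ j ∈ R, lam (gridBandwidth β n (commonExponent R t)) j ≤
      |Z (gridBandwidth β n (commonExponent R t)) j|)
    (h_reject : ∀ θ : ι → ℕ, Real.log n / n ≤ ∏ k, gridBandwidth β n θ k →
      (∀ k ∈ R, t₁ ≤ θ k) → ∀ j ∈ R, θ j = m →
      |Z (gridBandwidth β n θ) j| < lam (gridBandwidth β n θ) j) :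
    ∃ θ : ι → ℕ, output Z lam β n = gridBandwidth β n θ ∧ (∀ j ∈ R, t₁ ≤ θ j ∧ θ j ≤ m) ∧
      ∀ j ∉ R, θ j = 0 := by
  classical
  have hsucc : ∀ t, stateAt Z lam β n (t + 1) = (stateAt Z lam β n t).next Z lam β := by
    intro t
    simp only [stateAt, Function.iterate_succ_apply']
  have hinit : OnPath β n R t₁ m 0 (stateAt Z lam β n 0) := by
    refine ⟨fun _ => 0, ?_, fun _ _ => rfl, fun _ _ => rfl, fun _ => ⟨?_, ?_⟩, fun h => ?_⟩
    · ext k; simp [stateAt, initBandwidth, gridBandwidth]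
    · ext k; simp [commonExponent]
    · exact fun _ _ => Finset.mem_univ _
    · omega
  have hstep : ∀ (t : ℕ) (s : State ι), OnPath β n R t₁ m t s → s.Continues n →
      OnPath β n R t₁ m (t + 1) (s.next Z lam β) := by
    rintro t s ⟨θ, hh, hθR, hact, hlow, hhigh⟩ ⟨-, hprod⟩
    rw [hh] at hprod
    have hpassR : ∀ j, lam s.h j ≤ |Z s.h j| → j ∈ R := by
      intro j hj
      by_contra hjR
      rw [hh] at hj
      exact absurd (hoff θ hprod j hjR) (not_lt.2 hj)
    refine ⟨fun j => if j ∈ s.active ∧ lam s.h j ≤ |Z s.h j| then θ j + 1 else θ j,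
      ?_, ?_, ?_, ?_, ?_⟩
    · ext j
      simp only [State.next, gridBandwidth]
      have := congrFun hh j
      simp only [gridBandwidth] at this
      split_ifs with h
      · rw [this, pow_succ]; ring
      · exact this
    · intro j hj
      simp only
      rw [if_neg fun h => hj (hpassR j h.2), hθR j hj]
    · intro j hj
      simp only [State.next, Finset.mem_filter] at hj
      simp only
      rw [if_pos hj, hact j hj.1]
    · intro ht
      obtain ⟨rfl, hRact⟩ := hlow (by omega)
      have hp : ∀ j ∈ R, lam s.h j ≤ |Z s.h j| := by
        intro j hj
        rw [hh]
        exact hpass t (by omega) j hj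
      refine ⟨?_, fun j hj => ?_⟩
      · ext j
        by_cases hj : j ∈ R
        · simp [hRact hj, hp j hj, commonExponent, hj]
        · have : ¬ lam s.h j ≤ |Z s.h j| := fun h => hj (hpassR j h)
          simp [this, commonExponent, hj]
      · simp only [State.next, Finset.mem_filter]
        exact ⟨hRact hj, hp j hj⟩
    · intro ht j hj
      simp only
      rcases Nat.lt_or_ge t t₁ with hlt | hge
      · obtain ⟨rfl, hRact⟩ := hlow (by omega)
        have hp : lam s.h j ≤ |Z s.h j| := by
          rw [hh]
          exact hpass t hlt j hj
        rw [if_pos ⟨hRact hj, hp⟩]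
        simp only [commonExponent, if_pos hj]
        omega
      · obtain ⟨h1, h2⟩ := hhigh hge j hj
        split_ifs with hcase
        · have hne : θ j ≠ m := by
            intro e
            have := h_reject θ hprod (fun k hk => (hhigh hge k hk).1) j hj e
            rw [← hh] at this
            exact absurd this (not_lt.2 hcase.2)
          omega
        · exact ⟨h1, h2⟩
  have H := exists_not_continues Z lam hβ hn
  have hpath : ∀ t ≤ Nat.find H, OnPath β n R t₁ m t (stateAt Z lam β n t) := by
    intro t
    induction t with
    | zero => exact fun _ => hinit
    | succ t ih =>
      intro ht
      rw [hsucc]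
      exact hstep t _ (ih (by omega)) (not_not.1 (Nat.find_min H (by omega)))
  obtain ⟨θ, hh, hθR, -, hlow, hhigh⟩ := hpath _ le_rfl
  refine ⟨θ, ?_, fun j hj => ?_, hθR⟩
  · rw [output, dif_pos H, ← hh]
  · rcases Nat.lt_or_ge (Nat.find H) t₁ with hlt | hge
    · -- the loop cannot end before `t₁` iterations
      obtain ⟨e, hRact⟩ := hlow hlt.le
      refine absurd ⟨⟨j, hRact hj⟩, ?_⟩ (Nat.find_spec H)
      rw [hh, e]
      exact hcont _ hlt
    · exact hhigh hge j hj

end Path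

/-! ### The constants -/

section Constants

variable {d₁ d₂ p : ℕ} {K : ℝ → ℝ} {β a : ℝ} {f : (Fin d₁ ⊕ Fin d₂ → ℝ) → ℝ}
  {w : Fin d₁ ⊕ Fin d₂ → ℝ} {R : Finset (Fin d₁ ⊕ Fin d₂)}

theorem iInf_abs_partialD_le {j : Fin d₁ ⊕ Fin d₂} (hj : j ∈ R) :
    ⨅ j : R, |partialD p f j w| ≤ |partialD p f j w| :=
  ciInf_le (Set.finite_range fun j : R => |partialD p f j w|).bddBelow (⟨j, hj⟩ : R)

theorem le_iSup_abs_partialD {j : Fin d₁ ⊕ Fin d₂} (hj : j ∈ R) :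
    |partialD p f j w| ≤ ⨆ j : R, |partialD p f j w| :=
  le_ciSup (Set.finite_range fun j : R => |partialD p f j w|).bddAbove (⟨j, hj⟩ : R)

theorem iInf_abs_partialD_pos (hR : R.Nonempty) (hD : ∀ j ∈ R, partialD p f j w ≠ 0) :
    0 < ⨅ j : R, |partialD p f j w| := by
  have : Nonempty R := hR.to_subtype
  obtain ⟨j, hj⟩ := exists_eq_ciInf_of_finite (f := fun j : R => |partialD p f j w|)
  rw [← hj]
  exact abs_pos.2 (hD j j.2)

theorem iInf_abs_partialD_le_iSup (hR : R.Nonempty) :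
    ⨅ j : R, |partialD p f j w| ≤ ⨆ j : R, |partialD p f j w| := by
  obtain ⟨j, hj⟩ := hR
  exact (iInf_abs_partialD_le hj).trans (le_iSup_abs_partialD hj)

theorem cTau_pos (hK : IsKernel p K) (hR : R.Nonempty) (hD : ∀ j ∈ R, partialD p f j w ≠ 0) :
    0 < cTau p K f w R := by
  have h1 := iInf_abs_partialD_pos hR hD
  have h2 := cLam_pos hK (d₁ + d₂)
  have h3 := hK.moment_ne_zero
  have h4 : ((p - 1).factorial : ℝ) ≠ 0 := by exact_mod_cast (p - 1).factorial_ne_zero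
  unfold cTau
  have : 4 * ((p - 1).factorial : ℝ) * cLam K (d₁ + d₂) /
      ((⨅ j : R, |partialD p f j w|) * ∫ t, t ^ p * K t) ≠ 0 :=
    div_ne_zero (by positivity) (mul_ne_zero h1.ne' h3)
  positivity

theorem cT_pos (hR : R.Nonempty) (hD : ∀ j ∈ R, partialD p f j w ≠ 0) : 0 < cT p f w R := by
  have h1 := iInf_abs_partialD_pos hR hD
  have h2 := h1.trans_le (iInf_abs_partialD_le_iSup hR)
  unfold cT
  positivity

theorem cT_le (hR : R.Nonempty) (hD : ∀ j ∈ R, partialD p f j w ≠ 0) :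
    cT p f w R ≤ 1 / 576 := by
  have h1 := iInf_abs_partialD_pos hR hD
  have h2 := iInf_abs_partialD_le_iSup (p := p) (f := f) (w := w) hR
  have h3 := h1.trans_le h2
  rw [cT, div_pow, mul_pow, div_le_iff₀ (by positivity)]
  have := pow_le_pow_left₀ h1.le h2 2
  linarith

theorem rpow_log_div_log {β x : ℝ} (hβ : β ∈ Set.Ioo (0 : ℝ) 1) (hx : 0 < x) :
    β ^ (Real.log x⁻¹ / Real.log (1 / β)) = x := by
  have hl : Real.log β ≠ 0 := (Real.log_neg hβ.1 hβ.2).ne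
  rw [Real.rpow_def_of_pos hβ.1, one_div, Real.log_inv, Real.log_inv, neg_div_neg_eq,
    mul_div_cancel₀ _ hl, Real.exp_log hx]

/-- The defining property of `τ_n`. -/
theorem rpow_tau_pow (hp : 1 ≤ p) (hβ : β ∈ Set.Ioo (0 : ℝ) 1) (hC : 0 < cTau p K f w R) {n : ℕ}
    (hn : 0 < n) (hL : 0 < Real.log n) :
    (β ^ tau p K β a f w R n) ^ (2 * p + R.card) =
      cTau p K f w R * Real.log n ^ (2 * p) * Real.log n ^ (d₁ + d₂) * Real.log n ^ a / n := by
  have hn' : (0 : ℝ) < n := by exact_mod_cast hn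
  have hpow : Real.log n ^ (2 * p + ((d₁ + d₂ : ℕ) : ℝ) + a) =
      Real.log n ^ (2 * p) * Real.log n ^ (d₁ + d₂) * Real.log n ^ a := by
    rw [Real.rpow_add hL, Real.rpow_add hL, Real.rpow_natCast]
    congr 2
    exact_mod_cast Real.rpow_natCast (Real.log n) (2 * p)
  have hX : 0 < cTau p K f w R * Real.log n ^ (2 * p + ((d₁ + d₂ : ℕ) : ℝ) + a) / n := by
    have := Real.rpow_pos_of_pos hL (2 * p + ((d₁ + d₂ : ℕ) : ℝ) + a)
    positivity
  have hk : (2 * (p : ℝ) + R.card) ≠ 0 := by positivity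
  rw [← Real.rpow_natCast, ← Real.rpow_mul hβ.1.le, tau]
  have e : 1 / ((2 * (p : ℝ) + R.card) * Real.log (1 / β)) *
      Real.log (n / (cTau p K f w R * Real.log n ^ (2 * p + ((d₁ + d₂ : ℕ) : ℝ) + a))) *
      ((2 * p + R.card : ℕ) : ℝ) =
      Real.log (cTau p K f w R * Real.log n ^ (2 * p + ((d₁ + d₂ : ℕ) : ℝ) + a) / n)⁻¹ /
        Real.log (1 / β) := by
    rw [inv_div]
    push_cast
    field_simp
  rw [e, rpow_log_div_log hβ hX, hpow]
  ring

/-- The factor `β ^ (T_n - τ_n)`, which does not depend on `n`. -/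
noncomputable def gapFactor (p : ℕ) (β : ℝ) (f : (Fin d₁ ⊕ Fin d₂ → ℝ) → ℝ)
    (w : Fin d₁ ⊕ Fin d₂ → ℝ) (R : Finset (Fin d₁ ⊕ Fin d₂)) : ℝ :=
  β ^ (Real.log (cT p f w R)⁻¹ / ((2 * p + 1) * Real.log (1 / β)))

theorem rpow_bigT (hβ : β ∈ Set.Ioo (0 : ℝ) 1) (n : ℕ) :
    β ^ bigT p K β a f w R n = β ^ tau p K β a f w R n * gapFactor p β f w R := by
  rw [bigT, gapFactor, Real.rpow_add hβ.1]

theorem gapFactor_pos (hβ : β ∈ Set.Ioo (0 : ℝ) 1) : 0 < gapFactor p β f w R :=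
  Real.rpow_pos_of_pos hβ.1 _

theorem gapFactor_pow (hβ : β ∈ Set.Ioo (0 : ℝ) 1) (hC : 0 < cT p f w R) :
    gapFactor p β f w R ^ (2 * p + 1) = cT p f w R := by
  rw [gapFactor, ← Real.rpow_natCast, ← Real.rpow_mul hβ.1.le]
  have e : Real.log (cT p f w R)⁻¹ / ((2 * (p : ℝ) + 1) * Real.log (1 / β)) *
      ((2 * p + 1 : ℕ) : ℝ) = Real.log (cT p f w R)⁻¹ / Real.log (1 / β) := by
    push_cast
    have : (2 * (p : ℝ) + 1) ≠ 0 := by positivity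
    field_simp
  rw [e, rpow_log_div_log hβ hC]

/-- The order of `h_j ^ p` at `h_j = β ^ τ_n / log n` is the rate of convergence. -/
theorem rpow_tau_div_log_pow (hp : 1 ≤ p) (hβ : β ∈ Set.Ioo (0 : ℝ) 1)
    (hC : 0 < cTau p K f w R) {n : ℕ} (hn : 0 < n) (hL : 0 < Real.log n) :
    (β ^ tau p K β a f w R n / Real.log n) ^ p =
      cTau p K f w R ^ ((p : ℝ) / (2 * p + R.card)) * rate p a R n := by
  have hn' : (0 : ℝ) < n := by exact_mod_cast hn
  set v := β ^ tau p K β a f w R n with hv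
  have hv0 : 0 < v := Real.rpow_pos_of_pos hβ.1 _
  have hk : (2 * (p : ℝ) + R.card) ≠ 0 := by positivity
  set γ := (p : ℝ) / (2 * p + R.card) with hγ
  have h1 : v ^ p = (v ^ (2 * p + R.card)) ^ γ := by
    rw [← Real.rpow_natCast v (2 * p + R.card), ← Real.rpow_mul hv0.le,
      ← Real.rpow_natCast v p]
    congr 1
    rw [hγ]
    push_cast
    field_simp
  have hLa := Real.rpow_pos_of_pos hL a
  rw [div_pow, h1, rpow_tau_pow hp hβ hC hn hL, rate, ← hγ, Real.div_rpow (by positivity) hn'.le,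
    Real.mul_rpow (by positivity) hLa.le, Real.mul_rpow (by positivity) (by positivity),
    Real.mul_rpow hC.le (by positivity), Real.rpow_neg hn'.le]
  have h2 : (Real.log n ^ (2 * p)) ^ γ * (Real.log n ^ (d₁ + d₂)) ^ γ * (Real.log n ^ a) ^ γ /
      Real.log n ^ p = Real.log n ^ (γ * (((d₁ + d₂ : ℕ) : ℝ) - R.card + a)) := by
    rw [← Real.rpow_natCast _ (2 * p), ← Real.rpow_natCast _ (d₁ + d₂), ← Real.rpow_natCast _ p,
      ← Real.rpow_mul hL.le, ← Real.rpow_mul hL.le, ← Real.rpow_mul hL.le, ← Real.rpow_add hL,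
      ← Real.rpow_add hL, ← Real.rpow_sub hL]
    congr 1
    have : (p : ℝ) = γ * (2 * p + R.card) := by rw [hγ]; field_simp
    push_cast
    linear_combination -this
  rw [← h2]
  field_simp

open Filter Asymptotics in
theorem eventually_log_pow_le (hp : 1 ≤ p) (hβ : β ∈ Set.Ioo (0 : ℝ) 1) (ha : 0 < a)
    (hC : 0 < cTau p K f w R) {c : ℝ} (hc : 0 < c) : ∀ᶠ n : ℕ in atTop,
      Real.log n / n ≤ c * (β ^ tau p K β a f w R n) ^ R.card / Real.log n ^ (d₁ + d₂) := by
  set γ : ℝ := R.card / (2 * p + R.card) with hγ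
  have hk : 0 < 2 * (p : ℝ) + R.card := by positivity
  have hγ1 : 0 < 1 - γ := by
    rw [hγ, sub_pos, div_lt_one hk]
    have : (1 : ℝ) ≤ p := by exact_mod_cast hp
    linarith
  have hCγ : 0 < c * cTau p K f w R ^ γ := mul_pos hc (Real.rpow_pos_of_pos hC _)
  have h1 := ((isLittleO_log_rpow_rpow_atTop ((d₁ + d₂ + 1 : ℕ) : ℝ) hγ1).comp_tendsto
    tendsto_natCast_atTop_atTop).bound hCγ
  filter_upwards [h1, tendsto_log_natCast.eventually_ge_atTop 1, eventually_ge_atTop 1]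
    with n h hL hn
  have hn' : (0 : ℝ) < n := by exact_mod_cast hn
  have hL0 : 0 < Real.log n := by linarith
  set v := β ^ tau p K β a f w R n with hv
  have hv0 : 0 < v := Real.rpow_pos_of_pos hβ.1 _
  simp only [Function.comp, Real.rpow_natCast, Real.norm_eq_abs] at h
  rw [abs_of_pos (by positivity), abs_of_pos (Real.rpow_pos_of_pos hn' _)] at h
  have h2 : v ^ R.card = (v ^ (2 * p + R.card)) ^ γ := by
    rw [← Real.rpow_natCast v (2 * p + R.card), ← Real.rpow_mul hv0.le,
      ← Real.rpow_natCast v R.card]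
    congr 1
    rw [hγ]
    push_cast
    field_simp
  have h3 : cTau p K f w R / n ≤ v ^ (2 * p + R.card) := by
    rw [rpow_tau_pow hp hβ hC (by omega) hL0]
    have e1 : 1 ≤ Real.log n ^ (2 * p) := one_le_pow₀ hL
    have e2 : 1 ≤ Real.log n ^ (d₁ + d₂) := one_le_pow₀ hL
    have e3 : 1 ≤ Real.log n ^ a := Real.one_le_rpow hL ha.le
    have e4 : 1 ≤ Real.log n ^ (2 * p) * Real.log n ^ (d₁ + d₂) * Real.log n ^ a :=
      one_le_mul_of_one_le_of_one_le (one_le_mul_of_one_le_of_one_le e1 e2) e3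
    refine div_le_div_of_nonneg_right ?_ hn'.le
    calc cTau p K f w R = cTau p K f w R * 1 := (mul_one _).symm
      _ ≤ cTau p K f w R * (Real.log n ^ (2 * p) * Real.log n ^ (d₁ + d₂) * Real.log n ^ a) := by
        gcongr
      _ = _ := by ring
  have h4 : cTau p K f w R ^ γ * (n : ℝ) ^ (1 - γ) / n ≤ v ^ R.card := by
    rw [h2]
    refine le_trans (le_of_eq ?_) (Real.rpow_le_rpow (by positivity) h3 (by positivity))
    rw [Real.div_rpow hC.le hn'.le, Real.rpow_sub hn', Real.rpow_one]
    field_simp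
  rw [le_div_iff₀ (by positivity)]
  calc Real.log n / n * Real.log n ^ (d₁ + d₂) = Real.log n ^ (d₁ + d₂ + 1) / n := by ring
    _ ≤ c * cTau p K f w R ^ γ * (n : ℝ) ^ (1 - γ) / n := by gcongr
    _ = c * (cTau p K f w R ^ γ * (n : ℝ) ^ (1 - γ) / n) := by ring
    _ ≤ c * v ^ R.card := by gcongr

open Filter Asymptotics in
theorem eventually_tau_nonneg (hβ : β ∈ Set.Ioo (0 : ℝ) 1) (hC : 0 < cTau p K f w R) :
    ∀ᶠ n : ℕ in atTop, 0 ≤ tau p K β a f w R n := by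
  have h1 := ((isLittleO_log_rpow_rpow_atTop (2 * p + ((d₁ + d₂ : ℕ) : ℝ) + a)
    one_pos).comp_tendsto tendsto_natCast_atTop_atTop).bound (inv_pos.2 hC)
  filter_upwards [h1, tendsto_log_natCast.eventually_gt_atTop 0, eventually_ge_atTop 1]
    with n h hL hn
  have hn' : (0 : ℝ) < n := by exact_mod_cast hn
  have hLk := Real.rpow_pos_of_pos hL (2 * p + ((d₁ + d₂ : ℕ) : ℝ) + a)
  simp only [Function.comp, Real.rpow_one, Real.norm_eq_abs, abs_of_pos hLk,
    abs_of_pos hn'] at h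
  have hb : 0 < Real.log (1 / β) := Real.log_pos (by rw [lt_div_iff₀ hβ.1]; linarith [hβ.2])
  refine mul_nonneg (by positivity) (Real.log_nonneg ?_)
  rw [le_div_iff₀ (by positivity), one_mul]
  calc _ ≤ cTau p K f w R * ((cTau p K f w R)⁻¹ * n) := by gcongr
    _ = n := by field_simp

end Constants

/-! ### Selection of the bandwidth on the good event -/

section Selection

variable {d₁ d₂ p n : ℕ} {K : ℝ → ℝ} {β a : ℝ} {f : (Fin d₁ ⊕ Fin d₂ → ℝ) → ℝ}
  {w : Fin d₁ ⊕ Fin d₂ → ℝ} {R : Finset (Fin d₁ ⊕ Fin d₂)}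

/-- The scale `√((log n) ^ a / (n ∏ h_k))` of the threshold and of the stochastic error. -/
noncomputable def noiseScale (a : ℝ) (n : ℕ) (h : Fin d₁ ⊕ Fin d₂ → ℝ) : ℝ :=
  Real.sqrt (Real.log n ^ a / (n * ∏ k, h k))

/-- At all bandwidths of the grid at which the loop continues, the estimator and its derivatives
deviate from their expectations by at most `ε` times the scale of the threshold. -/
def IsGood (K : ℝ → ℝ) (β a ε : ℝ) (f : (Fin d₁ ⊕ Fin d₂ → ℝ) → ℝ) (w : Fin d₁ ⊕ Fin d₂ → ℝ)
    (g : (Fin d₁ → ℝ) → ℝ) (W : Fin n → Fin d₁ ⊕ Fin d₂ → ℝ) : Prop :=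
  ∀ θ : Fin d₁ ⊕ Fin d₂ → ℕ, Real.log n / n ≤ ∏ k, gridBandwidth β n θ k →
    |fhat K g W w (gridBandwidth β n θ) - smooth (fun _ => K) f w (gridBandwidth β n θ)| ≤
      ε * noiseScale a n (gridBandwidth β n θ) ∧
    ∀ j, |kernelStat (zKernel K j) g W w (gridBandwidth β n θ) -
        smooth (zKernel K j) f w (gridBandwidth β n θ)| ≤
      ε * noiseScale a n (gridBandwidth β n θ)

theorem IsGood.mono {ε ε' : ℝ} {g : (Fin d₁ → ℝ) → ℝ} {W : Fin n → Fin d₁ ⊕ Fin d₂ → ℝ}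
    (h : IsGood K β a ε f w g W) (hε : ε ≤ ε') : IsGood K β a ε' f w g W := fun θ hθ =>
  ⟨(h θ hθ).1.trans (mul_le_mul_of_nonneg_right hε (Real.sqrt_nonneg _)),
    fun j => ((h θ hθ).2 j).trans (mul_le_mul_of_nonneg_right hε (Real.sqrt_nonneg _))⟩

theorem threshold_eq {h : Fin d₁ ⊕ Fin d₂ → ℝ} {j : Fin d₁ ⊕ Fin d₂} (hj : 0 < h j) :
    threshold K a n h j = 1 / h j * (cLam K (d₁ + d₂) * noiseScale a n h) := by
  have e : Real.log n ^ a / (n * h j ^ 2 * ∏ k, h k) =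
      (1 / h j) ^ 2 * (Real.log n ^ a / (n * ∏ k, h k)) := by
    rw [one_div, inv_pow, ← one_div, div_mul_div_comm, one_mul]
    congr 1
    ring
  rw [threshold, noiseScale, e, Real.sqrt_mul (sq_nonneg _), Real.sqrt_sq (by positivity)]
  ring

theorem abs_statZ_eq (hK : ContDiff ℝ 1 K) (g : (Fin d₁ → ℝ) → ℝ)
    (W : Fin n → Fin d₁ ⊕ Fin d₂ → ℝ) {h : Fin d₁ ⊕ Fin d₂ → ℝ} {j : Fin d₁ ⊕ Fin d₂}
    (hj : 0 < h j) :
    |statZ K g W w h j| = 1 / h j * |kernelStat (zKernel K j) g W w h| := by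
  rw [statZ_eq_kernelStat hK g W w h j hj.ne', abs_mul, abs_neg,
    abs_of_pos (one_div_pos.2 hj)]

theorem abs_statZ_lt_threshold_iff (hK : ContDiff ℝ 1 K) (g : (Fin d₁ → ℝ) → ℝ)
    (W : Fin n → Fin d₁ ⊕ Fin d₂ → ℝ) {h : Fin d₁ ⊕ Fin d₂ → ℝ} {j : Fin d₁ ⊕ Fin d₂}
    (hj : 0 < h j) : |statZ K g W w h j| < threshold K a n h j ↔
      |kernelStat (zKernel K j) g W w h| < cLam K (d₁ + d₂) * noiseScale a n h := by
  rw [abs_statZ_eq hK g W hj, threshold_eq hj]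
  exact mul_lt_mul_iff_right₀ (one_div_pos.2 hj)

theorem threshold_le_abs_statZ_iff (hK : ContDiff ℝ 1 K) (g : (Fin d₁ → ℝ) → ℝ)
    (W : Fin n → Fin d₁ ⊕ Fin d₂ → ℝ) {h : Fin d₁ ⊕ Fin d₂ → ℝ} {j : Fin d₁ ⊕ Fin d₂}
    (hj : 0 < h j) : threshold K a n h j ≤ |statZ K g W w h j| ↔
      cLam K (d₁ + d₂) * noiseScale a n h ≤ |kernelStat (zKernel K j) g W w h| := by
  rw [abs_statZ_eq hK g W hj, threshold_eq hj]
  exact mul_le_mul_iff_right₀ (one_div_pos.2 hj)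

theorem prod_gridBandwidth_commonExponent (t : ℕ) :
    ∏ k, gridBandwidth β n (commonExponent R t) k =
      (β ^ t) ^ R.card / Real.log n ^ (d₁ + d₂) := by
  rw [prod_gridBandwidth]
  congr 1
  · simp only [commonExponent, pow_ite, pow_zero, Finset.prod_ite_mem, Finset.univ_inter,
      Finset.prod_const]
  · simp

theorem prod_pow_le {ι : Type*} [Fintype ι] [DecidableEq ι] (hβ : β ∈ Set.Ioo (0 : ℝ) 1)
    {R : Finset ι} {θ : ι → ℕ} {v : ℝ} (hv : ∀ k ∈ R, β ^ θ k ≤ v) {j : ι} (hj : j ∈ R) :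
    ∏ k, β ^ θ k ≤ β ^ θ j * v ^ (R.card - 1) := by
  rw [← Finset.prod_mul_prod_compl R, ← Finset.mul_prod_erase R _ hj]
  have h0 : ∀ k, 0 ≤ β ^ θ k := fun k => (pow_pos hβ.1 _).le
  have h1 : ∏ k ∈ R.erase j, β ^ θ k ≤ v ^ (R.card - 1) := by
    rw [← Finset.card_erase_of_mem hj, ← Finset.prod_const]
    exact Finset.prod_le_prod (fun k _ => h0 k) fun k hk => hv k (Finset.mem_of_mem_erase hk)
  have h2 : ∏ k ∈ Rᶜ, β ^ θ k ≤ 1 :=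
    Finset.prod_le_one (fun k _ => h0 k) fun k _ => pow_le_one₀ hβ.1.le hβ.2.le
  calc _ ≤ β ^ θ j * (∏ k ∈ R.erase j, β ^ θ k) * 1 :=
        mul_le_mul_of_nonneg_left h2 (mul_nonneg (h0 j) (Finset.prod_nonneg fun k _ => h0 k))
    _ ≤ _ := by rw [mul_one]; exact mul_le_mul_of_nonneg_left h1 (h0 j)

theorem sq_noise_le_of_le_pow {b C L La N : ℝ} {p r d : ℕ} (hb : 0 < b) (hL : 0 < L) (hN : 0 < N)
    (h : C * L ^ (2 * p) * L ^ d * La / N ≤ b ^ (2 * p + r)) :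
    C * (La / (N * (b ^ r / L ^ d))) ≤ ((b / L) ^ p) ^ 2 := by
  have e1 : C * (La / (N * (b ^ r / L ^ d))) =
      C * L ^ (2 * p) * L ^ d * La / N / (L ^ (2 * p) * b ^ r) := by field_simp
  have e2 : ((b / L) ^ p) ^ 2 = b ^ (2 * p + r) / (L ^ (2 * p) * b ^ r) := by
    rw [div_pow, div_pow, ← pow_mul, ← pow_mul, mul_comm p 2, pow_add]
    field_simp
  rw [e1, e2]
  gcongr

theorem pow_sq_le_sq_noise {b v π ϱ C L La N : ℝ} {p r d : ℕ} (hr : 1 ≤ r) (hb : 0 < b)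
    (hv : 0 < v) (hL : 0 < L) (hN : 0 < N) (hπ : 0 < π) (hπv : π ≤ b * v ^ (r - 1) / L ^ d)
    (hbv : b ^ (2 * p + 1) ≤ ϱ ^ 2 * v ^ (2 * p + 1))
    (h : v ^ (2 * p + r) = C * L ^ (2 * p) * L ^ d * La / N) :
    ((b / L) ^ p) ^ 2 ≤ ϱ ^ 2 * (C * (La / (N * π))) := by
  have e : ϱ ^ 2 * (C * (La / (N * π))) = ϱ ^ 2 * (C * La / N) / π := by field_simp
  rw [e, le_div_iff₀ hπ]
  have h1 : C * La / N = v ^ (2 * p + 1) * v ^ (r - 1) / (L ^ (2 * p) * L ^ d) := by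
    rw [← pow_add, show 2 * p + 1 + (r - 1) = 2 * p + r by omega, h]
    field_simp
  calc ((b / L) ^ p) ^ 2 * π ≤ ((b / L) ^ p) ^ 2 * (b * v ^ (r - 1) / L ^ d) := by gcongr
    _ = b ^ (2 * p + 1) * (v ^ (r - 1) / (L ^ (2 * p) * L ^ d)) := by
      rw [div_pow, div_pow, ← pow_mul, ← pow_mul, mul_comm p 2, pow_succ]
      field_simp
    _ ≤ ϱ ^ 2 * v ^ (2 * p + 1) * (v ^ (r - 1) / (L ^ (2 * p) * L ^ d)) := by gcongr
    _ = _ := by rw [h1]; ring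

open Filter in
/-- On the good event the irrelevant coordinates fail their first test. -/
theorem exists_eventually_abs_statZ_lt (hp : 1 ≤ p) (hK : IsKernel p K)
    (hβ : β ∈ Set.Ioo (0 : ℝ) 1) {fX : (Fin d₁ → ℝ) → ℝ} {ρ δ F : ℝ}
    (hwin : IsWindow p fX f w R ρ δ F) : ∃ ε > 0, ∀ᶠ n : ℕ in atTop,
      ∀ (g : (Fin d₁ → ℝ) → ℝ) (W : Fin n → Fin d₁ ⊕ Fin d₂ → ℝ), IsGood K β a ε f w g W →
      ∀ θ : Fin d₁ ⊕ Fin d₂ → ℕ, Real.log n / n ≤ ∏ k, gridBandwidth β n θ k → ∀ j ∉ R,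
        |statZ K g W w (gridBandwidth β n θ) j| < threshold K a n (gridBandwidth β n θ) j := by
  have hC := cLam_pos hK (d₁ + d₂)
  obtain ⟨η, hη, hbias⟩ := exists_bias_bounds hp hK hwin.radius_pos hwin.contDiffOn hwin.sparse
    one_pos
  refine ⟨cLam K (d₁ + d₂) / 2, by positivity, ?_⟩
  filter_upwards [tendsto_log_natCast.eventually_ge_atTop (1 / η),
    tendsto_log_natCast.eventually_gt_atTop 0, eventually_ge_atTop 1]
    with n hnη hL hn1 g W hgood θ hθ j hj
  have hh := gridBandwidth_pos (n := n) hβ hL θ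
  have hη' : 1 / Real.log n ≤ η := (one_div_le hη hL).1 hnη
  have hb := hbias (gridBandwidth β n θ) fun k =>
    ⟨(hh k).le, (gridBandwidth_le hβ hL θ k).trans hη'⟩
  have hn' : (0 : ℝ) < n := by exact_mod_cast hn1
  have hs : 0 < noiseScale a n (gridBandwidth β n θ) := by
    have h1 := Real.rpow_pos_of_pos hL a
    have h2 : 0 < ∏ k, gridBandwidth β n θ k := Finset.prod_pos fun k _ => hh k
    exact Real.sqrt_pos.2 (by positivity)
  rw [abs_statZ_lt_threshold_iff hK.contDiff g W (hh j)]
  have h1 := (hgood θ hθ).2 j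
  rw [hb.1 j hj, sub_zero] at h1
  nlinarith

open Filter in
/-- On the good event a relevant coordinate passes its test while `h_j ^ p` is above
`√C_τ` times the noise, and fails it once `h_j ^ p` is below a smaller multiple of the noise. -/
theorem exists_eventually_bandwidth_mem (hp : 1 ≤ p) (hK : IsKernel p K)
    (hβ : β ∈ Set.Ioo (0 : ℝ) 1) (ha : 0 < a) {fX : (Fin d₁ → ℝ) → ℝ} {ρ δ F : ℝ}
    (hwin : IsWindow p fX f w R ρ δ F) (hR : R.Nonempty) (hD : ∀ j ∈ R, partialD p f j w ≠ 0)
    {ϱ : ℝ} (hϱ0 : 0 ≤ ϱ)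
    (hϱ : 4 * ϱ * (⨆ j : R, |partialD p f j w|) < ⨅ j : R, |partialD p f j w|) :
    ∃ ε > 0, ∀ᶠ n : ℕ in atTop,
      ∀ (g : (Fin d₁ → ℝ) → ℝ) (W : Fin n → Fin d₁ ⊕ Fin d₂ → ℝ), IsGood K β a ε f w g W →
      ∀ m : ℤ, ⌊tau p K β a f w R n⌋ + 1 ≤ m →
        (β ^ m) ^ (2 * p + 1) ≤ ϱ ^ 2 * (β ^ tau p K β a f w R n) ^ (2 * p + 1) →
        bandwidth K β a g W w ∈ bandwidthSet p K β a f w R n m := by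
  obtain ⟨ε₁, hε₁, hoff⟩ := exists_eventually_abs_statZ_lt (a := a) hp hK hβ hwin
  have hCl := cLam_pos hK (d₁ + d₂)
  set Cl := cLam K (d₁ + d₂) with hCldef
  have hCt := cTau_pos hK hR hD
  set bmin := ⨅ j : R, |partialD p f j w| with hbmin
  set bmax := ⨆ j : R, |partialD p f j w| with hbmax
  have hb0 : 0 < bmin := iInf_abs_partialD_pos hR hD
  have hbb : bmin ≤ bmax := iInf_abs_partialD_le_iSup hR
  set M := |∫ t, t ^ p * K t| / ((p - 1).factorial : ℝ) with hM
  have hM0 : 0 < M := div_pos (abs_pos.2 hK.moment_ne_zero)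
    (by exact_mod_cast (p - 1).factorial_pos)
  -- `κ` is the square root of `C_τ`
  set κ := 4 * Cl / (bmin * M) with hκ
  have hκ0 : 0 < κ := by positivity
  have hκsq : κ ^ 2 = cTau p K f w R := by
    have h0 : ((p - 1).factorial : ℝ) ≠ 0 := by exact_mod_cast (p - 1).factorial_ne_zero
    rw [cTau, ← hbmin, ← hCldef, hκ, hM, div_pow, div_pow, mul_pow bmin, mul_pow bmin, div_pow,
      sq_abs]
    field_simp
  -- the tests leave room for an error of size `ε`
  have hgap : ϱ * κ * (bmax * M) < Cl := by
    rw [hκ, ← mul_div_assoc, div_mul_eq_mul_div, div_lt_iff₀ (by positivity)]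
    have := mul_lt_mul_of_pos_right hϱ (mul_pos hCl hM0)
    linarith
  set ε₂ := (Cl - ϱ * κ * (bmax * M)) / (2 * (ϱ * κ + 1)) with hε₂
  have hε₂0 : 0 < ε₂ := div_pos (by linarith) (by positivity)
  have hε₂' : ε₂ * (ϱ * κ + 1) < Cl - ϱ * κ * (bmax * M) := by
    rw [hε₂, div_mul_eq_mul_div, div_lt_iff₀ (by positivity)]
    nlinarith [mul_nonneg hϱ0 hκ0.le]
  set ε := min ε₁ (min (min (bmin * M / 2) Cl) ε₂) with hε
  have hε0 : 0 < ε := lt_min hε₁ (lt_min (lt_min (by positivity) hCl) hε₂0)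
  have hεb : ε ≤ bmin * M / 2 :=
    (min_le_right _ _).trans ((min_le_left _ _).trans (min_le_left _ _))
  have hεC : ε ≤ Cl := (min_le_right _ _).trans ((min_le_left _ _).trans (min_le_right _ _))
  have hεs : ε * (ϱ * κ + 1) < Cl - ϱ * κ * (bmax * M) :=
    (mul_le_mul_of_nonneg_right ((min_le_right _ _).trans (min_le_right _ _))
      (by positivity)).trans_lt hε₂'
  obtain ⟨η, hη, hbias⟩ := exists_bias_bounds hp hK hwin.radius_pos hwin.contDiffOn hwin.sparse
    hε0
  refine ⟨ε, hε0, ?_⟩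
  filter_upwards [hoff, tendsto_log_natCast.eventually_ge_atTop (1 / η),
    tendsto_log_natCast.eventually_gt_atTop 0, eventually_ge_atTop 2,
    eventually_tau_nonneg (a := a) hβ hCt, eventually_log_pow_le hp hβ ha hCt one_pos]
    with n hoffn hnη hL hn2 hτ hcont g W hgood m hm hmϱ
  set τ := tau p K β a f w R n with hτdef
  set v := β ^ τ with hv
  have hv0 : 0 < v := Real.rpow_pos_of_pos hβ.1 _
  have hvpow := rpow_tau_pow (K := K) (a := a) (f := f) (w := w) hp hβ hCt (n := n) (by omega) hL
  rw [← hτdef, ← hv] at hvpow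
  have hn' : (0 : ℝ) < n := by exact_mod_cast (by omega : 0 < n)
  have hη' : 1 / Real.log n ≤ η := (one_div_le hη hL).1 hnη
  have hLa := Real.rpow_pos_of_pos hL a
  -- the mean and the deviation of the statistic of a relevant coordinate
  have hstat : ∀ θ : Fin d₁ ⊕ Fin d₂ → ℕ, Real.log n / n ≤ ∏ k, gridBandwidth β n θ k → ∀ j,
      |(|kernelStat (zKernel K j) g W w (gridBandwidth β n θ)| -
        gridBandwidth β n θ j ^ p * (|partialD p f j w| * M))| ≤
      ε * gridBandwidth β n θ j ^ p + ε * noiseScale a n (gridBandwidth β n θ) := by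
    intro θ hθ j
    have hh := gridBandwidth_pos (n := n) hβ hL θ
    have h1 := (hbias (gridBandwidth β n θ) fun k =>
      ⟨(hh k).le, (gridBandwidth_le hβ hL θ k).trans hη'⟩).2.1 j
    have h2 := (hgood θ hθ).2 j
    set h := gridBandwidth β n θ with hhdef
    set mean := -(partialD p f j w * (-h j) ^ p / p.factorial * (p * ∫ t, t ^ p * K t)) with hmean
    have e : |mean| = h j ^ p * (|partialD p f j w| * M) := by
      have hfac : (p.factorial : ℝ) = p * (p - 1).factorial := by
        exact_mod_cast (Nat.mul_factorial_pred (by omega)).symm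
      have hp0 : (p : ℝ) ≠ 0 := by positivity
      have h0 : ((p - 1).factorial : ℝ) ≠ 0 := by exact_mod_cast (p - 1).factorial_ne_zero
      rw [hmean, abs_neg, abs_mul, abs_div, abs_mul, abs_pow, abs_neg, abs_of_pos (hh j),
        abs_mul, Nat.abs_cast, Nat.abs_cast, hM, hfac]
      field_simp
    rw [← e]
    refine (abs_abs_sub_abs_le_abs_sub _ _).trans ?_
    have h3 : kernelStat (zKernel K j) g W w h - mean =
        (smooth (zKernel K j) f w h + partialD p f j w * (-h j) ^ p / p.factorial *
          (p * ∫ t, t ^ p * K t)) +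
        (kernelStat (zKernel K j) g W w h - smooth (zKernel K j) f w h) := by
      rw [hmean]; ring
    rw [h3]
    exact (abs_add_le _ _).trans (add_le_add h1 h2)
  have hspos : ∀ θ : Fin d₁ ⊕ Fin d₂ → ℕ, 0 < noiseScale a n (gridBandwidth β n θ) := by
    intro θ
    have h2 : 0 < ∏ k, gridBandwidth β n θ k :=
      Finset.prod_pos fun k _ => gridBandwidth_pos hβ hL θ k
    exact Real.sqrt_pos.2 (by positivity)
  have hssq : ∀ θ : Fin d₁ ⊕ Fin d₂ → ℕ, noiseScale a n (gridBandwidth β n θ) ^ 2 =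
      Real.log n ^ a / (n * ∏ k, gridBandwidth β n θ k) := by
    intro θ
    have h2 : 0 < ∏ k, gridBandwidth β n θ k :=
      Finset.prod_pos fun k _ => gridBandwidth_pos hβ hL θ k
    exact Real.sq_sqrt (by positivity)
  have hfloor : ∀ t : ℕ, t < ⌊τ⌋₊ + 1 → v ≤ β ^ t := by
    intro t ht
    have : (t : ℝ) ≤ τ := (Nat.le_floor_iff hτ).1 (by omega)
    rw [← Real.rpow_natCast]
    exact Real.rpow_le_rpow_of_exponent_ge hβ.1 hβ.2.le this
  have hceil : ∀ t : ℕ, ⌊τ⌋₊ + 1 ≤ t → β ^ t ≤ v := by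
    intro t ht
    have : τ ≤ t := ((Nat.floor_lt hτ).1 (by omega)).le
    rw [← Real.rpow_natCast]
    exact Real.rpow_le_rpow_of_exponent_ge hβ.1 hβ.2.le this
  have hfl : ((⌊τ⌋₊ : ℕ) : ℤ) = ⌊τ⌋ := Int.natCast_floor_eq_floor hτ
  lift m to ℕ using by omega
  rw [zpow_natCast] at hmϱ
  have hcont' : ∀ t < ⌊τ⌋₊ + 1,
      Real.log n / n ≤ ∏ k, gridBandwidth β n (commonExponent R t) k := by
    intro t ht
    rw [prod_gridBandwidth_commonExponent]
    refine hcont.trans ?_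
    rw [one_mul]
    have := hfloor t ht
    gcongr
  have hpass : ∀ t < ⌊τ⌋₊ + 1, ∀ j ∈ R,
      threshold K a n (gridBandwidth β n (commonExponent R t)) j ≤
        |statZ K g W w (gridBandwidth β n (commonExponent R t)) j| := by
    intro t ht j hj
    have hh := gridBandwidth_pos (n := n) hβ hL (commonExponent R t)
    rw [threshold_le_abs_statZ_iff hK.contDiff g W (hh j)]
    have hst := (abs_le.1 (hstat _ (hcont' t ht) j)).1
    set s := noiseScale a n (gridBandwidth β n (commonExponent R t)) with hs
    have hs0 : 0 < s := hspos _
    have hhj : gridBandwidth β n (commonExponent R t) j = β ^ t / Real.log n := by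
      simp [gridBandwidth, commonExponent, hj]
    have hbt : 0 < β ^ t := pow_pos hβ.1 t
    have hkey : κ * s ≤ gridBandwidth β n (commonExponent R t) j ^ p := by
      refine le_of_sq_le_sq ?_ (pow_nonneg (hh j).le p)
      rw [mul_pow, hκsq, hssq, prod_gridBandwidth_commonExponent, hhj]
      refine sq_noise_le_of_le_pow hbt hL hn' ?_
      rw [← hvpow]
      exact pow_le_pow_left₀ hv0.le (hfloor t ht) _
    set H := gridBandwidth β n (commonExponent R t) j ^ p with hH
    have hH0 : 0 ≤ H := pow_nonneg (hh j).le p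
    have hDj : bmin * M ≤ |partialD p f j w| * M :=
      mul_le_mul_of_nonneg_right (iInf_abs_partialD_le hj) hM0.le
    have h1 : H * (bmin * M) ≤ H * (|partialD p f j w| * M) :=
      mul_le_mul_of_nonneg_left hDj hH0
    have h2 : ε * H ≤ bmin * M / 2 * H := mul_le_mul_of_nonneg_right hεb hH0
    have h3 : ε * s ≤ Cl * s := mul_le_mul_of_nonneg_right hεC hs0.le
    have h4 : 4 * Cl * s ≤ H * (bmin * M) := by
      have := mul_le_mul_of_nonneg_right hkey (by positivity : 0 ≤ bmin * M)
      calc 4 * Cl * s = κ * s * (bmin * M) := by rw [hκ]; field_simp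
        _ ≤ _ := this
    linarith
  have h_reject : ∀ θ : Fin d₁ ⊕ Fin d₂ → ℕ, Real.log n / n ≤ ∏ k, gridBandwidth β n θ k →
      (∀ k ∈ R, ⌊τ⌋₊ + 1 ≤ θ k) → ∀ j ∈ R, θ j = m →
      |statZ K g W w (gridBandwidth β n θ) j| < threshold K a n (gridBandwidth β n θ) j := by
    intro θ hθ hθR j hj hjm
    have hh := gridBandwidth_pos (n := n) hβ hL θ
    rw [abs_statZ_lt_threshold_iff hK.contDiff g W (hh j)]
    have hst := (abs_le.1 (hstat _ hθ j)).2
    set s := noiseScale a n (gridBandwidth β n θ) with hs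
    have hs0 : 0 < s := hspos _
    have hhj : gridBandwidth β n θ j = β ^ m / Real.log n := by
      simp [gridBandwidth, hjm]
    have hbm : 0 < β ^ m := pow_pos hβ.1 m
    have hkey : gridBandwidth β n θ j ^ p ≤ ϱ * κ * s := by
      refine le_of_sq_le_sq ?_ (by positivity)
      rw [mul_pow, mul_pow, hκsq, hssq, hhj, mul_assoc]
      refine pow_sq_le_sq_noise (Finset.card_pos.2 hR) hbm hv0 hL hn'
        (Finset.prod_pos fun k _ => hh k) ?_ hmϱ hvpow
      rw [prod_gridBandwidth, Fintype.card_sum, Fintype.card_fin, Fintype.card_fin, ← hjm]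
      refine div_le_div_of_nonneg_right ?_ (by positivity)
      exact prod_pow_le hβ (fun k hk => hceil _ (hθR k hk)) hj
    set H := gridBandwidth β n θ j ^ p with hH
    have hH0 : 0 ≤ H := pow_nonneg (hh j).le p
    have hDj : |partialD p f j w| * M ≤ bmax * M :=
      mul_le_mul_of_nonneg_right (le_iSup_abs_partialD hj) hM0.le
    have h1 : H * (|partialD p f j w| * M) ≤ ϱ * κ * s * (bmax * M) :=
      mul_le_mul hkey hDj (by positivity) (by positivity)
    have h2 : ε * H ≤ ε * (ϱ * κ * s) := mul_le_mul_of_nonneg_left hkey hε0.le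
    have h3 := mul_lt_mul_of_pos_right hεs hs0
    linarith
  obtain ⟨θ, hout, hθR, hθ0⟩ := output_eq_gridBandwidth hβ hn2 (by omega) (by omega)
    (fun θ hθ j hj => hoffn g W (hgood.mono (min_le_left _ _)) θ hθ j hj) hcont' hpass h_reject
  refine ⟨fun j => θ j, fun j => ⟨?_, fun hj => ?_, fun hj => by simp [hθ0 j hj]⟩⟩
  · rw [bandwidth, hout, zpow_natCast, gridBandwidth]
  · have := hθR j hj
    rw [← hτdef]
    dsimp only
    omega

end Selection

/-! ### The error of the selected estimator -/

section ErrorBound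

variable {d₁ d₂ p : ℕ} {K : ℝ → ℝ} {β a : ℝ} {f : (Fin d₁ ⊕ Fin d₂ → ℝ) → ℝ}
  {w : Fin d₁ ⊕ Fin d₂ → ℝ} {R : Finset (Fin d₁ ⊕ Fin d₂)}

open Filter in
/-- On the good event the error is dominated by the bias: the stochastic error is a multiple
`ε` of a quantity of the same order, and the factor `2` leaves room for it. -/
theorem exists_eventually_abs_fhat_sub_le (hp : 1 ≤ p) (hK : IsKernel p K)
    (hβ : β ∈ Set.Ioo (0 : ℝ) 1) (ha : 0 < a) {fX : (Fin d₁ → ℝ) → ℝ} {ρ δ F : ℝ}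
    (hwin : IsWindow p fX f w R ρ δ F) (hR : R.Nonempty)
    (hD : ∀ j ∈ R, partialD p f j w ≠ 0) :
    ∃ ε > 0, ∀ᶠ n : ℕ in atTop,
      ∀ (g : (Fin d₁ → ℝ) → ℝ) (W : Fin n → Fin d₁ ⊕ Fin d₂ → ℝ), IsGood K β a ε f w g W →
      ∀ h ∈ bandwidthSet p K β a f w R n ⌈bigT p K β a f w R n⌉,
        |fhat K g W w h - f w| ≤ 2 * R.card * (β ^ tau p K β a f w R n / Real.log n) ^ p *
          ((⨆ j : R, |partialD p f j w|) * (|∫ t, t ^ p * K t| / p.factorial)) := by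
  have hCt := cTau_pos hK hR hD
  have hCT := cT_pos hR hD
  set C := cTau p K f w R with hC
  set bmax := ⨆ j : R, |partialD p f j w| with hbmax
  have hb0 : 0 < bmax := (iInf_abs_partialD_pos hR hD).trans_le (iInf_abs_partialD_le_iSup hR)
  set M := |∫ t, t ^ p * K t| / (p.factorial : ℝ) with hM
  have hM0 : 0 < M := div_pos (abs_pos.2 hK.moment_ne_zero) (by exact_mod_cast p.factorial_pos)
  set u := gapFactor p β f w R with hu
  have hu0 : 0 < u := gapFactor_pos hβ
  have hβ0 := hβ.1
  -- lower bound for the product of the bandwidths, relative to `β ^ (r τ_n) / (log n) ^ d`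
  set c := (u * β) ^ R.card with hc
  have hc0 : 0 < c := by positivity
  have hr1 : (1 : ℝ) ≤ R.card := by exact_mod_cast hR.card_pos
  set ε := R.card * (bmax * M) / (1 / Real.sqrt (C * c) + R.card) with hε
  have hsq : 0 < Real.sqrt (C * c) := Real.sqrt_pos.2 (by positivity)
  have hε0 : 0 < ε := by positivity
  have hεeq : ε * (1 / Real.sqrt (C * c)) + ε * R.card = R.card * (bmax * M) := by
    rw [← mul_add, hε, div_mul_cancel₀]
    positivity
  obtain ⟨η, hη, hbias⟩ := exists_bias_bounds hp hK hwin.radius_pos hwin.contDiffOn hwin.sparse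
    hε0
  refine ⟨ε, hε0, ?_⟩
  filter_upwards [tendsto_log_natCast.eventually_ge_atTop (1 / η),
    tendsto_log_natCast.eventually_gt_atTop 0, eventually_ge_atTop 1,
    eventually_tau_nonneg (a := a) hβ hCt, eventually_log_pow_le hp hβ ha hCt hc0]
    with n hnη hL hn1 hτ hprodle g W hgood h hmem
  set τ := tau p K β a f w R n with hτdef
  set v := β ^ τ with hv
  have hv0 : 0 < v := Real.rpow_pos_of_pos hβ.1 _
  have hvpow := rpow_tau_pow (K := K) (a := a) (f := f) (w := w) hp hβ hCt (n := n) (by omega) hL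
  rw [← hτdef, ← hv, ← hC] at hvpow
  have hn' : (0 : ℝ) < n := by exact_mod_cast hn1
  have hη' : 1 / Real.log n ≤ η := (one_div_le hη hL).1 hnη
  have hLa := Real.rpow_pos_of_pos hL a
  obtain ⟨θz, hθz⟩ := hmem
  have hθnonneg : ∀ j, 0 ≤ θz j := by
    intro j
    by_cases hj : j ∈ R
    · have h1 := ((hθz j).2.1 hj).1
      have h2 : 0 ≤ ⌊τ⌋ := Int.floor_nonneg.2 hτ
      rw [← hτdef] at h1
      omega
    · rw [(hθz j).2.2 hj]
  obtain ⟨θ, rfl⟩ : ∃ θ : Fin d₁ ⊕ Fin d₂ → ℕ, θz = fun j => (θ j : ℤ) :=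
    ⟨fun j => (θz j).toNat, funext fun j => (Int.toNat_of_nonneg (hθnonneg j)).symm⟩
  obtain rfl : h = gridBandwidth β n θ := funext fun j => by
    rw [(hθz j).1, gridBandwidth, zpow_natCast]
  have hh := gridBandwidth_pos (n := n) hβ hL θ
  set y := (v / Real.log n) ^ p with hy
  have hy0 : 0 < y := by positivity
  have hupper : ∀ j ∈ R, gridBandwidth β n θ j ^ p ≤ y := by
    intro j hj
    refine pow_le_pow_left₀ (hh j).le (div_le_div_of_nonneg_right ?_ hL.le) p
    have h1 : τ ≤ θ j := by
      have := Int.floor_lt.1 (Int.lt_iff_add_one_le.2 ((hθz j).2.1 hj).1)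
      exact_mod_cast this.le
    rw [← Real.rpow_natCast]
    exact Real.rpow_le_rpow_of_exponent_ge hβ.1 hβ.2.le h1
  have hlower : c * v ^ R.card / Real.log n ^ (d₁ + d₂) ≤ ∏ k, gridBandwidth β n θ k := by
    have h0 : ∏ k, β ^ θ k = ∏ k ∈ R, β ^ θ k := by
      refine (Finset.prod_subset (Finset.subset_univ R) fun k _ hk => ?_).symm
      have := (hθz k).2.2 hk
      rw [Int.natCast_eq_zero.1 this, pow_zero]
    rw [prod_gridBandwidth, h0, Fintype.card_sum, Fintype.card_fin, Fintype.card_fin, hc,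
      ← mul_pow, ← Finset.prod_const]
    refine div_le_div_of_nonneg_right (Finset.prod_le_prod (fun _ _ => by positivity)
      fun j hj => ?_) (by positivity)
    have h1 : (θ j : ℝ) ≤ bigT p K β a f w R n + 1 := by
      have h2 : ((θ j : ℤ) : ℝ) ≤ (⌈bigT p K β a f w R n⌉ : ℝ) := by
        exact_mod_cast ((hθz j).2.1 hj).2
      have h3 := Int.ceil_lt_add_one (bigT p K β a f w R n)
      push_cast at h2
      linarith
    have h4 : u * β * v = β ^ (bigT p K β a f w R n + 1) := by
      rw [Real.rpow_add_one hβ0.ne', rpow_bigT hβ]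
      ring
    rw [h4, ← Real.rpow_natCast]
    exact Real.rpow_le_rpow_of_exponent_ge hβ.1 hβ.2.le h1
  have hloop := hprodle.trans hlower
  have hnoise : noiseScale a n (gridBandwidth β n θ) ≤ 1 / Real.sqrt (C * c) * y := by
    refine Real.sqrt_le_iff.2 ⟨by positivity, ?_⟩
    rw [mul_pow, div_pow, one_pow, Real.sq_sqrt (by positivity)]
    have h1 := sq_noise_le_of_le_pow (p := p) hv0 hL hn' hvpow.ge
    calc Real.log n ^ a / (n * ∏ k, gridBandwidth β n θ k)
        ≤ Real.log n ^ a / (n * (c * v ^ R.card / Real.log n ^ (d₁ + d₂))) := by gcongr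
      _ = 1 / (C * c) * (C * (Real.log n ^ a / (n * (v ^ R.card / Real.log n ^ (d₁ + d₂))))) := by
        field_simp
      _ ≤ 1 / (C * c) * y ^ 2 := by gcongr
  have hdev := (hgood θ hloop).1
  have hbiasn := (hbias (gridBandwidth β n θ) fun k =>
    ⟨(hh k).le, (gridBandwidth_le hβ hL θ k).trans hη'⟩).2.2
  have hsum : ∑ j ∈ R, gridBandwidth β n θ j ^ p *
      (|partialD p f j w| * |∫ t, t ^ p * K t| / p.factorial + ε) ≤
      R.card * (y * (bmax * M + ε)) := by
    rw [← nsmul_eq_mul]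
    refine Finset.sum_le_card_nsmul _ _ _ fun j hj => ?_
    rw [mul_div_assoc]
    have h1 := le_iSup_abs_partialD (p := p) (f := f) (w := w) hj
    have h2 := hupper j hj
    gcongr
  calc |fhat K g W w (gridBandwidth β n θ) - f w|
      ≤ ε * noiseScale a n (gridBandwidth β n θ) + ∑ j ∈ R, gridBandwidth β n θ j ^ p *
        (|partialD p f j w| * |∫ t, t ^ p * K t| / p.factorial + ε) :=
        (abs_sub_le _ _ _).trans (add_le_add hdev hbiasn)
    _ ≤ ε * (1 / Real.sqrt (C * c) * y) + R.card * (y * (bmax * M + ε)) := by gcongr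
    _ = y * (ε * (1 / Real.sqrt (C * c)) + ε * R.card) + R.card * y * (bmax * M) := by ring
    _ = _ := by rw [hεeq]; ring

open Filter in
theorem eventually_le_errorConst (hp : 1 ≤ p) (hK : IsKernel p K) (hβ : β ∈ Set.Ioo (0 : ℝ) 1)
    {fX : (Fin d₁ → ℝ) → ℝ} (hfX : ∀ x, 0 ≤ fX x) {ρ δ F : ℝ}
    (hwin : IsWindow p fX f w R ρ δ F) (hR : R.Nonempty)
    (hD : ∀ j ∈ R, partialD p f j w ≠ 0) :
    ∀ᶠ n : ℕ in atTop, 2 * R.card * (β ^ tau p K β a f w R n / Real.log n) ^ p *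
        ((⨆ j : R, |partialD p f j w|) * (|∫ t, t ^ p * K t| / p.factorial)) ≤
      errorConst p K f w R fX n * rate p a R n := by
  have hCt := cTau_pos hK hR hD
  have hCT := cT_pos hR hD
  -- near `w` the derivatives are bounded, so that `supOn` is a true supremum, not a junk value
  have hev : ∀ᶠ u in nhds w, ∀ j, |partialD p f j u| ≤ |partialD p f j w| + 1 := by
    refine eventually_all.2 fun j => ?_
    have hc := ((continuousOn_partialD Metric.isOpen_ball j p hwin.contDiffOn).continuousAt
      (Metric.isOpen_ball.mem_nhds (Metric.mem_ball_self hwin.radius_pos))).abs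
    exact (hc.eventually_lt_const (by linarith)).mono fun u hu => hu.le
  obtain ⟨r, hr, hball⟩ := Metric.eventually_nhds_iff_ball.1 hev
  filter_upwards [eventually_sub_mul_mem_ball hK.compactSupport w hr,
    tendsto_log_natCast.eventually_gt_atTop 0, eventually_ge_atTop 1] with n hmem hL hn1
  have hw : w ∈ nbhdN K n w := ⟨fun _ => 0, fun _ => interior_subset hK.zero_mem, by simp⟩
  have hsup : ∀ j, |partialD p f j w| ≤ supOn (partialD p f j) (nbhdN K n w) := by
    intro j
    refine le_csSup ⟨|partialD p f j w| + 1, ?_⟩ ⟨w, hw, rfl⟩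
    rintro _ ⟨u, ⟨z, hz, hzu⟩, rfl⟩
    refine hball u ?_ j
    obtain rfl : u = fun k => w k - initBandwidth _ n k * z k := funext hzu
    exact hmem _ (fun k => ⟨one_div_nonneg.2 hL.le, le_rfl⟩) z hz
  have hbmax : (⨆ j : R, |partialD p f j w|) ≤ ⨆ j : R, supOn (partialD p f j) (nbhdN K n w) :=
    ciSup_mono (Set.finite_range _).bddAbove fun j => hsup j
  have hmom : |∫ t, t ^ p * K t| / p.factorial ≤ ∫ t, |t ^ p / (p.factorial : ℝ) * K t| := by
    have e : ∫ t, t ^ p / (p.factorial : ℝ) * K t = (∫ t, t ^ p * K t) / p.factorial := by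
      rw [← integral_div]
      congr 1 with t
      ring
    have h1 := abs_integral_le_integral_abs (μ := volume) (f := fun t => t ^ p / (p.factorial : ℝ) * K t)
    rwa [e, abs_div, Nat.abs_cast] at h1
  have h0 : 0 ≤ ⨆ j : R, |partialD p f j w| := Real.iSup_nonneg fun j => abs_nonneg _
  have hrate : 0 ≤ rate p a R n := mul_nonneg (Real.rpow_nonneg hL.le _)
    (Real.rpow_nonneg (Nat.cast_nonneg n) _)
  have hsupf : 0 ≤ supOn f (nbhdN K n w) :=
    Real.sSup_nonneg (by rintro _ ⟨u, -, rfl⟩; exact abs_nonneg _)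
  have hinf : 0 ≤ infOn fX (nbhdN K n (xPart w)) :=
    Real.sInf_nonneg (by rintro _ ⟨u, -, rfl⟩; exact hfX u)
  have hl2 : 0 ≤ l2norm K := Real.sqrt_nonneg _
  rw [rpow_tau_div_log_pow hp hβ hCt (by omega) hL, errorConst, add_mul]
  have hCγ := Real.rpow_nonneg hCt.le ((p : ℝ) / (2 * p + R.card))
  refine le_add_of_le_of_nonneg ?_ (mul_nonneg ?_ hrate)
  · calc _ = 2 * R.card * cTau p K f w R ^ ((p : ℝ) / (2 * p + R.card)) *
          ((|∫ t, t ^ p * K t| / p.factorial) * (⨆ j : R, |partialD p f j w|)) *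
            rate p a R n := by ring
      _ ≤ 2 * R.card * cTau p K f w R ^ ((p : ℝ) / (2 * p + R.card)) *
          ((∫ t, |t ^ p / (p.factorial : ℝ) * K t|) *
            ⨆ j : R, supOn (partialD p f j) (nbhdN K n w)) * rate p a R n := by gcongr
      _ = _ := by ring
  · have h1 := Real.rpow_nonneg hsupf ((1 : ℝ) / 2)
    have h2 := Real.rpow_nonneg hinf (-(1 : ℝ) / 2)
    have h3 := Real.rpow_nonneg hCT.le (-(R.card : ℝ) / (2 * (2 * p + 1)))
    have h4 := Real.rpow_nonneg hCt.le (-(R.card : ℝ) / (2 * (2 * p + R.card)))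
    positivity

end ErrorBound

/-! ### Conclusion -/

section Conclusion

variable {d₁ d₂ p : ℕ} {K : ℝ → ℝ} {β a : ℝ} {f : (Fin d₁ ⊕ Fin d₂ → ℝ) → ℝ}
  {w : Fin d₁ ⊕ Fin d₂ → ℝ} {R : Finset (Fin d₁ ⊕ Fin d₂)}

open Filter Asymptotics in
theorem exists_eventually_bandwidth_mem_of_empty (hp : 1 ≤ p) (hK : IsKernel p K)
    (hβ : β ∈ Set.Ioo (0 : ℝ) 1) {fX : (Fin d₁ → ℝ) → ℝ} {ρ δ F : ℝ}
    (hwin : IsWindow p fX f w ∅ ρ δ F) :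
    ∃ ε > 0, ∀ᶠ n : ℕ in atTop,
      ∀ (g : (Fin d₁ → ℝ) → ℝ) (W : Fin n → Fin d₁ ⊕ Fin d₂ → ℝ), IsGood K β a ε f w g W →
      ∀ m : ℤ, bandwidth K β a g W w ∈ bandwidthSet p K β a f w ∅ n m := by
  obtain ⟨ε, hε, hoff⟩ := exists_eventually_abs_statZ_lt (a := a) hp hK hβ hwin
  refine ⟨ε, hε, ?_⟩
  have h1 := ((isLittleO_log_rpow_rpow_atTop ((d₁ + d₂ + 1 : ℕ) : ℝ) one_pos).comp_tendsto
    tendsto_natCast_atTop_atTop).bound one_pos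
  filter_upwards [hoff, h1, tendsto_log_natCast.eventually_gt_atTop 0, eventually_ge_atTop 2]
    with n hoffn hlog hL hn2 g W hgood m
  have hn' : (0 : ℝ) < n := by exact_mod_cast (by omega : 0 < n)
  simp only [Function.comp, Real.rpow_natCast, Real.rpow_one, Real.norm_eq_abs, one_mul,
    abs_of_pos hn', abs_of_pos (pow_pos hL _)] at hlog
  have hcont : ∀ t < 1, Real.log n / n ≤
      ∏ k, gridBandwidth β n (commonExponent (∅ : Finset (Fin d₁ ⊕ Fin d₂)) t) k := by
    intro t _
    rw [prod_gridBandwidth_commonExponent, Finset.card_empty, pow_zero,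
      div_le_div_iff₀ hn' (by positivity), one_mul, ← pow_succ']
    exact hlog
  obtain ⟨θ, hout, -, hθ0⟩ := output_eq_gridBandwidth (Z := statZ K g W w)
    (lam := threshold K a n) (R := ∅) (t₁ := 1) (m := 1) hβ hn2 le_rfl one_pos
    (hoffn g W hgood) hcont (by simp) (by simp)
  refine ⟨fun j => θ j, fun j => ⟨?_, by simp, fun hj => by simp [hθ0 j hj]⟩⟩
  rw [bandwidth, hout, zpow_natCast, gridBandwidth]

/-- All the assertions hold on the good event, for a suitable `ε`. -/
theorem exists_eventually_of_isGood (hp : 1 ≤ p) (hK : IsKernel p K)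
    (hβ : β ∈ Set.Ioo (0 : ℝ) 1) (ha : 0 < a) {fX : (Fin d₁ → ℝ) → ℝ}
    (hfX : ∀ x, 0 ≤ fX x) {ρ δ F : ℝ}
    (hwin : IsWindow p fX f w R ρ δ F) (hD : ∀ j ∈ R, partialD p f j w ≠ 0) :
    ∃ ε > 0, ∀ᶠ n : ℕ in Filter.atTop,
      ∀ (g : (Fin d₁ → ℝ) → ℝ) (W : Fin n → Fin d₁ ⊕ Fin d₂ → ℝ), IsGood K β a ε f w g W →
      bandwidth K β a g W w ∈ bandwidthSet p K β a f w R n ⌈bigT p K β a f w R n⌉ ∧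
      (1 < 36 * β ^ (2 * p + 1) →
        bandwidth K β a g W w ∈ bandwidthSet p K β a f w R n ⌊bigT p K β a f w R n⌋) ∧
      (R.Nonempty → |fhat K g W w (bandwidth K β a g W w) - f w| ≤
        errorConst p K f w R fX n * rate p a R n) := by
  rcases R.eq_empty_or_nonempty with rfl | hR
  · obtain ⟨ε, hε, hmem⟩ := exists_eventually_bandwidth_mem_of_empty (a := a) hp hK hβ hwin
    refine ⟨ε, hε, hmem.mono fun n h g W hgood => ⟨h g W hgood _, fun _ => h g W hgood _, ?_⟩⟩
    simp
  have hb0 : 0 < ⨅ j : R, |partialD p f j w| := iInf_abs_partialD_pos hR hD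
  have hb1 : 0 < ⨆ j : R, |partialD p f j w| := hb0.trans_le (iInf_abs_partialD_le_iSup hR)
  set bmin := ⨅ j : R, |partialD p f j w| with hbmin
  set bmax := ⨆ j : R, |partialD p f j w| with hbmax
  have hCT := cT_pos hR hD
  have hCT' : cT p f w R * (576 * bmax ^ 2) = bmin ^ 2 := by
    rw [cT, ← hbmin, ← hbmax]
    field_simp
    norm_num
  have hβ0 := hβ.1
  have hu0 := gapFactor_pos (p := p) (f := f) (w := w) (R := R) hβ
  have hupow := gapFactor_pow hβ hCT
  have hlogβ : 0 < Real.log (1 / β) :=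
    Real.log_pos (by rw [lt_div_iff₀ hβ0]; linarith [hβ.2])
  have hgap0 : 0 < Real.log (cT p f w R)⁻¹ / ((2 * p + 1) * Real.log (1 / β)) := by
    refine div_pos (Real.log_pos ?_) (by positivity)
    exact (one_lt_inv₀ hCT).2 ((cT_le hR hD).trans_lt (by norm_num))
  obtain ⟨ε₁, hε₁, h₁⟩ := exists_eventually_bandwidth_mem hp hK hβ ha hwin hR hD
    (Real.sqrt_nonneg (cT p f w R)) (by
      refine lt_of_pow_lt_pow_left₀ 2 hb0.le ?_
      rw [mul_pow, mul_pow, Real.sq_sqrt hCT.le, ← hCT']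
      nlinarith [mul_pos hCT (pow_pos hb1 2)])
  obtain ⟨ε₂, hε₂, h₂⟩ := exists_eventually_abs_fhat_sub_le hp hK hβ ha hwin hR hD
  have hfloor : ∃ ε > 0, ∀ᶠ n : ℕ in Filter.atTop,
      ∀ (g : (Fin d₁ → ℝ) → ℝ) (W : Fin n → Fin d₁ ⊕ Fin d₂ → ℝ), IsGood K β a ε f w g W →
      1 < 36 * β ^ (2 * p + 1) →
        bandwidth K β a g W w ∈ bandwidthSet p K β a f w R n ⌊bigT p K β a f w R n⌋ := by
    by_cases hβ36 : 1 < 36 * β ^ (2 * p + 1)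
    swap
    · exact ⟨1, one_pos, Filter.Eventually.of_forall fun n g W _ h => absurd h hβ36⟩
    have hpow : 0 < β ^ (2 * p + 1) := pow_pos hβ0 _
    obtain ⟨ε, hε, h⟩ := exists_eventually_bandwidth_mem hp hK hβ ha hwin hR hD
      (Real.sqrt_nonneg (cT p f w R / β ^ (2 * p + 1))) (by
        refine lt_of_pow_lt_pow_left₀ 2 hb0.le ?_
        rw [mul_pow, mul_pow, Real.sq_sqrt (by positivity), ← hCT', mul_div_assoc', div_mul_eq_mul_div,
          div_lt_iff₀ hpow]
        have := mul_pos hCT (pow_pos hb1 2)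
        nlinarith)
    refine ⟨ε, hε, h.mono fun n hn g W hgood _ => hn g W hgood _ ?_ ?_⟩
    · -- the condition on `β` says that `T_n - τ_n ≥ 1`
      have hgap1 : 1 ≤ Real.log (cT p f w R)⁻¹ / ((2 * p + 1) * Real.log (1 / β)) := by
        rw [le_div_iff₀ (by positivity), one_mul]
        have e : (2 * (p : ℝ) + 1) * Real.log (1 / β) = Real.log (β ^ (2 * p + 1))⁻¹ := by
          rw [Real.log_inv, Real.log_pow, one_div, Real.log_inv]
          push_cast
          ring
        rw [e]
        refine Real.log_le_log (by positivity) (inv_anti₀ hCT ?_)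
        have := cT_le (p := p) (f := f) hR hD
        linarith
      rw [Int.le_floor]
      have := Int.floor_le (tau p K β a f w R n)
      push_cast
      rw [bigT]
      linarith
    · rw [Real.sq_sqrt (by positivity), ← hupow]
      have h1 : β ^ ⌊bigT p K β a f w R n⌋ ≤
          β ^ tau p K β a f w R n * gapFactor p β f w R / β := by
        rw [← rpow_bigT hβ, ← Real.rpow_sub_one hβ0.ne', ← Real.rpow_intCast]
        refine Real.rpow_le_rpow_of_exponent_ge hβ0 hβ.2.le ?_
        linarith [Int.lt_floor_add_one (bigT p K β a f w R n)]
      refine (pow_le_pow_left₀ (zpow_pos hβ0 _).le h1 _).trans (le_of_eq ?_)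
      rw [div_pow, mul_pow]
      ring
  obtain ⟨ε₃, hε₃, h₃⟩ := hfloor
  refine ⟨min ε₁ (min ε₂ ε₃), lt_min hε₁ (lt_min hε₂ hε₃), ?_⟩
  filter_upwards [h₁, h₂, h₃, eventually_le_errorConst (a := a) hp hK hβ hfX hwin hR hD]
    with n hn₁ hn₂ hn₃ hn₄ g W hgood
  have hceil : bandwidth K β a g W w ∈
      bandwidthSet p K β a f w R n ⌈bigT p K β a f w R n⌉ := by
    refine hn₁ g W (hgood.mono (min_le_left _ _)) _ ?_ ?_
    · refine Int.add_one_le_iff.2 (Int.lt_ceil.2 ?_)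
      have := Int.floor_le (tau p K β a f w R n)
      rw [bigT]
      linarith
    · rw [Real.sq_sqrt hCT.le, ← hupow]
      have h1 : β ^ ⌈bigT p K β a f w R n⌉ ≤
          β ^ tau p K β a f w R n * gapFactor p β f w R := by
        rw [← rpow_bigT hβ, ← Real.rpow_intCast]
        exact Real.rpow_le_rpow_of_exponent_ge hβ0 hβ.2.le (Int.le_ceil _)
      refine (pow_le_pow_left₀ (zpow_pos hβ0 _).le h1 _).trans (le_of_eq ?_)
      rw [mul_pow]
      ring
  exact ⟨hceil, hn₃ g W (hgood.mono ((min_le_right _ _).trans (min_le_right _ _))),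
    fun _ => (hn₂ g W (hgood.mono ((min_le_right _ _).trans (min_le_left _ _))) _ hceil).trans hn₄⟩

theorem one_sub_le_measureReal {Ω : Type*} [MeasurableSpace Ω] {P : Measure Ω}
    [IsProbabilityMeasure P] {E G : Set Ω} {x : ℝ} (hE : P.real E ≤ x) (h : ∀ ω ∉ E, ω ∈ G) :
    1 - x ≤ P.real G := by
  have h1 : P.real Set.univ ≤ P.real (E ∪ G) := measureReal_mono fun ω _ => by
    by_cases hω : ω ∈ E
    · exact Or.inl hω
    · exact Or.inr (h ω hω)
  have h2 := measureReal_union_le (μ := P) E G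
  rw [probReal_univ] at h1
  linarith

end Conclusion

end CDRodeo

theorem theorem1
    {d₁ d₂ p : ℕ} (hp : 1 ≤ p)
    (K : ℝ → ℝ) (hK : IsKernel p K)
    (β a : ℝ) (hβ : β ∈ Set.Ioo (0 : ℝ) 1) (ha : 1 < a)
    (fX : (Fin d₁ → ℝ) → ℝ) (f : (Fin d₁ ⊕ Fin d₂ → ℝ) → ℝ) (hf : IsCondDensity fX f)
    (w : Fin d₁ ⊕ Fin d₂ → ℝ) (R : Finset (Fin d₁ ⊕ Fin d₂))
    (n₀ : ℕ) (hn₀ : 2 ≤ n₀)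
    (A1 : 0 < infOn fX (nbhdN K n₀ (xPart w)))
    (A2 : IsSparse K n₀ f w R)
    (A3 : IsRegular p K n₀ f w R)
    (MX : ℝ) (hMX : 0 < MX) (q : ℝ) (hq : 0 < q) :
    ∃ N : ℕ, ∀ n : ℕ, N ≤ n →
      ∀ (Ω : Type*) [MeasurableSpace Ω] (P : Measure Ω) [IsProbabilityMeasure P]
        (W : Fin n → Ω → Fin d₁ ⊕ Fin d₂ → ℝ) (fXtilde : Ω → (Fin d₁ → ℝ) → ℝ),
        IsSample P W fX f →
        EstimatorConditions P K (d₁ + d₂) n fX (xPart w) MX fXtilde →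
        (1 - (n : ℝ) ^ (-q) ≤
            P.real {ω | bandwidth K β a (fXtilde ω) (fun i => W i ω) w ∈
              bandwidthSet p K β a f w R n ⌈bigT p K β a f w R n⌉}) ∧
        (1 < 36 * β ^ (2 * p + 1) →
          1 - (n : ℝ) ^ (-q) ≤
            P.real {ω | bandwidth K β a (fXtilde ω) (fun i => W i ω) w ∈
              bandwidthSet p K β a f w R n ⌊bigT p K β a f w R n⌋}) ∧
        (R.Nonempty →
          1 - 2 * (n : ℝ) ^ (-q) ≤
            P.real {ω | |fhat K (fXtilde ω) (fun i => W i ω) w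
                (bandwidth K β a (fXtilde ω) (fun i => W i ω) w) - f w| ≤
              errorConst p K f w R fX n * rate p a R n}) := by
  obtain ⟨ρ, δ, F, hwin⟩ := exists_isWindow hK hn₀ A1 A2 A3
  obtain ⟨ε, hε, hdet⟩ := exists_eventually_of_isGood hp hK hβ (by linarith : 0 < a) hf.nonneg_fX
    hwin A3.2
  let φ : Option (Fin d₁ ⊕ Fin d₂) → Fin d₁ ⊕ Fin d₂ → ℝ → ℝ := fun c =>
    c.elim (fun _ => K) fun j => zKernel K j
  have hφc : ∀ c k, Continuous (φ c k) := by
    rintro (_ | j) k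
    · exact hK.contDiff.continuous
    · exact continuous_zKernel hK.contDiff j k
  have hφ0 : ∀ c k, ∀ t ∉ tsupport K, φ c k t = 0 := by
    rintro (_ | j) k t ht
    · exact image_eq_zero_of_notMem_tsupport ht
    · exact zKernel_eq_zero j k ht
  have hprob := eventually_exists_good_event hK hβ ha hf hwin hφc hφ0 q hMX hε
  obtain ⟨N, hN⟩ := Filter.eventually_atTop.1 (hdet.and hprob)
  refine ⟨N, fun n hn Ω _ P _ W g hW hg => ?_⟩
  obtain ⟨hdetn, hprobn⟩ := hN n hn
  obtain ⟨E, hE, hgood⟩ := hprobn Ω P W g hW hg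
  have hcond : ∀ ω ∉ E, IsGood K β a ε f w (g ω) fun i => W i ω := fun ω hω θ hθ =>
    ⟨hgood ω hω θ hθ none, fun j => hgood ω hω θ hθ (some j)⟩
  have hq0 : 0 ≤ (n : ℝ) ^ (-q) := Real.rpow_nonneg (Nat.cast_nonneg n) _
  exact ⟨one_sub_le_measureReal hE fun ω hω => (hdetn _ _ (hcond ω hω)).1,
    fun hβ36 => one_sub_le_measureReal hE fun ω hω => (hdetn _ _ (hcond ω hω)).2.1 hβ36,
    fun hR => one_sub_le_measureReal (by linarith : P.real E ≤ 2 * (n : ℝ) ^ (-q))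
      fun ω hω => (hdetn _ _ (hcond ω hω)).2.2 hR⟩
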